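/- Let $i\mathsf{RCA}_0$ be the following theory in two-sorted intuitionistic predicate logic with equality between numbers; the sorts are natural numbers and functions $\mathbb N\to\mathbb N$, and sets of numbers are represented by characteristic functions. The language has symbols for all functionals (with number arguments) that are primitive recursive in the function variables. The axioms are the successor axioms $t+1\neq 0$ and $s+1=t+1\to s=t$, the defining equations of the primitive recursive functionals, induction for quantifier-free formulas, and the choice scheme $\forall x\,\exists y\,\varphi(x,y)\to\exists f\,\forall x\,\varphi(x,f(x))$ for quantifier-free $\varphi$. Number and function parameters are allowed in all schemes. Fix the primitive recursive bijections $(a,b)\mapsto b(b-1)/2+a$ from $\{(a,b)\mid a<b\}$ onto $\mathbb N$ and $(i,n)\mapsto (i+n+1)(i+n)/2+i$ from $\mathbb N\times\mathbb N$ onto $\mathbb N$. A function $f$ codes the sequence $\langle f_i\rangle_{i\in\mathbb N}$ with $f_i(n)=f(i,n)$, the value of $f$ at the code of $(i,n)$. A function $e$ codes the graph with vertex set $\mathbb N$ in which $a<b$ are adjacent iff the value of $e$ at the code of $(a,b)$ is not $0$. For a graph $G$, let $G_m$ be its subgraph induced on $\{0,\dots,m\}$. A $k$-coloring of $G_m$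 is a function from $\{0,\dots,m\}$ to $\{0,\dots,k-1\}$ (coded by a number below $k^{m+1}$ through base $k$ digits) that takes different values at adjacent vertices. Consider the following. - $\mathsf{ACA}_0$ (arithmetical comprehension): for every formula $\varphi(n)$ without function quantifiers, possibly with parameters, there is a function $f$ such that, for all $n$, $f(n)\in\{0,1\}$ and $f(n)=1\leftrightarrow\varphi(n)$. - $\widehat{\mathsf{LPO}}$: for every sequence of functions $\langle f_i\rangle_{i\in\mathbb N}$ there is a function $g$ such that, for every $i$, if $g(i)=0$ then $f_i(n)>0$ for all $n$, and if $g(i)>0$ then $f_i(g(i)-1)=0$ and $f_i(t)>0$ for all $t<g(i)-1$. - $\widehat{\mathsf{LG}k}$: for every sequence of graphs $\langle G^i\rangle_{i\in\mathbb N}$ there is a function $g$ such that, for every $i$, if $g(i)=0$ then every $G^i_m$ has a $k$-coloring, and if $g(i)>0$ then $G^i_{g(i)}$ has no $k$-coloring and $G^i_t$ has a $k$-coloring for every $t<g(i)$. Then, over $i\mathsf{RCA}_0$, the following are equivalent: $\mathsf{ACA}_0$; $\widehat{\mathsf{LPO}}$; and, for any $k\ge 1$, $\widehat{\mathsf{LG}k}$.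 That is, for each natural number $k\ge1$, adding any one of the three to $i\mathsf{RCA}_0$ lets one prove (each instance of) the other two. The equivalence is also uniform in $k$: $i\mathsf{RCA}_0$ proves $\forall k\,(k\ge 1\to(\widehat{\mathsf{LPO}}\leftrightarrow\widehat{\mathsf{LG}k}))$. -/

import Mathlib

namespace SecondOrder

/-! ### The language

Two sorts: natural numbers, and functions from numbers to numbers. A set of numbers is given by its
characteristic function. Variables are de Bruijn indices, with one separate supply for each sort. -/

/-- `FTerm n`: symbols for `n`-ary functionals that are primitive recursive in the function
variables. The symbol `prec f g` is read: `prec f g (0, v) = f v` and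
`prec f g (x + 1, v) = g (x, prec f g (x, v), v)`. -/
inductive FTerm : ℕ → Type
  | var (v : ℕ) : FTerm 1
  | zero : FTerm 0
  | succ : FTerm 1
  | proj {n : ℕ} (i : Fin n) : FTerm n
  | comp {m n : ℕ} (f : FTerm m) (g : Fin m → FTerm n) : FTerm n
  | prec {n : ℕ} (f : FTerm n) (g : FTerm (n + 2)) : FTerm (n + 1)

/-- Terms of the number sort. -/
inductive Term : Type
  | var (x : ℕ) : Term
  | app {n : ℕ} (F : FTerm n) (ts : Fin n → Term) : Term

/-- Formulas; the only atomic formulas besides `⊥` are equations between numbers. -/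
inductive Formula : Type
  | bot : Formula
  | eq (s t : Term) : Formula
  | and (φ ψ : Formula) : Formula
  | or (φ ψ : Formula) : Formula
  | imp (φ ψ : Formula) : Formula
  | allN (φ : Formula) : Formula
  | exN (φ : Formula) : Formula
  | allF (φ : Formula) : Formula
  | exF (φ : Formula) : Formula

/-! ### Substitution -/

/-- Simultaneous substitution of unary functionals for function variables. -/
def FTerm.subst (τ : ℕ → FTerm 1) : {n : ℕ} → FTerm n → FTerm n
  | _, .var v => τ v
  | _, .zero => .zero
  | _, .succ => .succ
  | _, .proj i => .proj i
  | _, .comp f g => .comp (f.subst τ) (fun i => (g i).subst τ)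
  | _, .prec f g => .prec (f.subst τ) (g.subst τ)

/-- Simultaneous substitution in a number term. -/
def Term.subst (σ : ℕ → Term) (τ : ℕ → FTerm 1) : Term → Term
  | .var x => σ x
  | .app F ts => .app (F.subst τ) (fun i => (ts i).subst σ τ)

/-- Raise all number variables by one. -/
def Term.shiftN (t : Term) : Term := t.subst (fun x => .var (x + 1)) .var

/-- Raise all function variables by one. -/
def Term.shiftF (t : Term) : Term := t.subst .var (fun v => .var (v + 1))

/-- Raise all function variables by one. -/
def FTerm.shiftF {n : ℕ} (F : FTerm n) : FTerm n := F.subst (fun v => .var (v + 1))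

/-- A number substitution, carried under a number quantifier. -/
def liftN (σ : ℕ → Term) : ℕ → Term
  | 0 => .var 0
  | x + 1 => (σ x).shiftN

/-- A function substitution, carried under a function quantifier. -/
def liftF (τ : ℕ → FTerm 1) : ℕ → FTerm 1
  | 0 => .var 0
  | v + 1 => (τ v).shiftF

/-- Capture-avoiding simultaneous substitution in a formula. -/
def Formula.subst : Formula → (ℕ → Term) → (ℕ → FTerm 1) → Formula
  | .bot, _, _ => .bot
  | .eq s t, σ, τ => .eq (s.subst σ τ) (t.subst σ τ)
  | .and φ ψ, σ, τ => .and (φ.subst σ τ) (ψ.subst σ τ)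
  | .or φ ψ, σ, τ => .or (φ.subst σ τ) (ψ.subst σ τ)
  | .imp φ ψ, σ, τ => .imp (φ.subst σ τ) (ψ.subst σ τ)
  | .allN φ, σ, τ => .allN (φ.subst (liftN σ) τ)
  | .exN φ, σ, τ => .exN (φ.subst (liftN σ) τ)
  | .allF φ, σ, τ => .allF (φ.subst (fun x => (σ x).shiftF) (liftF τ))
  | .exF φ, σ, τ => .exF (φ.subst (fun x => (σ x).shiftF) (liftF τ))

/-- Raise all free number variables by one. -/
def Formula.shiftN (φ : Formula) : Formula := φ.subst (fun x => .var (x + 1)) .var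

/-- Raise all free function variables by one. -/
def Formula.shiftF (φ : Formula) : Formula := φ.subst .var (fun v => .var (v + 1))

/-- Replace number variable `0` by `t` and lower the other free number variables by one. -/
def Formula.instN (φ : Formula) (t : Term) : Formula :=
  φ.subst (fun x => Nat.casesOn x t .var) .var

/-- Replace function variable `0` by `F` and lower the other free function variables by one. -/
def Formula.instF (φ : Formula) (F : FTerm 1) : Formula :=
  φ.subst .var (fun v => Nat.casesOn v F .var)

/-! ### Abbreviations -/

/-- Negation. -/
def Formula.neg (φ : Formula) : Formula := .imp φ .bot

/-- Biconditional. -/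
def Formula.iff (φ ψ : Formula) : Formula := .and (.imp φ ψ) (.imp ψ φ)

/-- The term `0`. -/
def Term.zero : Term := .app .zero ![]

/-- The term `t + 1`. -/
def Term.succ (t : Term) : Term := .app .succ ![t]

/-- The numeral of `k`. -/
def Term.numeral : ℕ → Term
  | 0 => .zero
  | k + 1 => .succ (.numeral k)

/-- `f(t)`, for the function variable `f` with index `v`. -/
def Term.fn (v : ℕ) (t : Term) : Term := .app (.var v) ![t]

/-! ### Intuitionistic predicate logic with equality -/

/-- `Deriv T Γ φ`: natural deduction derivation of `φ` from the assumptions `Γ` and the axioms `T`,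
in two-sorted intuitionistic logic. Free variables of axioms (but not those of assumptions) are
understood as universally quantified. -/
inductive Deriv (T : Set Formula) : List Formula → Formula → Prop
  | ax {Γ φ} : φ ∈ T → Deriv T Γ φ
  | hyp {Γ φ} : φ ∈ Γ → Deriv T Γ φ
  | botE {Γ φ} : Deriv T Γ .bot → Deriv T Γ φ
  | andI {Γ φ ψ} : Deriv T Γ φ → Deriv T Γ ψ → Deriv T Γ (.and φ ψ)
  | andE₁ {Γ φ ψ} : Deriv T Γ (.and φ ψ) → Deriv T Γ φ
  | andE₂ {Γ φ ψ} : Deriv T Γ (.and φ ψ) → Deriv T Γ ψ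
  | orI₁ {Γ φ ψ} : Deriv T Γ φ → Deriv T Γ (.or φ ψ)
  | orI₂ {Γ φ ψ} : Deriv T Γ ψ → Deriv T Γ (.or φ ψ)
  | orE {Γ φ ψ χ} : Deriv T Γ (.or φ ψ) → Deriv T (φ :: Γ) χ → Deriv T (ψ :: Γ) χ → Deriv T Γ χ
  | impI {Γ φ ψ} : Deriv T (φ :: Γ) ψ → Deriv T Γ (.imp φ ψ)
  | impE {Γ φ ψ} : Deriv T Γ (.imp φ ψ) → Deriv T Γ φ → Deriv T Γ ψ
  | allNI {Γ φ} : Deriv T (Γ.map Formula.shiftN) φ → Deriv T Γ (.allN φ)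
  | allNE {Γ φ} (t : Term) : Deriv T Γ (.allN φ) → Deriv T Γ (φ.instN t)
  | exNI {Γ φ} (t : Term) : Deriv T Γ (φ.instN t) → Deriv T Γ (.exN φ)
  | exNE {Γ φ ψ} : Deriv T Γ (.exN φ) → Deriv T (φ :: Γ.map Formula.shiftN) ψ.shiftN → Deriv T Γ ψ
  | allFI {Γ φ} : Deriv T (Γ.map Formula.shiftF) φ → Deriv T Γ (.allF φ)
  | allFE {Γ φ} (F : FTerm 1) : Deriv T Γ (.allF φ) → Deriv T Γ (φ.instF F)
  | exFI {Γ φ} (F : FTerm 1) : Deriv T Γ (φ.instF F) → Deriv T Γ (.exF φ)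
  | exFE {Γ φ ψ} : Deriv T Γ (.exF φ) → Deriv T (φ :: Γ.map Formula.shiftF) ψ.shiftF → Deriv T Γ ψ
  | eqI {Γ} (t : Term) : Deriv T Γ (.eq t t)
  | eqE {Γ s t} (φ : Formula) :
      Deriv T Γ (.eq s t) → Deriv T Γ (φ.instN s) → Deriv T Γ (φ.instN t)

/-- `φ` is intuitionistically provable in the theory with axioms `T`. -/
def Provable (T : Set Formula) (φ : Formula) : Prop := Deriv T [] φ

/-- The axiom sets `A` and `B` are equivalent over `T`. -/
def EquivOver (T A B : Set Formula) : Prop :=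
  (∀ ψ ∈ B, Provable (T ∪ A) ψ) ∧ (∀ φ ∈ A, Provable (T ∪ B) φ)

/-! ### The base theory and arithmetical comprehension -/

/-- No quantifiers. -/
def Formula.QuantifierFree : Formula → Prop
  | .bot => True
  | .eq _ _ => True
  | .and φ ψ => φ.QuantifierFree ∧ ψ.QuantifierFree
  | .or φ ψ => φ.QuantifierFree ∧ ψ.QuantifierFree
  | .imp φ ψ => φ.QuantifierFree ∧ ψ.QuantifierFree
  | .allN _ => False
  | .exN _ => False
  | .allF _ => False
  | .exF _ => False

/-- No function quantifiers (number and function parameters are allowed). -/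
def Formula.Arithmetical : Formula → Prop
  | .bot => True
  | .eq _ _ => True
  | .and φ ψ => φ.Arithmetical ∧ ψ.Arithmetical
  | .or φ ψ => φ.Arithmetical ∧ ψ.Arithmetical
  | .imp φ ψ => φ.Arithmetical ∧ ψ.Arithmetical
  | .allN φ => φ.Arithmetical
  | .exN φ => φ.Arithmetical
  | .allF _ => False
  | .exF _ => False

/-- The induction axiom `φ(0) ∧ ∀ x (φ(x) → φ(x + 1)) → ∀ x φ(x)`, with `x` the number
variable `0` of `φ`. -/
def inductionAxiom (φ : Formula) : Formula :=
  .imp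
    (.and (φ.instN .zero)
      (.allN (.imp φ
        (φ.subst (fun x => Nat.casesOn x (.succ (.var 0)) (fun y => .var (y + 1))) .var))))
    (.allN φ)

/-- The choice axiom `∀ x ∃ y φ(x, y) → ∃ f ∀ x φ(x, f(x))`, with `y`, `x` the number variables
`0`, `1` of `φ`. -/
def choiceAxiom (φ : Formula) : Formula :=
  .imp (.allN (.exN φ)) (.exF (.allN (φ.shiftF.instN (.fn 0 (.var 0)))))

/-- The axioms of `iRCA₀` (the logic being intuitionistic): successor axioms, defining equations of
the primitive recursive functionals, quantifier-free induction, and quantifier-free choice from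
numbers to numbers. -/
inductive IsRCAAxiom : Formula → Prop
  | succ_ne_zero (t : Term) : IsRCAAxiom (.neg (.eq (.succ t) .zero))
  | succ_inj (s t : Term) : IsRCAAxiom (.imp (.eq (.succ s) (.succ t)) (.eq s t))
  | proj {n : ℕ} (i : Fin n) (ts : Fin n → Term) :
      IsRCAAxiom (.eq (.app (.proj i) ts) (ts i))
  | comp {m n : ℕ} (f : FTerm m) (g : Fin m → FTerm n) (ts : Fin n → Term) :
      IsRCAAxiom (.eq (.app (.comp f g) ts) (.app f (fun i => .app (g i) ts)))
  | prec_zero {n : ℕ} (f : FTerm n) (g : FTerm (n + 2)) (ts : Fin n → Term) :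
      IsRCAAxiom (.eq (.app (.prec f g) (Fin.cons .zero ts)) (.app f ts))
  | prec_succ {n : ℕ} (f : FTerm n) (g : FTerm (n + 2)) (t : Term) (ts : Fin n → Term) :
      IsRCAAxiom (.eq (.app (.prec f g) (Fin.cons (.succ t) ts))
        (.app g (Fin.cons t (Fin.cons (.app (.prec f g) (Fin.cons t ts)) ts))))
  | induction (φ : Formula) : φ.QuantifierFree → IsRCAAxiom (inductionAxiom φ)
  | choice (φ : Formula) : φ.QuantifierFree → IsRCAAxiom (choiceAxiom φ)

/-- The theory `iRCA₀`. -/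
def iRCA₀ : Set Formula := {φ | IsRCAAxiom φ}

/-- `∃ f ∀ n (f(n) ≤ 1 ∧ (f(n) = 1 ↔ φ(n)))`, with `n` the number variable `0` of `φ`: the set
`{n | φ(n)}` exists, that is, it has a characteristic function. -/
def comprehensionAxiom (φ : Formula) : Formula :=
  .exF (.allN (.and
    (.or (.eq (.fn 0 (.var 0)) .zero) (.eq (.fn 0 (.var 0)) (.succ .zero)))
    (.iff (.eq (.fn 0 (.var 0)) (.succ .zero)) φ.shiftF)))

/-- The arithmetical comprehension scheme. -/
def ACA : Set Formula := {ψ | ∃ φ : Formula, φ.Arithmetical ∧ ψ = comprehensionAxiom φ}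

/-! ### Some primitive recursive functions -/

/-- `x ↦ x - 1` (truncated). -/
def FTerm.pred : FTerm 1 := .prec .zero (.proj 0)

/-- `(x, y) ↦ x + y`. -/
def FTerm.add : FTerm 2 := .prec (.proj 0) (.comp .succ ![.proj 1])

/-- `(x, y) ↦ x * y`. -/
def FTerm.mul : FTerm 2 := .prec (.comp .zero ![]) (.comp .add ![.proj 1, .proj 2])

/-- `(x, y) ↦ x - y` (truncated). -/
def FTerm.sub : FTerm 2 :=
  .comp (.prec (.proj 0) (.comp .pred ![.proj 1])) ![.proj 1, .proj 0]

/-- `(x, y) ↦ x ^ y`. -/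
def FTerm.pow : FTerm 2 :=
  .comp (.prec (.comp .succ ![.comp .zero ![]]) (.comp .mul ![.proj 1, .proj 2]))
    ![.proj 1, .proj 0]

/-- `x ↦ 0 + 1 + ⋯ + (x - 1)`. -/
def FTerm.tri : FTerm 1 := .prec .zero (.comp .add ![.proj 0, .proj 1])

/-- `x ↦ 1 - x` (truncated): the characteristic function of `{0}`. -/
def FTerm.isZero : FTerm 1 :=
  .prec (.comp .succ ![.zero]) (.comp .zero ![])

/-- `(x, d) ↦ x mod d`, for `d ≥ 1`: in passing from `x` to `x + 1` the remainder `r` becomes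
`r + 1`, or `0` if `r + 1 = d`. -/
def FTerm.mod : FTerm 2 :=
  .prec (.comp .zero ![])
    (.comp .mul ![.comp .succ ![.proj 1],
      .comp .isZero ![.comp .isZero ![.comp .sub ![.proj 2, .comp .succ ![.proj 1]]]]])

/-- `(x, d) ↦ ⌊x / d⌋`, for `d ≥ 1`: in passing from `x` to `x + 1` the quotient grows by one if
`(x mod d) + 1 = d`, and stays the same otherwise. -/
def FTerm.div : FTerm 2 :=
  .prec (.comp .zero ![])
    (.comp .add ![.proj 1,
      .comp .isZero ![.comp .sub ![.proj 2, .comp .succ ![.comp .mod ![.proj 0, .proj 2]]]]])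

/-- `(a, b) ↦ b * (b - 1) / 2 + a`: restricted to `a < b`, this is a bijection from the increasing
pairs onto the numbers. -/
def FTerm.edgeCode : FTerm 2 := .comp .add ![.comp .tri ![.proj 1], .proj 0]

/-- `(i, n) ↦ edgeCode (i, i + n + 1)`: a bijection (Cantor's) from all pairs onto the numbers. -/
def FTerm.pair : FTerm 2 :=
  .comp .edgeCode ![.proj 0, .comp .succ ![.comp .add ![.proj 0, .proj 1]]]

/-- `(k, s, a) ↦ ⌊s / k ^ a⌋ mod k`, the value at `a` of the finite function with values below `k`
that `s` codes in base `k`. -/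
def FTerm.digit : FTerm 3 :=
  .comp .mod ![.comp .div ![.proj 1, .comp .pow ![.proj 0, .proj 2]], .proj 0]

/-- `t - 1` (truncated). -/
def Term.pred (t : Term) : Term := .app .pred ![t]

/-- `s < t`, as the equation `(s + 1) - t = 0` with truncated subtraction. -/
def Formula.lt (s t : Term) : Formula := .eq (.app .sub ![.succ s, t]) .zero

/-- `f_i(t) = f(⟨i, t⟩)`: the `i`-th member of the sequence of functions coded by the function
variable with index `v`. -/
def Term.entry (v : ℕ) (i t : Term) : Term := .fn v (.app .pair ![i, t])

/-! ### The parallelized problems -/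

/-- The parallelization of `LPO`: for every sequence `⟨f_i⟩` there is a `g` such that for all `i`,
`g(i) = 0 → ∀ n (f_i(n) > 0)` and
`g(i) > 0 → f_i(g(i) - 1) = 0 ∧ ∀ t < g(i) - 1 (f_i(t) > 0)`.
Function variables: `g` is `0`, `f` is `1`. Number variables: `i` is `0` outside, and `1` below the
inner quantifiers. -/
def LPOhat : Formula :=
  .allF (.exF (.allN (.and
    (.imp (.eq (.fn 0 (.var 0)) .zero)
      (.allN (.lt .zero (.entry 1 (.var 1) (.var 0)))))
    (.imp (.lt .zero (.fn 0 (.var 0)))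
      (.and
        (.eq (.entry 1 (.var 0) (.pred (.fn 0 (.var 0)))) .zero)
        (.allN (.imp (.lt (.var 0) (.pred (.fn 0 (.var 1))))
          (.lt .zero (.entry 1 (.var 1) (.var 0))))))))))

/-- Let `G` be the graph with vertex set `ℕ` in which `a < b` are adjacent iff
`e_i(edgeCode(a, b)) ≠ 0`, where `e` is the function variable with index `v`. The formula says that
the subgraph induced on `{0, …, m}` has a `k`-coloring:
`∃ s < k ^ (m + 1) ∀ b ≤ m ∀ a < b (e_i(edgeCode(a, b)) ≠ 0 → digit(k, s, a) ≠ digit(k, s, b))`,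
since the `s < k ^ (m + 1)` are the base `k` codes of the functions from `{0, …, m}` to
`{0, …, k - 1}`. In the matrix, `a`, `b`, `s` are the number variables `0`, `1`, `2`. -/
def colorable (k : Term) (v : ℕ) (i m : Term) : Formula :=
  .exN (.and
    (.lt (.var 0) (.app .pow ![k.shiftN, .succ m.shiftN]))
    (.allN (.imp (.lt (.var 0) (.succ m.shiftN.shiftN))
      (.allN (.imp (.lt (.var 0) (.var 1))
        (.imp
          (.neg (.eq (.entry v i.shiftN.shiftN.shiftN (.app .edgeCode ![.var 0, .var 1])) .zero))
          (.neg (.eq (.app .digit ![k.shiftN.shiftN.shiftN, .var 2, .var 0])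
            (.app .digit ![k.shiftN.shiftN.shiftN, .var 2, .var 1])))))))))

/-- The parallelization of local `k`-coloring: for every sequence `⟨e_i⟩` of graphs there is a `g`
such that for all `i`, `g(i) = 0 → ∀ m (G_m is k-colorable)` and
`g(i) > 0 → G_{g(i)} is not k-colorable ∧ ∀ t < g(i) (G_t is k-colorable)`, with `G` the graph of
`e_i` and `G_m` its subgraph induced on `{0, …, m}`.
Function variables: `g` is `0`, `e` is `1`. The only free variable is the number variable `0` in
front, which stands for `k`; below the quantifiers `∀ i` and `∀ i ∀ m`, `∀ i ∀ t` it becomes `1` and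
`2`. -/
def LGhatAt : Formula :=
  .allF (.exF (.allN (.and
    (.imp (.eq (.fn 0 (.var 0)) .zero)
      (.allN (colorable (.var 2) 1 (.var 1) (.var 0))))
    (.imp (.lt .zero (.fn 0 (.var 0)))
      (.and
        (.neg (colorable (.var 1) 1 (.var 0) (.fn 0 (.var 0))))
        (.allN (.imp (.lt (.var 0) (.fn 0 (.var 1)))
          (colorable (.var 2) 1 (.var 1) (.var 0)))))))))

/-- The sentence for a fixed number `k`. -/
def LGhat (k : ℕ) : Formula := LGhatAt.instN (.numeral k)

end SecondOrder

/-! ### Syntax: substitution, structural rules, fresh variables -/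

namespace SecondOrder

/-! ### Substitution calculus -/

/-! From `ACA` to `LPOhat`: let `H` be the characteristic function of the set of `i` for which `f_i`
has a zero. Since `H(i) = 1` is decidable, every `i` has an `n` with `H(i) = 1 → f_i(n) = 0`; this
matrix is quantifier-free, so choice gives a function `b`, and a search up to `b(i)` finds the least
zero of `f_i` whenever there is one.

From `LPOhat` to `ACA`: induct on the arithmetical formula. The connectives act on characteristic
functions as on truth values, because a set with a characteristic function is decidable. A number
quantifier is decided by applying `LPOhat` to the characteristic function of the matrix, with its
two variables coded as a pair (`Deriv.comprehension_of_lpo`).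

From `LPOhat` to local coloring: colorability of `G_m` is arithmetical, so by the previous step it
has a characteristic function in `(i, m)`, and `LPOhat` finds the first `m` where it vanishes. That
`G_0` is colorable for `k ≥ 1` makes the value `0` free to mean "always colorable".

From local coloring to `LPOhat`: join `a < b` in the `i`-th graph iff `f_i` has a zero `t ≤ a`. If
`f_i(n) = 0`, the vertices `n, …, n + k` form a clique, so by the pigeonhole principle `G_(n+k)` has
no `k`-coloring, and the solution `g` has `g(i) > 0`. Then `G_(g(i))` is not colorable, hence has an
edge, hence `f_i` has a zero below `g(i)`. So `g` bounds the search for zeros (`isLPO_of_bound`).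
Here `k` may be any term, so the pigeonhole principle is proved inside the theory by quantifier-free
induction on a primitive recursive count.

Formal derivations are replaced by a semantics. By Zorn's lemma a formula is derivable from `Γ` as
soon as it lies in every prime theory containing `Γ` (`Deriv.complete`). In a prime theory
quantifier-free formulas behave classically, and the terms modulo provable equality form a linearly
ordered commutative semiring, so ordinary algebra applies. Prime theories need not contain witnesses
for their existential formulas; quantifiers are handled at the level of derivations by fresh
variables, and facts about them are proved for all prime theories over a finite context. -/

@[simp] theorem FTerm.subst_var {n : ℕ} (F : FTerm n) : F.subst .var = F := by
  induction F <;> simp_all [FTerm.subst]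

theorem FTerm.subst_subst {n : ℕ} (F : FTerm n) (τ τ' : ℕ → FTerm 1) :
    (F.subst τ).subst τ' = F.subst (fun v => (τ v).subst τ') := by
  induction F <;> simp_all [FTerm.subst]

@[simp] theorem Term.subst_var (t : Term) : t.subst .var .var = t := by
  induction t <;> simp_all [Term.subst]

theorem Term.subst_subst (t : Term) (σ σ' : ℕ → Term) (τ τ' : ℕ → FTerm 1) :
    (t.subst σ τ).subst σ' τ' =
      t.subst (fun x => (σ x).subst σ' τ') (fun v => (τ v).subst τ') := by
  induction t <;> simp_all [Term.subst, FTerm.subst_subst]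

@[simp] theorem liftN_var : liftN .var = .var := by
  funext x; cases x <;> simp [liftN, Term.shiftN, Term.subst]

@[simp] theorem liftF_var : liftF .var = .var := by
  funext x; cases x <;> simp [liftF, FTerm.shiftF, FTerm.subst]

theorem Term.shiftN_subst (t : Term) (σ : ℕ → Term) (τ : ℕ → FTerm 1) :
    t.shiftN.subst σ τ = t.subst (fun x => σ (x + 1)) τ := by
  simp [Term.shiftN, Term.subst_subst, Term.subst, FTerm.subst]

theorem Term.shiftF_subst (t : Term) (σ : ℕ → Term) (τ : ℕ → FTerm 1) :
    t.shiftF.subst σ τ = t.subst σ (fun v => τ (v + 1)) := by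
  simp [Term.shiftF, Term.subst_subst, Term.subst, FTerm.subst]

theorem FTerm.shiftF_subst {n : ℕ} (F : FTerm n) (τ : ℕ → FTerm 1) :
    F.shiftF.subst τ = F.subst (fun v => τ (v + 1)) := by
  simp [FTerm.shiftF, FTerm.subst_subst, FTerm.subst]

theorem liftN_subst_liftN (σ σ' : ℕ → Term) (τ' : ℕ → FTerm 1) :
    (fun x => (liftN σ x).subst (liftN σ') τ') = liftN (fun x => (σ x).subst σ' τ') := by
  funext x
  cases x with
  | zero => simp [liftN, Term.subst]
  | succ x =>
    simp only [liftN, Term.shiftN_subst]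
    simp [Term.shiftN, Term.subst_subst]

theorem liftF_subst_liftF (τ τ' : ℕ → FTerm 1) :
    (fun v => (liftF τ v).subst (liftF τ')) = liftF (fun v => (τ v).subst τ') := by
  funext x
  cases x with
  | zero => simp [liftF, FTerm.subst]
  | succ x =>
    simp only [liftF, FTerm.shiftF_subst]
    simp [FTerm.shiftF, FTerm.subst_subst]

theorem Term.shiftF_subst_liftF (t : Term) (σ : ℕ → Term) (τ : ℕ → FTerm 1) :
    t.shiftF.subst (fun x => (σ x).shiftF) (liftF τ) = (t.subst σ τ).shiftF := by
  rw [Term.shiftF_subst]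
  simp [Term.shiftF, Term.subst_subst, liftF, FTerm.shiftF]

@[simp] theorem Formula.subst_var (φ : Formula) : φ.subst .var .var = φ := by
  induction φ <;> simp_all [Formula.subst, Term.shiftF, Term.subst]

/-- Composition of substitutions. All later commutation facts reduce through it to comparing two
substitutions variable by variable (`Formula.subst_congr`). -/
theorem Formula.subst_subst (φ : Formula) (σ σ' : ℕ → Term) (τ τ' : ℕ → FTerm 1) :
    (φ.subst σ τ).subst σ' τ' =
      φ.subst (fun x => (σ x).subst σ' τ') (fun v => (τ v).subst τ') := by
  induction φ generalizing σ σ' τ τ' <;>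
    simp_all [Formula.subst, Term.subst_subst, liftN_subst_liftN, liftF_subst_liftF,
      Term.shiftF_subst_liftF]

/-- The substitution of `t` for variable `0`. -/
def instσ (t : Term) : ℕ → Term := fun x => Nat.casesOn x t .var

/-- The substitution of `F` for function variable `0`. -/
def instτ (F : FTerm 1) : ℕ → FTerm 1 := fun v => Nat.casesOn v F .var

@[simp] theorem instσ_zero (t : Term) : instσ t 0 = t := rfl
@[simp] theorem instσ_succ (t : Term) (x : ℕ) : instσ t (x + 1) = .var x := rfl
@[simp] theorem instτ_zero (F : FTerm 1) : instτ F 0 = F := rfl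
@[simp] theorem instτ_succ (F : FTerm 1) (x : ℕ) : instτ F (x + 1) = .var x := rfl

theorem Formula.instN_def (φ : Formula) (t : Term) : φ.instN t = φ.subst (instσ t) .var := rfl
theorem Formula.instF_def (φ : Formula) (F : FTerm 1) : φ.instF F = φ.subst .var (instτ F) := rfl

theorem Formula.subst_congr (φ : Formula) {σ σ' : ℕ → Term} {τ τ' : ℕ → FTerm 1}
    (h : ∀ x, σ x = σ' x) (h' : ∀ v, τ v = τ' v) : φ.subst σ τ = φ.subst σ' τ' := by
  rw [funext h, funext h']

/-- Opening a binder after a substitution amounts to one substitution that sends variable `0` to the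
witness; the shift made by `liftN` cancels. -/
theorem Formula.subst_liftN_instN (φ : Formula) (σ : ℕ → Term) (τ : ℕ → FTerm 1) (t : Term) :
    (φ.subst (liftN σ) τ).instN t = φ.subst (fun x => Nat.casesOn x t σ) τ := by
  rw [Formula.instN_def, Formula.subst_subst]
  refine φ.subst_congr (fun x => ?_) (fun v => by simp)
  cases x with
  | zero => simp [liftN, Term.subst]
  | succ x =>
    simp only [liftN, Term.shiftN_subst, instσ_succ]
    exact Term.subst_var _

theorem Formula.instN_subst (φ : Formula) (σ : ℕ → Term) (τ : ℕ → FTerm 1) (t : Term) :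
    (φ.instN t).subst σ τ = (φ.subst (liftN σ) τ).instN (t.subst σ τ) := by
  rw [Formula.subst_liftN_instN, Formula.instN_def, Formula.subst_subst]
  refine φ.subst_congr (fun x => ?_) (fun v => by simp [FTerm.subst])
  cases x <;> simp [Term.subst]

theorem Formula.instF_subst (φ : Formula) (σ : ℕ → Term) (τ : ℕ → FTerm 1) (F : FTerm 1) :
    (φ.instF F).subst σ τ =
      (φ.subst (fun x => (σ x).shiftF) (liftF τ)).instF (F.subst τ) := by
  rw [Formula.instF_def, Formula.instF_def, Formula.subst_subst, Formula.subst_subst]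
  refine φ.subst_congr (fun x => ?_) (fun v => ?_)
  · simp only [Term.subst, Term.shiftF_subst, instτ_succ]
    exact (Term.subst_var _).symm
  · cases v with
    | zero => simp [liftF, FTerm.subst]
    | succ v =>
      simp only [liftF, FTerm.shiftF_subst, instτ_succ, FTerm.subst]
      exact (FTerm.subst_var _).symm

theorem Formula.shiftN_subst_liftN (φ : Formula) (σ : ℕ → Term) (τ : ℕ → FTerm 1) :
    φ.shiftN.subst (liftN σ) τ = (φ.subst σ τ).shiftN := by
  rw [Formula.shiftN, Formula.shiftN, Formula.subst_subst, Formula.subst_subst]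
  exact φ.subst_congr (fun x => by simp [Term.subst, liftN, Term.shiftN])
    (fun v => by simp [FTerm.subst])

theorem Formula.shiftF_subst_liftF (φ : Formula) (σ : ℕ → Term) (τ : ℕ → FTerm 1) :
    φ.shiftF.subst (fun x => (σ x).shiftF) (liftF τ) = (φ.subst σ τ).shiftF := by
  rw [Formula.shiftF, Formula.shiftF, Formula.subst_subst, Formula.subst_subst]
  exact φ.subst_congr (fun x => by simp [Term.subst, Term.shiftF])
    (fun v => by simp [FTerm.subst, liftF, FTerm.shiftF])

@[simp] theorem Term.shiftN_instσ (s t : Term) (τ : ℕ → FTerm 1) :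
    s.shiftN.subst (instσ t) τ = s.subst .var τ := by
  rw [Term.shiftN_subst]; rfl

@[simp] theorem Term.shiftF_instτ (s : Term) (σ : ℕ → Term) (F : FTerm 1) :
    s.shiftF.subst σ (instτ F) = s.subst σ .var := by
  rw [Term.shiftF_subst]; rfl

/-! ### Theories closed under substitution -/

theorem Formula.QuantifierFree.subst {φ : Formula} (h : φ.QuantifierFree) (σ : ℕ → Term)
    (τ : ℕ → FTerm 1) : (φ.subst σ τ).QuantifierFree := by
  induction φ <;> simp_all [Formula.QuantifierFree, Formula.subst]

theorem Formula.Arithmetical.subst {φ : Formula} (h : φ.Arithmetical) (σ : ℕ → Term)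
    (τ : ℕ → FTerm 1) : (φ.subst σ τ).Arithmetical := by
  induction φ generalizing σ <;> simp_all [Formula.Arithmetical, Formula.subst]

theorem Term.subst_app_cons {n : ℕ} (F : FTerm (n + 1)) (t : Term) (ts : Fin n → Term)
    (σ : ℕ → Term) (τ : ℕ → FTerm 1) :
    (Term.app F (Fin.cons t ts)).subst σ τ =
      .app (F.subst τ) (Fin.cons (t.subst σ τ) (fun i => (ts i).subst σ τ)) := by
  simp only [Term.subst]
  congr 1
  funext i
  refine Fin.cases ?_ (fun i => ?_) i <;> simp

theorem Term.subst_app_zero (F : FTerm 0) (ts : Fin 0 → Term) (σ : ℕ → Term)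
    (τ : ℕ → FTerm 1) : (Term.app F ts).subst σ τ = .app (F.subst τ) ![] := by
  simp only [Term.subst]
  congr 1
  funext i
  exact i.elim0

@[simp] theorem Term.subst_app_one (F : FTerm 1) (a : Term) (σ : ℕ → Term)
    (τ : ℕ → FTerm 1) : (Term.app F ![a]).subst σ τ = .app (F.subst τ) ![a.subst σ τ] := by
  simp only [Term.subst]
  congr 1
  funext i
  fin_cases i; rfl

@[simp] theorem Term.subst_app_two (F : FTerm 2) (a b : Term) (σ : ℕ → Term)
    (τ : ℕ → FTerm 1) :
    (Term.app F ![a, b]).subst σ τ = .app (F.subst τ) ![a.subst σ τ, b.subst σ τ] := by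
  simp only [Term.subst]
  congr 1
  funext i
  fin_cases i <;> rfl

@[simp] theorem Term.subst_app_three (F : FTerm 3) (a b c : Term) (σ : ℕ → Term)
    (τ : ℕ → FTerm 1) :
    (Term.app F ![a, b, c]).subst σ τ =
      .app (F.subst τ) ![a.subst σ τ, b.subst σ τ, c.subst σ τ] := by
  simp only [Term.subst]
  congr 1
  funext i
  fin_cases i <;> rfl

@[simp] theorem Term.subst_zero (σ : ℕ → Term) (τ : ℕ → FTerm 1) :
    Term.zero.subst σ τ = .zero := Term.subst_app_zero _ _ _ _

@[simp] theorem Term.subst_succ (t : Term) (σ : ℕ → Term) (τ : ℕ → FTerm 1) :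
    t.succ.subst σ τ = (t.subst σ τ).succ := Term.subst_app_one _ _ _ _

@[simp] theorem Term.fn_subst (v : ℕ) (t : Term) (σ : ℕ → Term) (τ : ℕ → FTerm 1) :
    (Term.fn v t).subst σ τ = .app (τ v) ![t.subst σ τ] := Term.subst_app_one _ _ _ _

theorem Formula.neg_subst (φ : Formula) (σ : ℕ → Term) (τ : ℕ → FTerm 1) :
    φ.neg.subst σ τ = (φ.subst σ τ).neg := rfl

theorem inductionAxiom_subst (φ : Formula) (σ : ℕ → Term) (τ : ℕ → FTerm 1) :
    (inductionAxiom φ).subst σ τ = inductionAxiom (φ.subst (liftN σ) τ) := by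
  simp only [inductionAxiom, Formula.subst, Formula.instN_subst, Term.subst_zero,
    Formula.subst_subst]
  congr 4
  refine φ.subst_congr (fun x => ?_) (fun v => by simp [FTerm.subst])
  cases x with
  | zero => simp [liftN, Term.subst]
  | succ x => simp only [liftN, Term.shiftN_subst]; simp [Term.subst, liftN, Term.shiftN]

theorem choiceAxiom_subst (φ : Formula) (σ : ℕ → Term) (τ : ℕ → FTerm 1) :
    (choiceAxiom φ).subst σ τ = choiceAxiom (φ.subst (liftN (liftN σ)) τ) := by
  simp only [choiceAxiom, Formula.subst, Formula.instN_subst]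
  congr 3
  rw [← Formula.shiftF_subst_liftF, Formula.instN_def, Formula.instN_def, Term.fn,
    Term.subst_app_one, Formula.subst_subst, Formula.subst_subst]
  refine Formula.subst_congr _ (fun x => ?_) (fun v => ?_)
  · rcases x with _ | _ | x
    · simp [liftN, Term.subst, Term.shiftF, FTerm.subst, liftF]
    · simp [liftN, Term.subst, Term.shiftF, Term.shiftN]
    · simp only [liftN, Term.shiftN, Term.shiftF, Term.subst_subst]
      simp [Term.subst, FTerm.subst]
  · simp

/-- Each axiom scheme ranges over arbitrary terms and formulas, so a substitution only changes the
instance. Without this, derivations could not be renamed. -/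
theorem iRCA₀_subst {φ : Formula} (h : φ ∈ iRCA₀) (σ : ℕ → Term) (τ : ℕ → FTerm 1) :
    φ.subst σ τ ∈ iRCA₀ := by
  have h : IsRCAAxiom φ := h
  change IsRCAAxiom _
  cases h with
  | succ_ne_zero t =>
    simpa [Formula.neg, Formula.subst] using IsRCAAxiom.succ_ne_zero (t.subst σ τ)
  | succ_inj s t =>
    simpa [Formula.subst] using IsRCAAxiom.succ_inj (s.subst σ τ) (t.subst σ τ)
  | proj i ts => exact .proj i (fun i => (ts i).subst σ τ)
  | comp f g ts =>
    exact .comp (f.subst τ) (fun i => (g i).subst τ) (fun i => (ts i).subst σ τ)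
  | prec_zero f g ts =>
    simp only [Formula.subst, Term.subst_app_cons, Term.subst_zero]
    exact .prec_zero (f.subst τ) (g.subst τ) (fun i => (ts i).subst σ τ)
  | prec_succ f g t ts =>
    have := IsRCAAxiom.prec_succ (f.subst τ) (g.subst τ) (t.subst σ τ)
      (fun i => (ts i).subst σ τ)
    simp only [Formula.subst, Term.subst_app_cons, Term.subst_succ]
    convert this using 4
    · rfl
    funext i
    refine Fin.cases ?_ (fun i => ?_) i
    · exact Term.subst_app_cons _ _ _ _ _
    · rfl
  | induction φ hφ => rw [inductionAxiom_subst]; exact .induction _ (hφ.subst _ _)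
  | choice φ hφ => rw [choiceAxiom_subst]; exact .choice _ (hφ.subst _ _)

/-- Theories that contain `iRCA₀` and are closed under substitution. -/
class IsTheory (T : Set Formula) : Prop where
  rca : ∀ {φ}, IsRCAAxiom φ → φ ∈ T
  subst : ∀ {φ}, φ ∈ T → ∀ σ τ, φ.subst σ τ ∈ T

instance : IsTheory iRCA₀ := ⟨fun h => h, iRCA₀_subst⟩

theorem comprehensionAxiom_subst (φ : Formula) (σ : ℕ → Term) (τ : ℕ → FTerm 1) :
    (comprehensionAxiom φ).subst σ τ = comprehensionAxiom (φ.subst (liftN σ) τ) := by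
  have : liftN (fun x => (σ x).shiftF) = fun x => (liftN σ x).shiftF := by
    funext x
    cases x <;> simp [liftN, Term.shiftF, Term.subst, Term.shiftN, Term.subst_subst, FTerm.subst]
  have h₀ : (liftN fun x => (σ x).shiftF) 0 = .var 0 := rfl
  have h₁ : liftF τ 0 = .var 0 := rfl
  simp only [comprehensionAxiom, Formula.subst, Formula.iff, ← Formula.shiftF_subst_liftF,
    Term.fn_subst, Term.subst_succ, Term.subst_zero, h₀, h₁, Term.subst]
  rw [this]
  rfl

instance : IsTheory (iRCA₀ ∪ ACA) where
  rca h := Or.inl h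
  subst := by
    rintro φ (h | ⟨φ, h, rfl⟩) σ τ
    · exact Or.inl (iRCA₀_subst h σ τ)
    · exact Or.inr ⟨_, h.subst (liftN σ) τ, comprehensionAxiom_subst _ _ _⟩

/-- Sentences are unaffected by substitution, so adding one keeps the closure property. -/
theorem isTheory_union_singleton {φ : Formula} (h : ∀ σ τ, φ.subst σ τ = φ) :
    IsTheory (iRCA₀ ∪ {φ}) where
  rca h := Or.inl h
  subst := by
    rintro ψ (hψ | rfl) σ τ
    · exact Or.inl (iRCA₀_subst hψ σ τ)
    · exact Or.inr (h σ τ)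

/-! ### Structural rules -/

variable {T : Set Formula}

theorem Deriv.mono {Γ Δ : List Formula} {φ : Formula} (h : Deriv T Γ φ) (hΔ : Γ ⊆ Δ) :
    Deriv T Δ φ := by
  induction h generalizing Δ with
  | ax h => exact .ax h
  | hyp h => exact .hyp (hΔ h)
  | botE _ ih => exact .botE (ih hΔ)
  | andI _ _ ih₁ ih₂ => exact .andI (ih₁ hΔ) (ih₂ hΔ)
  | andE₁ _ ih => exact .andE₁ (ih hΔ)
  | andE₂ _ ih => exact .andE₂ (ih hΔ)
  | orI₁ _ ih => exact .orI₁ (ih hΔ)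
  | orI₂ _ ih => exact .orI₂ (ih hΔ)
  | orE _ _ _ ih ih₁ ih₂ =>
    exact .orE (ih hΔ) (ih₁ (List.cons_subset_cons _ hΔ)) (ih₂ (List.cons_subset_cons _ hΔ))
  | impI _ ih => exact .impI (ih (List.cons_subset_cons _ hΔ))
  | impE _ _ ih₁ ih₂ => exact .impE (ih₁ hΔ) (ih₂ hΔ)
  | allNI _ ih => exact .allNI (ih (List.map_subset _ hΔ))
  | allNE t _ ih => exact .allNE t (ih hΔ)
  | exNI t _ ih => exact .exNI t (ih hΔ)
  | exNE _ _ ih₁ ih₂ =>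
    exact .exNE (ih₁ hΔ) (ih₂ (List.cons_subset_cons _ (List.map_subset _ hΔ)))
  | allFI _ ih => exact .allFI (ih (List.map_subset _ hΔ))
  | allFE t _ ih => exact .allFE t (ih hΔ)
  | exFI t _ ih => exact .exFI t (ih hΔ)
  | exFE _ _ ih₁ ih₂ =>
    exact .exFE (ih₁ hΔ) (ih₂ (List.cons_subset_cons _ (List.map_subset _ hΔ)))
  | eqI t => exact .eqI t
  | eqE φ _ _ ih₁ ih₂ => exact .eqE φ (ih₁ hΔ) (ih₂ hΔ)

theorem map_shiftN_subst (Γ : List Formula) (σ : ℕ → Term) (τ : ℕ → FTerm 1) :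
    (Γ.map Formula.shiftN).map (fun φ => φ.subst (liftN σ) τ) =
      (Γ.map (fun φ => φ.subst σ τ)).map Formula.shiftN := by
  simp [Function.comp_def, Formula.shiftN_subst_liftN]

theorem map_shiftF_subst (Γ : List Formula) (σ : ℕ → Term) (τ : ℕ → FTerm 1) :
    (Γ.map Formula.shiftF).map (fun φ => φ.subst (fun x => (σ x).shiftF) (liftF τ)) =
      (Γ.map (fun φ => φ.subst σ τ)).map Formula.shiftF := by
  simp [Function.comp_def, Formula.shiftF_subst_liftF]

/-- Substitution turns derivations into derivations; under a quantifier rule the substitution is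
lifted so as to leave the eigenvariable alone. Its use is the renaming of a fresh variable into a
bound one. -/
theorem Deriv.subst [IsTheory T] {Γ : List Formula} {φ : Formula} (h : Deriv T Γ φ)
    (σ : ℕ → Term) (τ : ℕ → FTerm 1) :
    Deriv T (Γ.map (fun φ => φ.subst σ τ)) (φ.subst σ τ) := by
  induction h generalizing σ τ with
  | ax h => exact .ax (IsTheory.subst h σ τ)
  | hyp h => exact .hyp (List.mem_map_of_mem h)
  | botE _ ih => exact .botE (ih σ τ)
  | andI _ _ ih₁ ih₂ => exact .andI (ih₁ σ τ) (ih₂ σ τ)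
  | andE₁ _ ih => exact .andE₁ (ih σ τ)
  | andE₂ _ ih => exact .andE₂ (ih σ τ)
  | orI₁ _ ih => exact .orI₁ (ih σ τ)
  | orI₂ _ ih => exact .orI₂ (ih σ τ)
  | orE _ _ _ ih ih₁ ih₂ => exact .orE (ih σ τ) (ih₁ σ τ) (ih₂ σ τ)
  | impI _ ih => exact .impI (ih σ τ)
  | impE _ _ ih₁ ih₂ => exact .impE (ih₁ σ τ) (ih₂ σ τ)
  | allNI _ ih =>
    have := ih (liftN σ) τ
    rw [map_shiftN_subst] at this
    exact .allNI this
  | allNE t _ ih => rw [Formula.instN_subst]; exact .allNE _ (ih σ τ)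
  | exNI t _ ih =>
    have := ih σ τ
    rw [Formula.instN_subst] at this
    exact .exNI _ this
  | exNE _ _ ih₁ ih₂ =>
    have := ih₂ (liftN σ) τ
    rw [List.map_cons, map_shiftN_subst, Formula.shiftN_subst_liftN] at this
    exact .exNE (ih₁ σ τ) this
  | allFI _ ih =>
    have := ih (fun x => (σ x).shiftF) (liftF τ)
    rw [map_shiftF_subst] at this
    exact .allFI this
  | allFE t _ ih => rw [Formula.instF_subst]; exact .allFE _ (ih σ τ)
  | exFI t _ ih =>
    have := ih σ τ
    rw [Formula.instF_subst] at this
    exact .exFI _ this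
  | exFE _ _ ih₁ ih₂ =>
    have := ih₂ (fun x => (σ x).shiftF) (liftF τ)
    rw [List.map_cons, map_shiftF_subst, Formula.shiftF_subst_liftF] at this
    exact .exFE (ih₁ σ τ) this
  | eqI t => exact .eqI _
  | eqE φ _ _ ih₁ ih₂ =>
    have := ih₂ σ τ
    rw [Formula.instN_subst] at this ⊢
    exact .eqE _ (ih₁ σ τ) this

/-! ### Fresh variables -/

/-- Only finitely many variables occur. This is put as independence of the substitution from its
values at large indices, which avoids defining free variables. -/
theorem FTerm.exists_support {n : ℕ} (F : FTerm n) :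
    ∃ N, ∀ τ τ' : ℕ → FTerm 1, (∀ v < N, τ v = τ' v) → F.subst τ = F.subst τ' := by
  induction F with
  | var v => exact ⟨v + 1, fun τ τ' h => h v v.lt_succ_self⟩
  | zero => exact ⟨0, fun _ _ _ => rfl⟩
  | succ => exact ⟨0, fun _ _ _ => rfl⟩
  | proj i => exact ⟨0, fun _ _ _ => rfl⟩
  | comp f g ihf ihg =>
    obtain ⟨N, hN⟩ := ihf
    choose M hM using ihg
    refine ⟨N + ∑ i, M i, fun τ τ' h => ?_⟩
    simp only [FTerm.subst]
    rw [hN τ τ' fun v hv => h v (by omega)]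
    congr 1
    funext i
    have := Finset.single_le_sum (f := M) (fun i _ => Nat.zero_le _) (Finset.mem_univ i)
    exact hM i τ τ' fun v hv => h v (by omega)
  | prec f g ihf ihg =>
    obtain ⟨N, hN⟩ := ihf
    obtain ⟨M, hM⟩ := ihg
    refine ⟨N + M, fun τ τ' h => ?_⟩
    simp only [FTerm.subst]
    rw [hN τ τ' fun v hv => h v (by omega), hM τ τ' fun v hv => h v (by omega)]

theorem Term.exists_support (t : Term) :
    ∃ N, ∀ (σ σ' : ℕ → Term) (τ τ' : ℕ → FTerm 1), (∀ x < N, σ x = σ' x) →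
      (∀ v < N, τ v = τ' v) → t.subst σ τ = t.subst σ' τ' := by
  induction t with
  | var x => exact ⟨x + 1, fun _ _ _ _ h _ => h x x.lt_succ_self⟩
  | app F ts ih =>
    obtain ⟨N, hN⟩ := F.exists_support
    choose M hM using ih
    refine ⟨N + ∑ i, M i, fun σ σ' τ τ' h h' => ?_⟩
    simp only [Term.subst]
    rw [hN τ τ' fun v hv => h' v (by omega)]
    congr 1
    funext i
    have := Finset.single_le_sum (f := M) (fun i _ => Nat.zero_le _) (Finset.mem_univ i)
    exact hM i σ σ' τ τ' (fun v hv => h v (by omega)) (fun v hv => h' v (by omega))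

theorem Formula.exists_support (φ : Formula) :
    ∃ N, ∀ (σ σ' : ℕ → Term) (τ τ' : ℕ → FTerm 1), (∀ x < N, σ x = σ' x) →
      (∀ v < N, τ v = τ' v) → φ.subst σ τ = φ.subst σ' τ' := by
  induction φ with
  | bot => exact ⟨0, fun _ _ _ _ _ _ => rfl⟩
  | eq s t =>
    obtain ⟨N, hN⟩ := s.exists_support
    obtain ⟨M, hM⟩ := t.exists_support
    refine ⟨N + M, fun σ σ' τ τ' h h' => ?_⟩
    simp only [Formula.subst]
    rw [hN σ σ' τ τ' (fun v hv => h v (by omega)) (fun v hv => h' v (by omega)),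
      hM σ σ' τ τ' (fun v hv => h v (by omega)) (fun v hv => h' v (by omega))]
  | and φ ψ ih₁ ih₂ | or φ ψ ih₁ ih₂ | imp φ ψ ih₁ ih₂ =>
    obtain ⟨N, hN⟩ := ih₁
    obtain ⟨M, hM⟩ := ih₂
    refine ⟨N + M, fun σ σ' τ τ' h h' => ?_⟩
    simp only [Formula.subst]
    rw [hN σ σ' τ τ' (fun v hv => h v (by omega)) (fun v hv => h' v (by omega)),
      hM σ σ' τ τ' (fun v hv => h v (by omega)) (fun v hv => h' v (by omega))]
  | allN φ ih | exN φ ih =>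
    obtain ⟨N, hN⟩ := ih
    refine ⟨N, fun σ σ' τ τ' h h' => ?_⟩
    simp only [Formula.subst]
    rw [hN (liftN σ) (liftN σ') τ τ' (fun x hx => ?_) h']
    cases x with
    | zero => rfl
    | succ x => simp only [liftN, h x (by omega)]
  | allF φ ih | exF φ ih =>
    obtain ⟨N, hN⟩ := ih
    refine ⟨N, fun σ σ' τ τ' h h' => ?_⟩
    simp only [Formula.subst]
    rw [hN _ (fun x => (σ' x).shiftF) (liftF τ) (liftF τ') (fun x hx => by rw [h x hx])
      (fun x hx => ?_)]
    cases x with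
    | zero => rfl
    | succ x => simp only [liftF, h' x (by omega)]

theorem exists_support_list (Γ : List Formula) :
    ∃ N, ∀ φ ∈ Γ, ∀ (σ σ' : ℕ → Term) (τ τ' : ℕ → FTerm 1), (∀ x < N, σ x = σ' x) →
      (∀ v < N, τ v = τ' v) → φ.subst σ τ = φ.subst σ' τ' := by
  induction Γ with
  | nil => exact ⟨0, by simp⟩
  | cons φ Γ ih =>
    obtain ⟨N, hN⟩ := φ.exists_support
    obtain ⟨M, hM⟩ := ih
    refine ⟨N + M, fun ψ hψ σ σ' τ τ' h h' => ?_⟩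
    rcases List.mem_cons.1 hψ with rfl | hψ
    · exact hN _ _ _ _ (fun v hv => h v (by omega)) (fun v hv => h' v (by omega))
    · exact hM _ hψ _ _ _ _ (fun v hv => h v (by omega)) (fun v hv => h' v (by omega))

/-- A fresh number variable `N` for `Γ`, `φ`, `ψ`, with the renaming that turns it into the
variable bound by a quantifier. -/
theorem exists_fresh_number (Γ : List Formula) (φ ψ : Formula) :
    ∃ (N : ℕ) (ρ : ℕ → Term), Γ.map (fun χ => χ.subst ρ .var) = Γ.map Formula.shiftN ∧
      (φ.instN (.var N)).subst ρ .var = φ ∧ ψ.subst ρ .var = ψ.shiftN := by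
  obtain ⟨N, hN⟩ := exists_support_list (φ :: ψ :: Γ)
  -- Below `N` the renaming is the shift, so on formulas not using `N` it agrees with
  -- `Formula.shiftN`; the variable `N` itself becomes the bound one.
  refine ⟨N, fun x => if x = N then .var 0 else .var (x + 1), ?_, ?_, ?_⟩
  · refine List.map_congr_left fun χ hχ => ?_
    exact hN χ (by simp [hχ]) _ _ _ _ (fun x hx => by simp [hx.ne]) (fun _ _ => rfl)
  · rw [Formula.instN_def, Formula.subst_subst]
    conv_rhs => rw [← Formula.subst_var φ]
    refine hN φ (by simp) _ _ _ _ (fun x hx => ?_) (fun _ _ => by simp)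
    rcases x with _ | x
    · simp [Term.subst]
    · have : x ≠ N := by omega
      simp [Term.subst, this]
  · exact hN ψ (by simp) _ _ _ _ (fun x hx => by simp [hx.ne]) (fun _ _ => rfl)

theorem exists_fresh_function (Γ : List Formula) (φ ψ : Formula) :
    ∃ (N : ℕ) (ρ : ℕ → FTerm 1), Γ.map (fun χ => χ.subst .var ρ) = Γ.map Formula.shiftF ∧
      (φ.instF (.var N)).subst .var ρ = φ ∧ ψ.subst .var ρ = ψ.shiftF := by
  obtain ⟨N, hN⟩ := exists_support_list (φ :: ψ :: Γ)
  refine ⟨N, fun x => if x = N then .var 0 else .var (x + 1), ?_, ?_, ?_⟩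
  · refine List.map_congr_left fun χ hχ => ?_
    exact hN χ (by simp [hχ]) _ _ _ _ (fun _ _ => rfl) (fun x hx => by simp [hx.ne])
  · rw [Formula.instF_def, Formula.subst_subst]
    conv_rhs => rw [← Formula.subst_var φ]
    refine hN φ (by simp) _ _ _ _ (fun _ _ => by simp [Term.subst]) (fun x hx => ?_)
    rcases x with _ | x
    · simp [FTerm.subst]
    · have : x ≠ N := by omega
      simp [FTerm.subst, this]
  · exact hN ψ (by simp) _ _ _ _ (fun _ _ => rfl) (fun x hx => by simp [hx.ne])

variable [IsTheory T] {Γ : List Formula} {φ ψ : Formula}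

/-- The eigenvariable condition becomes a quantifier over all terms: the hypothesis is used at a
fresh variable, which is then renamed to the bound one. -/
theorem Deriv.allN_intro (h : ∀ t, Deriv T Γ (φ.instN t)) : Deriv T Γ (.allN φ) := by
  obtain ⟨N, ρ, h₁, h₂, -⟩ := exists_fresh_number Γ φ .bot
  have := (h (.var N)).subst ρ .var
  rw [h₁, h₂] at this
  exact .allNI this

theorem Deriv.allF_intro (h : ∀ F, Deriv T Γ (φ.instF F)) : Deriv T Γ (.allF φ) := by
  obtain ⟨N, ρ, h₁, h₂, -⟩ := exists_fresh_function Γ φ .bot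
  have := (h (.var N)).subst .var ρ
  rw [h₁, h₂] at this
  exact .allFI this

/-- In continuation form: the witness is really a fresh variable and `Δ` is `Γ` with one more
assumption, but a proof may treat both as arbitrary. -/
theorem Deriv.exN_elim (h : Deriv T Γ (.exN φ))
    (h' : ∀ t Δ, Γ ⊆ Δ → Deriv T Δ (φ.instN t) → Deriv T Δ ψ) : Deriv T Γ ψ := by
  obtain ⟨N, ρ, h₁, h₂, h₃⟩ := exists_fresh_number Γ φ ψ
  have := (h' (.var N) (φ.instN (.var N) :: Γ) (by simp) (.hyp (by simp))).subst ρ .var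
  rw [List.map_cons, h₁, h₂, h₃] at this
  exact .exNE h this

theorem Deriv.exF_elim (h : Deriv T Γ (.exF φ))
    (h' : ∀ F Δ, Γ ⊆ Δ → Deriv T Δ (φ.instF F) → Deriv T Δ ψ) : Deriv T Γ ψ := by
  obtain ⟨N, ρ, h₁, h₂, h₃⟩ := exists_fresh_function Γ φ ψ
  have := (h' (.var N) (φ.instF (.var N) :: Γ) (by simp) (.hyp (by simp))).subst .var ρ
  rw [List.map_cons, h₁, h₂, h₃] at this
  exact .exFE h this

end SecondOrder

/-! ### Prime theories as a semantics for intuitionistic derivability -/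

namespace SecondOrder

/-! ### Prime theories -/

/-- A deductively closed consistent set of formulas with the disjunction property. -/
structure PrimeTheory (T : Set Formula) where
  Holds : Formula → Prop
  closed : ∀ {Γ φ}, (∀ ψ ∈ Γ, Holds ψ) → Deriv T Γ φ → Holds φ
  not_bot : ¬ Holds .bot
  or_prime : ∀ {φ ψ}, Holds (.or φ ψ) → Holds φ ∨ Holds ψ

variable {T : Set Formula}

/-- Derivability from a possibly infinite set of assumptions. -/
def Entails (T S : Set Formula) (φ : Formula) : Prop :=
  ∃ Γ : List Formula, (∀ ψ ∈ Γ, ψ ∈ S) ∧ Deriv T Γ φ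

theorem Entails.closed {S : Set Formula} {Γ : List Formula} {φ : Formula}
    (h : ∀ ψ ∈ Γ, Entails T S ψ) (hφ : Deriv T Γ φ) : Entails T S φ := by
  induction Γ generalizing φ with
  | nil => exact ⟨[], by simp, hφ⟩
  | cons ψ Γ ih =>
    obtain ⟨Δ₁, h₁, h₁'⟩ := ih (fun χ hχ => h χ (by simp [hχ])) hφ.impI
    obtain ⟨Δ₂, h₂, h₂'⟩ := h ψ (by simp)
    refine ⟨Δ₁ ++ Δ₂, fun χ hχ => ?_, (h₁'.mono (by simp)).impE (h₂'.mono (by simp))⟩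
    rcases List.mem_append.1 hχ with hχ | hχ
    exacts [h₁ χ hχ, h₂ χ hχ]

theorem Entails.imp {S : Set Formula} {φ ψ : Formula} (h : Entails T (insert φ S) ψ) :
    Entails T S (.imp φ ψ) := by
  classical
  obtain ⟨Γ, h₁, h₂⟩ := h
  -- All occurrences of `φ` among the finitely many assumptions are discharged at once.
  refine ⟨Γ.filter (· ≠ φ), fun χ hχ => ?_, (h₂.mono fun χ hχ => ?_).impI⟩
  · simp only [List.mem_filter, decide_eq_true_eq] at hχ
    exact (h₁ χ hχ.1).resolve_left hχ.2
  · by_cases h : χ = φ <;> simp [h, hχ]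

/-- Take a set maximal among the supersets of `S` that do not entail `χ`. A formula outside it
would, if added, entail `χ`; this gives deductive closure, and by the rule for disjunction also
primeness. -/
theorem exists_primeTheory {S : Set Formula} {χ : Formula} (h : ¬ Entails T S χ) :
    ∃ P : PrimeTheory T, (∀ φ ∈ S, P.Holds φ) ∧ ¬ P.Holds χ := by
  obtain ⟨M, hSM, hM⟩ := zorn_subset_nonempty {U : Set Formula | ¬ Entails T U χ} (by
    intro c hc hchain hne
    refine ⟨⋃₀ c, ?_, fun s hs => Set.subset_sUnion_of_mem hs⟩
    rintro ⟨Γ, hΓ, hχ⟩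
    have : ∃ s ∈ c, ∀ ψ ∈ Γ, ψ ∈ s := by
      clear hχ
      induction Γ with
      | nil => obtain ⟨s, hs⟩ := hne; exact ⟨s, hs, by simp⟩
      | cons ψ Γ ih =>
        obtain ⟨s, hs, hs'⟩ := ih fun ψ hψ => hΓ ψ (by simp [hψ])
        obtain ⟨t, ht, ht'⟩ := hΓ ψ (by simp)
        rcases hchain.total hs ht with hst | hts
        · exact ⟨t, ht, by simpa [ht'] using fun χ hχ => hst (hs' χ hχ)⟩
        · exact ⟨s, hs, by simpa [hts ht'] using hs'⟩
    obtain ⟨s, hs, hs'⟩ := this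
    exact hc hs ⟨Γ, hs', hχ⟩) S h
  have hmem : ∀ φ, Entails T M φ → φ ∈ M := by
    intro φ hφ
    by_contra hn
    have : Entails T (insert φ M) χ := by
      by_contra hins
      exact hn (hM.le_of_ge hins (Set.subset_insert _ _) (Set.mem_insert _ _))
    refine hM.prop (Entails.closed (Γ := [.imp φ χ, φ]) ?_
      (.impE (φ := φ) (.hyp (by simp)) (.hyp (by simp))))
    simpa using ⟨this.imp, hφ⟩
  have hself : ∀ φ ∈ M, Entails T M φ := fun φ hφ => ⟨[φ], by simpa, .hyp (by simp)⟩
  refine ⟨⟨(· ∈ M), fun hΓ hφ => hmem _ (Entails.closed (fun ψ hψ => hself ψ (hΓ ψ hψ)) hφ),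
    fun hb => ?_, fun {φ ψ} hor => ?_⟩, hSM, fun hχ => hM.prop (hself _ hχ)⟩
  · exact hM.prop (Entails.closed (Γ := [.bot]) (by simpa using hself _ hb)
      (.botE (.hyp (by simp))))
  · by_contra hn
    push Not at hn
    have key : ∀ φ, φ ∉ M → Entails T M (.imp φ χ) := by
      intro φ hφ
      refine Entails.imp ?_
      by_contra hins
      exact hφ (hM.le_of_ge hins (Set.subset_insert _ _) (Set.mem_insert _ _))
    refine hM.prop (Entails.closed (Γ := [.or φ ψ, .imp φ χ, .imp ψ χ]) ?_
      (.orE (φ := φ) (ψ := ψ) (.hyp (by simp)) (.impE (φ := φ) (.hyp (by simp)) (.hyp (by simp)))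
        (.impE (φ := ψ) (.hyp (by simp)) (.hyp (by simp)))))
    simpa using ⟨hself _ hor, key _ hn.1, key _ hn.2⟩

namespace PrimeTheory

/-- `P` contains all formulas of `Γ`. -/
def Models (P : PrimeTheory T) (Γ : List Formula) : Prop := ∀ φ ∈ Γ, P.Holds φ

theorem Models.mono {P : PrimeTheory T} {Γ Δ : List Formula} (h : P.Models Δ) (hΓ : Γ ⊆ Δ) :
    P.Models Γ := fun φ hφ => h φ (hΓ hφ)

theorem models_nil (P : PrimeTheory T) : P.Models [] := by simp [Models]

end PrimeTheory

/-- The bridge from semantics to derivations: a non-derivable `φ` is omitted by some prime theory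
that contains `Γ`. -/
theorem Deriv.complete {Γ : List Formula} {φ : Formula}
    (h : ∀ P : PrimeTheory T, P.Models Γ → P.Holds φ) : Deriv T Γ φ := by
  by_contra hn
  obtain ⟨P, h₁, h₂⟩ := exists_primeTheory (T := T) (S := {ψ | ψ ∈ Γ}) (χ := φ)
    (fun ⟨Δ, h₁, h₂⟩ => hn (h₂.mono h₁))
  exact h₂ (h P h₁)

theorem Deriv.holds {Γ : List Formula} {φ : Formula} (h : Deriv T Γ φ) {P : PrimeTheory T}
    (hP : P.Models Γ) : P.Holds φ := P.closed hP h

namespace PrimeTheory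

variable (P : PrimeTheory T) {φ ψ : Formula}

theorem holds_of_deriv (h : Deriv T [] φ) : P.Holds φ := P.closed (by simp) h

theorem mp (h : P.Holds (.imp φ ψ)) (h' : P.Holds φ) : P.Holds ψ :=
  P.closed (Γ := [.imp φ ψ, φ]) (by simpa using ⟨h, h'⟩)
    (.impE (φ := φ) (.hyp (by simp)) (.hyp (by simp)))

@[simp] theorem holds_bot : P.Holds .bot ↔ False := iff_false_intro P.not_bot

@[simp] theorem holds_and : P.Holds (.and φ ψ) ↔ P.Holds φ ∧ P.Holds ψ :=
  ⟨fun h => ⟨P.closed (Γ := [.and φ ψ]) (by simpa) (.andE₁ (.hyp (List.mem_singleton_self _))),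
    P.closed (Γ := [.and φ ψ]) (by simpa) (.andE₂ (.hyp (List.mem_singleton_self _)))⟩,
    fun h => P.closed (Γ := [φ, ψ]) (by simpa) (.andI (.hyp (by simp)) (.hyp (by simp)))⟩

@[simp] theorem holds_or : P.Holds (.or φ ψ) ↔ P.Holds φ ∨ P.Holds ψ := by
  refine ⟨P.or_prime, ?_⟩
  rintro (h | h)
  · exact P.closed (Γ := [φ]) (by simpa) (.orI₁ (.hyp (by simp)))
  · exact P.closed (Γ := [ψ]) (by simpa) (.orI₂ (.hyp (by simp)))

theorem holds_allN (h : P.Holds (.allN φ)) (t : Term) : P.Holds (φ.instN t) :=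
  P.closed (Γ := [.allN φ]) (by simpa) (.allNE t (.hyp (by simp)))

/-- The Kripke clause for implication, with the prime theories ordered by inclusion as worlds. -/
theorem holds_imp_of (h : ∀ Q : PrimeTheory T, (∀ χ, P.Holds χ → Q.Holds χ) → Q.Holds φ →
    Q.Holds ψ) : P.Holds (.imp φ ψ) := by
  by_contra hn
  have : ¬ Entails T (insert φ {χ | P.Holds χ}) ψ := by
    intro hE
    obtain ⟨Γ, h₁, h₂⟩ := hE.imp
    exact hn (P.closed h₁ h₂)
  obtain ⟨Q, h₁, h₂⟩ := exists_primeTheory this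
  exact h₂ (h Q (fun χ hχ => h₁ χ (Set.mem_insert_of_mem _ hχ)) (h₁ φ (Set.mem_insert _ _)))

/-- If the antecedent is decided, larger prime theories bring nothing new: it is already true, or
its negation persists. -/
theorem holds_imp_iff (hφ : P.Holds φ ∨ P.Holds φ.neg) :
    P.Holds (.imp φ ψ) ↔ (P.Holds φ → P.Holds ψ) := by
  refine ⟨P.mp, fun h => P.holds_imp_of fun Q hQ hφ' => ?_⟩
  rcases hφ with hφ | hφ
  · exact hQ _ (h hφ)
  · exact absurd (Q.mp (hQ _ hφ) hφ') Q.not_bot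

/-! ### The numbers of a prime theory -/

theorem holds_eq_refl (t : Term) : P.Holds (.eq t t) := P.holds_of_deriv (.eqI t)

theorem holds_subst {s t : Term} (φ : Formula) (h : P.Holds (.eq s t))
    (h' : P.Holds (φ.instN s)) : P.Holds (φ.instN t) :=
  P.closed (Γ := [.eq s t, φ.instN s]) (by simpa using ⟨h, h'⟩)
    (.eqE φ (s := s) (.hyp (by simp)) (.hyp (by simp)))

theorem holds_eq_symm {s t : Term} (h : P.Holds (.eq s t)) : P.Holds (.eq t s) := by
  have := P.holds_subst (.eq (.var 0) s.shiftN) h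
  simpa [Formula.instN_def, Formula.subst, Term.subst, P.holds_eq_refl] using this

theorem holds_eq_trans {r s t : Term} (h : P.Holds (.eq r s)) (h' : P.Holds (.eq s t)) :
    P.Holds (.eq r t) := by
  have := P.holds_subst (.eq r.shiftN (.var 0)) h'
  simpa [Formula.instN_def, Formula.subst, Term.subst, h] using this

/-- Provable equality of terms. -/
def setoid : Setoid Term where
  r s t := P.Holds (.eq s t)
  iseqv := ⟨P.holds_eq_refl, P.holds_eq_symm, P.holds_eq_trans⟩

/-- Terms up to provable equality. -/
def Num : Type := Quotient P.setoid

/-- The value of a term. -/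
def ev (t : Term) : P.Num := Quotient.mk P.setoid t

@[simp] theorem holds_eq {s t : Term} : P.Holds (.eq s t) ↔ P.ev s = P.ev t :=
  (Quotient.eq (r := P.setoid)).symm

theorem exists_ev (x : P.Num) : ∃ t, P.ev t = x := Quotient.exists_rep x

/-- The equality rule replaces a single variable, so congruence is first obtained in one argument;
`ev_app_congr` then changes the arguments one at a time. -/
theorem ev_app_update {n : ℕ} (F : FTerm n) (ts : Fin n → Term) (i : Fin n) (s t : Term)
    (h : P.ev s = P.ev t) : P.ev (.app F (Function.update ts i s)) =
      P.ev (.app F (Function.update ts i t)) := by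
  have key : ∀ r, (Term.app F (Function.update (fun j => (ts j).shiftN) i (.var 0))).subst
      (instσ r) .var = .app F (Function.update ts i r) := by
    intro r
    simp only [Term.subst, FTerm.subst_var]
    congr 1
    funext j
    by_cases hj : j = i
    · subst hj; simp [Term.subst]
    · simp [hj]
  have := P.holds_subst (.eq (Term.app F (Function.update ts i s)).shiftN
    (.app F (Function.update (fun j => (ts j).shiftN) i (.var 0)))) (P.holds_eq.2 h)
  simp only [Formula.instN_def, Formula.subst, Term.shiftN_instσ, Term.subst_var, key] at this
  exact P.holds_eq.1 (this (P.holds_eq_refl _))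

theorem ev_app_congr {n : ℕ} (F : FTerm n) (ts us : Fin n → Term)
    (h : ∀ i, P.ev (ts i) = P.ev (us i)) : P.ev (.app F ts) = P.ev (.app F us) := by
  suffices ∀ s : Finset (Fin n), P.ev (.app F (s.piecewise us ts)) = P.ev (.app F ts) by
    simpa using (this Finset.univ).symm
  intro s
  induction s using Finset.induction_on with
  | empty => simp
  | insert a s ha ih =>
    rw [← ih, Finset.piecewise_insert]
    conv_rhs => rw [← Function.update_eq_self a (s.piecewise us ts)]
    exact P.ev_app_update _ _ _ _ _ (by simp [ha, h])

/-- The functional `F` on the numbers of `P`. -/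
noncomputable def ap {n : ℕ} (F : FTerm n) (xs : Fin n → P.Num) : P.Num :=
  P.ev (.app F fun i => Quotient.out (xs i))

theorem ev_app {n : ℕ} (F : FTerm n) (ts : Fin n → Term) :
    P.ev (.app F ts) = P.ap F (fun i => P.ev (ts i)) :=
  P.ev_app_congr _ _ _ fun i => (Quotient.out_eq (P.ev (ts i))).symm

theorem exists_ev_vec {n : ℕ} (xs : Fin n → P.Num) :
    ∃ ts : Fin n → Term, xs = fun i => P.ev (ts i) := by
  choose ts h using fun i => P.exists_ev (xs i)
  exact ⟨ts, funext fun i => (h i).symm⟩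

instance : Zero P.Num := ⟨P.ev .zero⟩

/-- The successor function on the numbers of `P`. -/
noncomputable def sc (x : P.Num) : P.Num := P.ap .succ ![x]

@[simp] theorem ev_zero : P.ev .zero = 0 := rfl

@[simp] theorem ev_app_one (F : FTerm 1) (a : Term) : P.ev (.app F ![a]) = P.ap F ![P.ev a] := by
  rw [ev_app]
  congr 1
  funext i
  fin_cases i; rfl

@[simp] theorem ev_app_two (F : FTerm 2) (a b : Term) :
    P.ev (.app F ![a, b]) = P.ap F ![P.ev a, P.ev b] := by
  rw [ev_app]
  congr 1
  funext i
  fin_cases i <;> rfl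

@[simp] theorem ev_app_three (F : FTerm 3) (a b c : Term) :
    P.ev (.app F ![a, b, c]) = P.ap F ![P.ev a, P.ev b, P.ev c] := by
  rw [ev_app]
  congr 1
  funext i
  fin_cases i <;> rfl

@[simp] theorem ev_app_five (F : FTerm 5) (a b c d e : Term) :
    P.ev (.app F ![a, b, c, d, e]) = P.ap F ![P.ev a, P.ev b, P.ev c, P.ev d, P.ev e] := by
  rw [ev_app]
  congr 1
  funext i
  fin_cases i <;> rfl

theorem ev_succ_eq_sc (t : Term) : P.ev t.succ = P.sc (P.ev t) := P.ev_app_one _ _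

@[simp] theorem ap_zero (xs : Fin 0 → P.Num) : P.ap .zero xs = 0 := by
  change _ = P.ev (.app .zero ![])
  rw [ev_app]
  congr 1
  funext i
  exact i.elim0

theorem ev_app_cons {n : ℕ} (F : FTerm (n + 1)) (t : Term) (ts : Fin n → Term) :
    P.ev (.app F (Fin.cons t ts)) = P.ap F (Matrix.vecCons (P.ev t) (fun i => P.ev (ts i))) := by
  rw [ev_app]
  congr 1
  funext i
  refine Fin.cases ?_ (fun i => ?_) i <;> simp

variable [IsTheory T]

theorem holds_of_isRCAAxiom (h : IsRCAAxiom φ) : P.Holds φ :=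
  P.holds_of_deriv (.ax (IsTheory.rca h))

@[simp] theorem ap_proj {n : ℕ} (i : Fin n) (xs : Fin n → P.Num) : P.ap (.proj i) xs = xs i := by
  obtain ⟨ts, rfl⟩ := P.exists_ev_vec xs
  rw [← ev_app]
  exact P.holds_eq.1 (P.holds_of_isRCAAxiom (.proj i ts))

theorem ap_comp {m n : ℕ} (f : FTerm m) (g : Fin m → FTerm n) (xs : Fin n → P.Num) :
    P.ap (.comp f g) xs = P.ap f (fun i => P.ap (g i) xs) := by
  obtain ⟨ts, rfl⟩ := P.exists_ev_vec xs
  simp only [← ev_app]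
  exact P.holds_eq.1 (P.holds_of_isRCAAxiom (.comp f g ts))

@[simp] theorem ap_comp_zero {n : ℕ} (f : FTerm 0) (xs : Fin n → P.Num) :
    P.ap (.comp f ![]) xs = P.ap f ![] := by
  rw [ap_comp]
  congr 1
  funext i
  exact i.elim0

@[simp] theorem ap_comp_one {n : ℕ} (f : FTerm 1) (g : FTerm n) (xs : Fin n → P.Num) :
    P.ap (.comp f ![g]) xs = P.ap f ![P.ap g xs] := by
  rw [ap_comp]
  congr 1
  funext i
  fin_cases i; rfl

@[simp] theorem ap_comp_two {n : ℕ} (f : FTerm 2) (g h : FTerm n) (xs : Fin n → P.Num) :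
    P.ap (.comp f ![g, h]) xs = P.ap f ![P.ap g xs, P.ap h xs] := by
  rw [ap_comp]
  congr 1
  funext i
  fin_cases i <;> rfl

@[simp] theorem ap_comp_three {n : ℕ} (f : FTerm 3) (g h k : FTerm n) (xs : Fin n → P.Num) :
    P.ap (.comp f ![g, h, k]) xs = P.ap f ![P.ap g xs, P.ap h xs, P.ap k xs] := by
  rw [ap_comp]
  congr 1
  funext i
  fin_cases i <;> rfl

theorem ap_prec_zero {n : ℕ} (f : FTerm n) (g : FTerm (n + 2)) (xs : Fin n → P.Num) :
    P.ap (.prec f g) (Matrix.vecCons 0 xs) = P.ap f xs := by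
  obtain ⟨ts, rfl⟩ := P.exists_ev_vec xs
  have := P.holds_eq.1 (P.holds_of_isRCAAxiom (.prec_zero f g ts))
  rw [ev_app_cons, ev_app] at this
  exact this

theorem ap_prec_sc {n : ℕ} (f : FTerm n) (g : FTerm (n + 2)) (x : P.Num) (xs : Fin n → P.Num) :
    P.ap (.prec f g) (Matrix.vecCons (P.sc x) xs) =
      P.ap g (Matrix.vecCons x (Matrix.vecCons (P.ap (.prec f g) (Matrix.vecCons x xs)) xs)) := by
  obtain ⟨ts, rfl⟩ := P.exists_ev_vec xs
  obtain ⟨t, rfl⟩ := P.exists_ev x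
  have := P.holds_eq.1 (P.holds_of_isRCAAxiom (.prec_succ f g t ts))
  rw [ev_app_cons, ev_succ_eq_sc, ev_app_cons] at this
  rw [this]
  congr 2
  funext i
  refine Fin.cases ?_ (fun i => ?_) i <;> simp [ev_app_cons]

theorem sc_ne_zero (x : P.Num) : P.sc x ≠ 0 := by
  obtain ⟨t, rfl⟩ := P.exists_ev x
  intro h
  refine P.not_bot (P.mp (P.holds_of_isRCAAxiom (.succ_ne_zero t)) ?_)
  rwa [holds_eq, ev_succ_eq_sc]

end PrimeTheory

/-! ### Induction -/

/-- The terms `A t` are the instances of one term. -/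
class UniformTerm (A : Term → Term) : Prop where
  exists_subst : ∃ a : Term, ∀ t, a.subst (instσ t) .var = A t

/-- The formulas `P t` are the instances of one quantifier-free formula. -/
class UniformFormula (P : Term → Formula) : Prop where
  exists_subst : ∃ φ : Formula, φ.QuantifierFree ∧ ∀ t, φ.subst (instσ t) .var = P t

section Uniform

variable (A B C D E : Term → Term) (P Q : Term → Formula)

/-- With these instances an induction statement can be written as a function of `t`; instance search
produces the open formula that the induction scheme requires. -/
instance : UniformTerm (fun t => t) := ⟨.var 0, fun t => by simp [Term.subst]⟩

instance (c : Term) : UniformTerm (fun _ => c) := ⟨c.shiftN, fun t => by simp⟩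

instance (F : FTerm 1) [UniformTerm A] : UniformTerm (fun t => .app F ![A t]) := by
  obtain ⟨a, ha⟩ := UniformTerm.exists_subst (A := A)
  exact ⟨.app F ![a], fun t => by simp [ha]⟩

instance (F : FTerm 2) [UniformTerm A] [UniformTerm B] :
    UniformTerm (fun t => .app F ![A t, B t]) := by
  obtain ⟨a, ha⟩ := UniformTerm.exists_subst (A := A)
  obtain ⟨b, hb⟩ := UniformTerm.exists_subst (A := B)
  exact ⟨.app F ![a, b], fun t => by simp [ha, hb]⟩

instance (F : FTerm 5) [UniformTerm A] [UniformTerm B] [UniformTerm C] [UniformTerm D]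
    [UniformTerm E] : UniformTerm (fun t => .app F ![A t, B t, C t, D t, E t]) := by
  obtain ⟨a, ha⟩ := UniformTerm.exists_subst (A := A)
  obtain ⟨b, hb⟩ := UniformTerm.exists_subst (A := B)
  obtain ⟨c, hc⟩ := UniformTerm.exists_subst (A := C)
  obtain ⟨d, hd⟩ := UniformTerm.exists_subst (A := D)
  obtain ⟨e, he⟩ := UniformTerm.exists_subst (A := E)
  refine ⟨.app F ![a, b, c, d, e], fun t => ?_⟩
  simp only [Term.subst, FTerm.subst_var]
  congr 1
  funext i
  fin_cases i <;> simp [ha, hb, hc, hd, he]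

instance [UniformTerm A] : UniformTerm (fun t => (A t).succ) :=
  inferInstanceAs (UniformTerm fun t => .app .succ ![A t])

instance : UniformTerm Term.succ := ⟨.succ (.var 0), fun t => by simp [Term.subst]⟩

instance : UniformFormula (fun _ => .bot) := ⟨.bot, trivial, fun _ => rfl⟩

instance [UniformTerm A] [UniformTerm B] : UniformFormula (fun t => .eq (A t) (B t)) := by
  obtain ⟨a, ha⟩ := UniformTerm.exists_subst (A := A)
  obtain ⟨b, hb⟩ := UniformTerm.exists_subst (A := B)
  exact ⟨.eq a b, trivial, fun t => by simp [Formula.subst, ha, hb]⟩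

instance [UniformTerm A] [UniformTerm B] : UniformFormula (fun t => .lt (A t) (B t)) :=
  inferInstanceAs (UniformFormula fun t => .eq (.app .sub ![.succ (A t), B t]) .zero)

instance (c : Term) : UniformFormula (Formula.lt c) :=
  inferInstanceAs (UniformFormula fun t => .eq (.app .sub ![.succ c, t]) .zero)

instance [UniformFormula P] [UniformFormula Q] : UniformFormula (fun t => .and (P t) (Q t)) := by
  obtain ⟨a, ha, ha'⟩ := UniformFormula.exists_subst (P := P)
  obtain ⟨b, hb, hb'⟩ := UniformFormula.exists_subst (P := Q)
  exact ⟨.and a b, ⟨ha, hb⟩, fun t => by simp [Formula.subst, ha', hb']⟩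

instance [UniformFormula P] [UniformFormula Q] : UniformFormula (fun t => .or (P t) (Q t)) := by
  obtain ⟨a, ha, ha'⟩ := UniformFormula.exists_subst (P := P)
  obtain ⟨b, hb, hb'⟩ := UniformFormula.exists_subst (P := Q)
  exact ⟨.or a b, ⟨ha, hb⟩, fun t => by simp [Formula.subst, ha', hb']⟩

instance [UniformFormula P] [UniformFormula Q] : UniformFormula (fun t => .imp (P t) (Q t)) := by
  obtain ⟨a, ha, ha'⟩ := UniformFormula.exists_subst (P := P)
  obtain ⟨b, hb, hb'⟩ := UniformFormula.exists_subst (P := Q)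
  exact ⟨.imp a b, ⟨ha, hb⟩, fun t => by simp [Formula.subst, ha', hb']⟩

instance [UniformFormula P] : UniformFormula (fun t => .neg (P t)) :=
  inferInstanceAs (UniformFormula fun t => .imp (P t) .bot)

end Uniform

variable [IsTheory T]

/-- Base and step are required in every prime theory over `Γ`, not just in `P`, because they must be
turned into derivations from `Γ` before the induction axiom applies. -/
theorem PrimeTheory.induction {Γ : List Formula} (φ : Term → Formula) [UniformFormula φ]
    (h₀ : ∀ P : PrimeTheory T, P.Models Γ → P.Holds (φ .zero))
    (hs : ∀ P : PrimeTheory T, P.Models Γ → ∀ t, P.Holds (φ t) → P.Holds (φ t.succ))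
    (P : PrimeTheory T) (hP : P.Models Γ) (t : Term) : P.Holds (φ t) := by
  obtain ⟨χ, hχ, hχ'⟩ := UniformFormula.exists_subst (P := φ)
  refine Deriv.holds (Γ := Γ) ?_ hP
  rw [← hχ' t]
  refine .allNE t (.impE (.ax (IsTheory.rca (.induction χ hχ))) (.andI ?_ ?_))
  · rw [Formula.instN_def, hχ']
    exact Deriv.complete h₀
  · refine Deriv.allN_intro fun s => ?_
    have : (χ.subst (fun x => Nat.casesOn x (.succ (.var 0)) (fun y => .var (y + 1))) .var).subst
        (instσ s) .var = φ s.succ := by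
      rw [← hχ', Formula.subst_subst]
      refine χ.subst_congr (fun x => ?_) (fun v => by simp)
      cases x <;> simp [Term.subst]
    rw [Formula.instN_def, Formula.subst, this, hχ']
    refine .impI (Deriv.complete fun Q hQ => ?_)
    exact hs Q (hQ.mono (by simp)) s (hQ _ (by simp))

theorem PrimeTheory.induction_nil (φ : Term → Formula) [UniformFormula φ]
    (h₀ : ∀ P : PrimeTheory T, P.Holds (φ .zero))
    (hs : ∀ (P : PrimeTheory T) (t), P.Holds (φ t) → P.Holds (φ t.succ))
    (P : PrimeTheory T) (t : Term) : P.Holds (φ t) :=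
  P.induction (Γ := []) φ (fun P _ => h₀ P) (fun P _ => hs P) P.models_nil t

end SecondOrder

/-! ### Arithmetic of the numbers of a prime theory -/

namespace SecondOrder

namespace PrimeTheory

variable {T : Set Formula} (P : PrimeTheory T)

/-! ### The ordered semiring of numbers -/

noncomputable instance : Add P.Num := ⟨fun x y => P.ap .add ![x, y]⟩
noncomputable instance : Mul P.Num := ⟨fun x y => P.ap .mul ![x, y]⟩
noncomputable instance : Sub P.Num := ⟨fun x y => P.ap .sub ![x, y]⟩
noncomputable instance : One P.Num := ⟨P.sc 0⟩

@[simp] theorem ap_add (x y : P.Num) : P.ap .add ![x, y] = x + y := rfl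
@[simp] theorem ap_mul (x y : P.Num) : P.ap .mul ![x, y] = x * y := rfl
@[simp] theorem ap_sub (x y : P.Num) : P.ap .sub ![x, y] = x - y := rfl
theorem ap_succ_eq_sc (x : P.Num) : P.ap .succ ![x] = P.sc x := rfl

variable [IsTheory T]

theorem zero_add' (y : P.Num) : 0 + y = y := by
  rw [← ap_add, FTerm.add, ap_prec_zero]; simp

theorem sc_add' (x y : P.Num) : P.sc x + y = P.sc (x + y) := by
  rw [← ap_add, FTerm.add, ap_prec_sc]; simp [ap_succ_eq_sc]; rfl

theorem add_zero' (x : P.Num) : x + 0 = x := by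
  obtain ⟨t, rfl⟩ := P.exists_ev x
  simpa using P.induction_nil (fun t => .eq (.app .add ![t, .zero]) t)
    (fun P => by simp [zero_add'])
    (fun P t h => by simp_all [ev_succ_eq_sc, sc_add']) t

theorem add_sc' (x y : P.Num) : x + P.sc y = P.sc (x + y) := by
  obtain ⟨t, rfl⟩ := P.exists_ev x
  obtain ⟨s, rfl⟩ := P.exists_ev y
  simpa [ev_succ_eq_sc] using P.induction_nil
    (fun t => .eq (.app .add ![t, s.succ]) (.succ (.app .add ![t, s])))
    (fun P => by simp [zero_add', ev_succ_eq_sc])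
    (fun P t h => by simp_all [ev_succ_eq_sc, sc_add']) t

theorem sc_eq (x : P.Num) : P.sc x = x + 1 := by
  change _ = x + P.sc 0
  rw [add_sc', add_zero']

theorem add_comm' (x y : P.Num) : x + y = y + x := by
  obtain ⟨t, rfl⟩ := P.exists_ev x
  obtain ⟨s, rfl⟩ := P.exists_ev y
  simpa using P.induction_nil
    (fun t => .eq (.app .add ![t, s]) (.app .add ![s, t]))
    (fun P => by simp [zero_add', add_zero'])
    (fun P t h => by simp_all [ev_succ_eq_sc, sc_add', add_sc']) t

theorem add_assoc' (x y z : P.Num) : x + y + z = x + (y + z) := by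
  obtain ⟨t, rfl⟩ := P.exists_ev x
  obtain ⟨s, rfl⟩ := P.exists_ev y
  obtain ⟨r, rfl⟩ := P.exists_ev z
  simpa using P.induction_nil
    (fun t => .eq (.app .add ![.app .add ![t, s], r]) (.app .add ![t, .app .add ![s, r]]))
    (fun P => by simp [zero_add'])
    (fun P t h => by simp_all [ev_succ_eq_sc, sc_add']) t

noncomputable instance : AddCommMonoid P.Num where
  add_assoc := P.add_assoc'
  zero_add := P.zero_add'
  add_zero := P.add_zero'
  add_comm := P.add_comm'
  nsmul := nsmulRec

theorem zero_mul' (y : P.Num) : 0 * y = 0 := by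
  rw [← ap_mul, FTerm.mul, ap_prec_zero]; simp

theorem add_one_mul' (x y : P.Num) : (x + 1) * y = x * y + y := by
  rw [← sc_eq, ← ap_mul, FTerm.mul, ap_prec_sc]; simp; rfl

@[simp] theorem ev_succ (t : Term) : P.ev t.succ = P.ev t + 1 := by rw [ev_succ_eq_sc, sc_eq]

@[simp] theorem ap_succ (x : P.Num) : P.ap .succ ![x] = x + 1 := P.sc_eq x

theorem mul_zero' (x : P.Num) : x * 0 = 0 := by
  obtain ⟨t, rfl⟩ := P.exists_ev x
  simpa using P.induction_nil (fun t => .eq (.app .mul ![t, .zero]) .zero)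
    (fun P => by simp [zero_mul'])
    (fun P t h => by simp_all [add_one_mul']) t

theorem mul_add_one' (x y : P.Num) : x * (y + 1) = x * y + x := by
  obtain ⟨t, rfl⟩ := P.exists_ev x
  obtain ⟨s, rfl⟩ := P.exists_ev y
  simpa using P.induction_nil
    (fun t => .eq (.app .mul ![t, s.succ]) (.app .add ![.app .mul ![t, s], t]))
    (fun P => by simp [zero_mul'])
    (fun P t h => by simp_all [add_one_mul']; ac_rfl) t

theorem mul_comm' (x y : P.Num) : x * y = y * x := by
  obtain ⟨t, rfl⟩ := P.exists_ev x
  obtain ⟨s, rfl⟩ := P.exists_ev y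
  simpa using P.induction_nil
    (fun t => .eq (.app .mul ![t, s]) (.app .mul ![s, t]))
    (fun P => by simp [zero_mul', mul_zero'])
    (fun P t h => by simp_all [add_one_mul', mul_add_one']) t

theorem mul_add' (x y z : P.Num) : x * (y + z) = x * y + x * z := by
  obtain ⟨t, rfl⟩ := P.exists_ev x
  obtain ⟨s, rfl⟩ := P.exists_ev y
  obtain ⟨r, rfl⟩ := P.exists_ev z
  simpa using P.induction_nil
    (fun t => .eq (.app .mul ![t, .app .add ![s, r]])
      (.app .add ![.app .mul ![t, s], .app .mul ![t, r]]))
    (fun P => by simp [zero_mul'])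
    (fun P t h => by simp_all [add_one_mul']; ac_rfl) t

theorem mul_assoc' (x y z : P.Num) : x * y * z = x * (y * z) := by
  obtain ⟨t, rfl⟩ := P.exists_ev x
  obtain ⟨s, rfl⟩ := P.exists_ev y
  obtain ⟨r, rfl⟩ := P.exists_ev z
  simpa using P.induction_nil
    (fun t => .eq (.app .mul ![.app .mul ![t, s], r]) (.app .mul ![t, .app .mul ![s, r]]))
    (fun P => by simp [zero_mul'])
    (fun P t h => by simp_all [add_one_mul', P.mul_comm' _ (P.ev r), mul_add']) t

noncomputable instance : CommSemiring P.Num where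
  __ := (inferInstance : AddCommMonoid P.Num)
  zero_mul := P.zero_mul'
  mul_zero := P.mul_zero'
  mul_comm := P.mul_comm'
  mul_assoc := P.mul_assoc'
  one_mul x := by
    have := P.add_one_mul' 0 x
    rwa [_root_.zero_add, P.zero_mul', _root_.zero_add] at this
  mul_one x := by
    have := P.mul_add_one' x 0
    rwa [_root_.zero_add, P.mul_zero', _root_.zero_add] at this
  left_distrib := P.mul_add'
  right_distrib x y z := by rw [P.mul_comm', P.mul_add', P.mul_comm' z, P.mul_comm' z]
  npow := npowRec
  natCast n := n.unaryCast
  natCast_zero := rfl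
  natCast_succ _ := rfl

theorem ap_prec_succ {n : ℕ} (f : FTerm n) (g : FTerm (n + 2)) (x : P.Num)
    (xs : Fin n → P.Num) : P.ap (.prec f g) (Matrix.vecCons (x + 1) xs) =
      P.ap g (Matrix.vecCons x (Matrix.vecCons (P.ap (.prec f g) (Matrix.vecCons x xs)) xs)) := by
  rw [← sc_eq, ap_prec_sc]

theorem add_one_ne_zero' (x : P.Num) : x + 1 ≠ 0 := by
  rw [← sc_eq]; exact P.sc_ne_zero x

@[simp] theorem ap_pred_zero : P.ap .pred ![0] = 0 := by
  rw [FTerm.pred, ap_prec_zero]; simp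

@[simp] theorem ap_pred_succ (x : P.Num) : P.ap .pred ![x + 1] = x := by
  rw [FTerm.pred, ap_prec_succ]; simp

/-- Naming the predecessor explicitly keeps the statement quantifier-free, hence open to induction.
-/
theorem eq_zero_or_eq_pred_add_one (x : P.Num) : x = 0 ∨ x = P.ap .pred ![x] + 1 := by
  obtain ⟨t, rfl⟩ := P.exists_ev x
  simpa using P.induction_nil (fun t => .or (.eq t .zero) (.eq t (.succ (.app .pred ![t]))))
    (fun P => by simp) (fun P t h => by simp) t

theorem eq_zero_or_exists_add_one (x : P.Num) : x = 0 ∨ ∃ y, x = y + 1 :=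
  (P.eq_zero_or_eq_pred_add_one x).imp_right fun h => ⟨_, h⟩

theorem sub_zero' (x : P.Num) : x - 0 = x := by
  rw [← ap_sub, FTerm.sub, ap_comp_two, ap_proj, ap_proj]
  simp [ap_prec_zero]

theorem sub_add_one' (x y : P.Num) : x - (y + 1) = P.ap .pred ![x - y] := by
  rw [← ap_sub, ← ap_sub, FTerm.sub, ap_comp_two, ap_proj, ap_proj, ap_comp_two, ap_proj, ap_proj]
  simp [ap_prec_succ]

theorem add_one_sub_add_one' (x y : P.Num) : (x + 1) - (y + 1) = x - y := by
  obtain ⟨s, rfl⟩ := P.exists_ev x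
  obtain ⟨t, rfl⟩ := P.exists_ev y
  simpa using P.induction_nil
    (fun t => .eq (.app .sub ![s.succ, t.succ]) (.app .sub ![s, t]))
    (fun P => by
      simp only [holds_eq, ev_app_two, ev_succ, ap_sub, ev_zero]
      rw [sub_add_one', sub_zero', sub_zero', ap_pred_succ])
    (fun P t h => by
      simp only [holds_eq, ev_app_two, ev_succ, ap_sub] at h ⊢
      rw [sub_add_one', h, sub_add_one']) t

theorem add_sub_left' (x y : P.Num) : (x + y) - x = y := by
  obtain ⟨t, rfl⟩ := P.exists_ev x
  obtain ⟨s, rfl⟩ := P.exists_ev y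
  simpa using P.induction_nil
    (fun t => .eq (.app .sub ![.app .add ![t, s], t]) s)
    (fun P => by simp [sub_zero'])
    (fun P t h => by
      simp only [holds_eq, ev_app_two, ev_succ, ap_sub, ap_add] at h ⊢
      rw [add_right_comm, add_one_sub_add_one', h]) t

theorem sub_add_self' (x y : P.Num) : x - (x + y) = 0 := by
  obtain ⟨s, rfl⟩ := P.exists_ev x
  obtain ⟨t, rfl⟩ := P.exists_ev y
  simpa using P.induction_nil
    (fun t => .eq (.app .sub ![s, .app .add ![s, t]]) .zero)
    (fun P => by simpa using P.add_sub_left' (P.ev s) 0)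
    (fun P t h => by
      simp only [holds_eq, ev_app_two, ev_succ, ap_sub, ap_add, ev_zero] at h ⊢
      rw [← add_assoc, sub_add_one', h, ap_pred_zero]) t

/-- Totality of the order, made quantifier-free by naming the differences. In the step `t` to `t +
1` only the case `s = t + c` splits: for `c = 0` the order of the two numbers is reversed. -/
theorem eq_add_sub_or (x y : P.Num) : y = x + (y - x) ∨ x = y + (x - y) := by
  obtain ⟨s, rfl⟩ := P.exists_ev x
  obtain ⟨t, rfl⟩ := P.exists_ev y
  simpa using P.induction_nil
    (fun t => .or (.eq t (.app .add ![s, .app .sub ![t, s]]))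
      (.eq s (.app .add ![t, .app .sub ![s, t]])))
    (fun P => by simp [sub_zero'])
    (fun P t h => by
      simp only [holds_or, holds_eq, ev_app_two, ev_succ, ap_sub, ap_add] at h ⊢
      obtain ⟨c, hc⟩ | ⟨c, hc⟩ : (∃ c, P.ev t = P.ev s + c) ∨ ∃ c, P.ev s = P.ev t + c :=
        h.imp (fun h => ⟨_, h⟩) fun h => ⟨_, h⟩
      · rw [hc, add_assoc, add_sub_left']; simp
      · rcases P.eq_zero_or_exists_add_one c with rfl | ⟨d, rfl⟩
        · rw [hc, add_zero, add_sub_left']; simp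
        · rw [hc, add_comm d, ← add_assoc, add_sub_left']; simp) t

theorem le_total' (x y : P.Num) : (∃ c, y = x + c) ∨ ∃ c, x = y + c :=
  (P.eq_add_sub_or x y).imp (fun h => ⟨_, h⟩) fun h => ⟨_, h⟩

theorem add_left_cancel' {x y z : P.Num} (h : x + y = x + z) : y = z := by
  rw [← P.add_sub_left' x y, h, P.add_sub_left']

theorem eq_zero_of_add_eq_zero' {x y : P.Num} (h : x + y = 0) : x = 0 := by
  rcases P.eq_zero_or_exists_add_one x with rfl | ⟨d, rfl⟩
  · rfl
  · rw [add_right_comm] at h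
    exact absurd h (P.add_one_ne_zero' _)

noncomputable instance : LinearOrder P.Num where
  le x y := ∃ c, y = x + c
  le_refl x := ⟨0, by simp⟩
  le_trans := by rintro x y z ⟨c, rfl⟩ ⟨d, rfl⟩; exact ⟨c + d, by rw [add_assoc]⟩
  le_antisymm := by
    rintro x y ⟨c, rfl⟩ ⟨d, h⟩
    have := P.add_left_cancel' (x := x) (y := c + d) (z := 0) (by rw [← add_assoc, ← h, add_zero])
    rw [P.eq_zero_of_add_eq_zero' this, add_zero]
  le_total := P.le_total'
  toDecidableLE := Classical.decRel _

theorem le_iff' {x y : P.Num} : x ≤ y ↔ ∃ c, y = x + c := Iff.rfl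

instance : IsOrderedCancelAddMonoid P.Num where
  add_le_add_left := by
    rintro x y ⟨c, rfl⟩ z
    exact ⟨c, by rw [add_right_comm]⟩
  le_of_add_le_add_left := by
    rintro x y z ⟨c, h⟩
    rw [add_assoc] at h
    exact ⟨c, P.add_left_cancel' h⟩

instance : CanonicallyOrderedAdd P.Num where
  exists_add_of_le h := h
  le_self_add _ y := ⟨y, rfl⟩
  le_add_self _ y := ⟨y, add_comm _ _⟩

instance : Nontrivial P.Num := ⟨⟨1, 0, by simpa using P.add_one_ne_zero' 0⟩⟩

theorem lt_iff_add_one_le {x y : P.Num} : x < y ↔ x + 1 ≤ y := by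
  constructor
  · intro h
    obtain ⟨c, rfl⟩ := h.le
    rcases P.eq_zero_or_exists_add_one c with rfl | ⟨d, rfl⟩
    · simp at h
    · exact ⟨d, by rw [add_comm d, add_assoc]⟩
  · rintro ⟨c, rfl⟩
    refine lt_of_le_of_ne ⟨1 + c, add_assoc _ _ _⟩ fun h => ?_
    rw [add_assoc] at h
    have := P.add_left_cancel' (x := x) (y := 0) (z := 1 + c) (by rwa [add_zero])
    exact P.add_one_ne_zero' c (by rw [add_comm, ← this])

theorem lt_add_one_iff' {x y : P.Num} : x < y + 1 ↔ x ≤ y := by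
  rw [lt_iff_add_one_le, add_le_add_iff_right]

theorem mul_pos' {x y : P.Num} (hx : 0 < x) (hy : 0 < y) : 0 < x * y := by
  rw [pos_iff_ne_zero] at *
  obtain ⟨a, rfl⟩ := (P.eq_zero_or_exists_add_one x).resolve_left hx
  obtain ⟨b, rfl⟩ := (P.eq_zero_or_exists_add_one y).resolve_left hy
  rw [mul_add, mul_one, ← add_assoc]
  exact P.add_one_ne_zero' _

instance : IsStrictOrderedRing P.Num :=
  have key : ∀ {a b c : P.Num}, 0 < a → b < c → a * b < a * c := by
    intro a b c ha h
    obtain ⟨d, rfl⟩ := h.le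
    have hd : 0 < d := by
      rw [pos_iff_ne_zero]; rintro rfl; simp at h
    rw [mul_add]
    exact lt_add_of_pos_right _ (P.mul_pos' ha hd)
  { zero_le_one := zero_le
    mul_lt_mul_of_pos_left := fun a ha b c h => key ha h
    mul_lt_mul_of_pos_right := fun a ha b c h => by
      rw [mul_comm b, mul_comm c]; exact key ha h }

/-- Makes the functional `sub` the truncated subtraction of the order; this is what gives the
equation coding `s < t` its meaning in `holds_lt`. -/
instance : OrderedSub P.Num where
  tsub_le_iff_right x y z := by
    rcases P.le_total' x y with ⟨c, rfl⟩ | ⟨c, rfl⟩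
    · rw [P.sub_add_self']
      simp only [zero_le, true_iff]
      exact le_add_left le_self_add
    · rw [P.add_sub_left', add_comm z, add_le_add_iff_left]

end PrimeTheory

end SecondOrder

/-! ### Decidability, primitive recursive functions and bounded search -/

namespace SecondOrder

/-! ### Primitive recursive functions without function variables -/

namespace FTerm

@[simp] theorem subst_comp_zero {n : ℕ} (f : FTerm 0) (τ : ℕ → FTerm 1) :
    (FTerm.comp f ![] : FTerm n).subst τ = .comp (f.subst τ) ![] := by
  simp only [FTerm.subst]
  congr 1
  funext i
  exact i.elim0

@[simp] theorem subst_comp_one {n : ℕ} (f : FTerm 1) (g : FTerm n) (τ : ℕ → FTerm 1) :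
    (FTerm.comp f ![g]).subst τ = .comp (f.subst τ) ![g.subst τ] := by
  simp only [FTerm.subst]
  congr 1
  funext i
  fin_cases i; rfl

@[simp] theorem subst_comp_two {n : ℕ} (f : FTerm 2) (g h : FTerm n) (τ : ℕ → FTerm 1) :
    (FTerm.comp f ![g, h]).subst τ = .comp (f.subst τ) ![g.subst τ, h.subst τ] := by
  simp only [FTerm.subst]
  congr 1
  funext i
  fin_cases i <;> rfl

@[simp] theorem subst_proj {n : ℕ} (i : Fin n) (τ : ℕ → FTerm 1) :
    (FTerm.proj i).subst τ = .proj i := rfl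

@[simp] theorem subst_zero (τ : ℕ → FTerm 1) : FTerm.zero.subst τ = .zero := rfl

@[simp] theorem subst_succ (τ : ℕ → FTerm 1) : FTerm.succ.subst τ = .succ := rfl

@[simp] theorem subst_prec {n : ℕ} (f : FTerm n) (g : FTerm (n + 2)) (τ : ℕ → FTerm 1) :
    (FTerm.prec f g).subst τ = .prec (f.subst τ) (g.subst τ) := rfl

variable (τ : ℕ → FTerm 1)

@[simp] theorem pred_subst : pred.subst τ = pred := by simp [pred]
@[simp] theorem add_subst : add.subst τ = add := by simp [add]
@[simp] theorem mul_subst : mul.subst τ = mul := by simp [mul]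
@[simp] theorem sub_subst : sub.subst τ = sub := by simp [sub]
@[simp] theorem pow_subst : pow.subst τ = pow := by simp [pow]
@[simp] theorem tri_subst : tri.subst τ = tri := by simp [tri]
@[simp] theorem isZero_subst : isZero.subst τ = isZero := by simp [isZero]
@[simp] theorem mod_subst : mod.subst τ = mod := by simp [mod]
@[simp] theorem div_subst : div.subst τ = div := by simp [div]
@[simp] theorem edgeCode_subst : edgeCode.subst τ = edgeCode := by simp [edgeCode]
@[simp] theorem pair_subst : pair.subst τ = pair := by simp [pair]
@[simp] theorem digit_subst : digit.subst τ = digit := by simp [digit]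

/-- `(x, a, b) ↦ a` if `x > 0`, and `(0, a, b) ↦ b`. -/
def cond : FTerm 3 := .prec (.proj 1) (.proj 2)

/-- The sum of the components of the pair with code `x`. -/
def diag : FTerm 1 :=
  -- Diagonal `d` consists of the codes from `tri (d + 1)` up to, but excluding, `tri (d + 2)`. So
  -- in passing from `x` to `x + 1` the value `d` grows by one exactly if `tri (d + 2) ≤ x + 1`.
  .prec .zero (.comp .add ![.proj 1, .comp .isZero ![.comp .sub
    ![.comp .tri ![.comp .succ ![.comp .succ ![.proj 1]]], .comp .succ ![.proj 0]]]])

/-- The first component of a pair. -/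
def fst : FTerm 1 := .comp .sub ![.proj 0, .comp .tri ![.comp .succ ![diag]]]

/-- The second component of a pair. -/
def snd : FTerm 1 := .comp .sub ![diag, fst]

/-- `search h (m, v)` is `x + 1` for the least `x < m` with `h (x, v) = 0`, and `0` if there is
none. -/
def search {n : ℕ} (h : FTerm (n + 1)) : FTerm (n + 1) :=
  .prec (.comp .zero ![]) (.comp cond ![.proj 1, .proj 1,
    .comp cond ![.comp h (Fin.cons (.proj 0) fun i => .proj i.succ.succ),
      .comp .zero ![], .comp .succ ![.proj 0]]])

@[simp] theorem diag_subst : diag.subst τ = diag := by simp [diag]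
@[simp] theorem fst_subst : fst.subst τ = fst := by simp [fst]
@[simp] theorem snd_subst : snd.subst τ = snd := by simp [snd]

end FTerm

@[simp] theorem Formula.quantifierFree_eq (s t : Term) : (Formula.eq s t).QuantifierFree := trivial
@[simp] theorem Formula.quantifierFree_bot : Formula.bot.QuantifierFree := trivial
@[simp] theorem Formula.quantifierFree_lt (s t : Term) : (Formula.lt s t).QuantifierFree := trivial
@[simp] theorem Formula.quantifierFree_neg (φ : Formula) :
    φ.neg.QuantifierFree ↔ φ.QuantifierFree := by simp [Formula.neg, Formula.QuantifierFree]
@[simp] theorem Formula.quantifierFree_and (φ ψ : Formula) :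
    (φ.and ψ).QuantifierFree ↔ φ.QuantifierFree ∧ ψ.QuantifierFree := Iff.rfl
@[simp] theorem Formula.quantifierFree_or (φ ψ : Formula) :
    (φ.or ψ).QuantifierFree ↔ φ.QuantifierFree ∧ ψ.QuantifierFree := Iff.rfl

/-- Only the first argument varies, the others being parameters: the form needed for induction on
the bound of a search of arbitrary arity. -/
instance (A : Term → Term) [UniformTerm A] {n : ℕ} (F : FTerm (n + 1)) (ts : Fin n → Term) :
    UniformTerm (fun t => .app F (Matrix.vecCons (A t) ts)) := by
  obtain ⟨a, ha⟩ := UniformTerm.exists_subst (A := A)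
  refine ⟨.app F (Fin.cons a fun i => (ts i).shiftN), fun t => ?_⟩
  rw [Term.subst_app_cons]
  simp [ha]
  rfl

namespace PrimeTheory

variable {T : Set Formula} [IsTheory T] (P : PrimeTheory T)

omit [IsTheory T] in
theorem ev_app_vecCons {n : ℕ} (F : FTerm (n + 1)) (t : Term) (ts : Fin n → Term) :
    P.ev (.app F (Matrix.vecCons t ts)) =
      P.ap F (Matrix.vecCons (P.ev t) (fun i => P.ev (ts i))) := P.ev_app_cons F t ts

omit [IsTheory T] in
theorem ev_vecEmpty : (fun i => P.ev ((![] : Fin 0 → Term) i)) = ![] :=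
  funext fun i => i.elim0

/-! ### Decidability of quantifier-free formulas -/

theorem holds_eq_or_neg (s t : Term) : P.Holds (.eq s t) ∨ P.Holds (.neg (.eq s t)) := by
  have key : ∀ r, P.Holds (.eq r .zero) ∨ P.Holds (.neg (.eq r .zero)) := fun r => by
    rw [← holds_or]
    refine P.induction_nil (fun r => .or (.eq r .zero) (.neg (.eq r .zero)))
      (fun P => by simp) (fun P t _ => ?_) r
    rw [holds_or]
    exact Or.inr (P.holds_of_isRCAAxiom (.succ_ne_zero t))
  -- Equality of `s` and `t` is reduced to the vanishing of `(s - t) + (t - s)`; equality with `0`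
  -- is decided by induction.
  rcases key (.app .add ![.app .sub ![s, t], .app .sub ![t, s]]) with h | h
  · left
    simp only [holds_eq, ev_app_two, ap_add, ap_sub, ev_zero, add_eq_zero,
      tsub_eq_zero_iff_le] at h ⊢
    exact le_antisymm h.1 h.2
  · right
    refine P.holds_imp_of fun Q hQ hst => ?_
    refine Q.mp (hQ _ h) ?_
    simp only [holds_eq] at hst
    simp [hst]

/-- Excluded middle for quantifier-free formulas, by induction from decidable equations. Together
with primeness it makes the connectives truth-functional on such formulas. -/
theorem holds_or_neg {φ : Formula} (h : φ.QuantifierFree) : P.Holds φ ∨ P.Holds φ.neg := by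
  have neg_of : ∀ {φ : Formula}, (∀ Q : PrimeTheory T, (∀ χ, P.Holds χ → Q.Holds χ) →
      Q.Holds φ → False) → P.Holds φ.neg := fun h =>
    P.holds_imp_of fun Q hQ hφ => (h Q hQ hφ).elim
  have neg_elim : ∀ {φ : Formula} (Q : PrimeTheory T), (∀ χ, P.Holds χ → Q.Holds χ) →
      P.Holds φ.neg → Q.Holds φ → False := fun Q hQ h h' => Q.not_bot (Q.mp (hQ _ h) h')
  induction φ with
  | bot => exact Or.inr (neg_of fun Q _ => Q.not_bot)
  | eq s t => exact P.holds_eq_or_neg s t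
  | and φ ψ ih₁ ih₂ =>
    rcases ih₁ h.1 with h₁ | h₁
    · rcases ih₂ h.2 with h₂ | h₂
      · exact Or.inl (P.holds_and.2 ⟨h₁, h₂⟩)
      · exact Or.inr (neg_of fun Q hQ h => neg_elim Q hQ h₂ (Q.holds_and.1 h).2)
    · exact Or.inr (neg_of fun Q hQ h => neg_elim Q hQ h₁ (Q.holds_and.1 h).1)
  | or φ ψ ih₁ ih₂ =>
    rcases ih₁ h.1 with h₁ | h₁
    · exact Or.inl (P.holds_or.2 (Or.inl h₁))
    · rcases ih₂ h.2 with h₂ | h₂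
      · exact Or.inl (P.holds_or.2 (Or.inr h₂))
      · exact Or.inr (neg_of fun Q hQ h =>
          (Q.holds_or.1 h).elim (neg_elim Q hQ h₁) (neg_elim Q hQ h₂))
  | imp φ ψ ih₁ ih₂ =>
    rcases ih₂ h.2 with h₂ | h₂
    · exact Or.inl (P.holds_imp_of fun Q hQ _ => hQ _ h₂)
    · rcases ih₁ h.1 with h₁ | h₁
      · exact Or.inr (neg_of fun Q hQ h => neg_elim Q hQ h₂ (Q.mp h (hQ _ h₁)))
      · exact Or.inl (P.holds_imp_of fun Q hQ h => (neg_elim Q hQ h₁ h).elim)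
  | _ => exact h.elim

@[simp] theorem holds_imp {φ ψ : Formula} (h : φ.QuantifierFree) :
    P.Holds (.imp φ ψ) ↔ (P.Holds φ → P.Holds ψ) := P.holds_imp_iff (P.holds_or_neg h)

@[simp] theorem holds_neg {φ : Formula} (h : φ.QuantifierFree) :
    P.Holds φ.neg ↔ ¬ P.Holds φ := by
  rw [Formula.neg, holds_imp _ h, holds_bot]

@[simp] theorem holds_lt (s t : Term) : P.Holds (.lt s t) ↔ P.ev s < P.ev t := by
  simp [Formula.lt, P.lt_iff_add_one_le, tsub_eq_zero_iff_le]

/-! ### Values of primitive recursive functions -/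

@[simp] theorem ap_isZero_zero : P.ap .isZero ![0] = 1 := by
  rw [FTerm.isZero, ap_prec_zero]; simp

@[simp] theorem ap_isZero_succ (x : P.Num) : P.ap .isZero ![x + 1] = 0 := by
  rw [FTerm.isZero, ap_prec_succ]; simp

theorem ap_isZero_of_ne {x : P.Num} (h : x ≠ 0) : P.ap .isZero ![x] = 0 := by
  obtain ⟨y, rfl⟩ := (P.eq_zero_or_exists_add_one x).resolve_left h
  simp

@[simp] theorem ap_cond_zero (a b : P.Num) : P.ap .cond ![0, a, b] = b := by
  rw [FTerm.cond, ap_prec_zero]; simp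

theorem ap_cond_of_ne {x : P.Num} (h : x ≠ 0) (a b : P.Num) : P.ap .cond ![x, a, b] = a := by
  obtain ⟨y, rfl⟩ := (P.eq_zero_or_exists_add_one x).resolve_left h
  rw [FTerm.cond, ap_prec_succ]; simp

@[simp] theorem ap_tri_zero : P.ap .tri ![0] = 0 := by
  rw [FTerm.tri, ap_prec_zero]; simp

@[simp] theorem ap_tri_succ (x : P.Num) : P.ap .tri ![x + 1] = x + P.ap .tri ![x] := by
  conv_lhs => rw [FTerm.tri, ap_prec_succ]
  simp; rfl

theorem ap_edgeCode (x y : P.Num) : P.ap .edgeCode ![x, y] = P.ap .tri ![y] + x := by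
  simp [FTerm.edgeCode]

theorem ap_pair (x y : P.Num) : P.ap .pair ![x, y] = P.ap .tri ![x + y + 1] + x := by
  rw [FTerm.pair, ap_comp_two, ap_edgeCode]; simp

theorem ap_edgeCode_add (x y : P.Num) :
    P.ap .edgeCode ![x, x + y + 1] = P.ap .pair ![x, y] := by
  rw [ap_edgeCode, ap_pair]

@[simp] theorem ap_diag_zero : P.ap .diag ![0] = 0 := by
  rw [FTerm.diag, ap_prec_zero]; simp

theorem ap_diag_succ (x : P.Num) : P.ap .diag ![x + 1] = P.ap .diag ![x] +
    P.ap .isZero ![P.ap .tri ![P.ap .diag ![x] + 1 + 1] - (x + 1)] := by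
  conv_lhs => rw [FTerm.diag, ap_prec_succ]
  rw [← FTerm.diag]
  simp

/-- Along a diagonal the next triangular number stays out of reach, so the value does not change.
The bound on `i` is part of the induction statement. -/
theorem ap_diag_tri_add {s i : P.Num} (hs : P.ap .diag ![P.ap .tri ![s + 1]] = s) (hi : i ≤ s) :
    P.ap .diag ![P.ap .tri ![s + 1] + i] = s := by
  obtain ⟨s, rfl⟩ := P.exists_ev s
  obtain ⟨i, rfl⟩ := P.exists_ev i
  have := P.induction_nil (fun i => .imp
      (.eq (.app .diag ![.app .tri ![s.succ]]) s)
      (.imp (.lt i s.succ) (.eq (.app .diag ![.app .add ![.app .tri ![s.succ], i]]) s)))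
    (fun P => by simp) (fun P i ih => by
      simp only [holds_imp, holds_eq, holds_lt, Formula.quantifierFree_eq,
        Formula.quantifierFree_lt, ev_app_one, ev_app_two, ev_succ, ap_add] at ih ⊢
      intro h hi
      have := ih h ((lt_add_one _).trans hi)
      rw [← add_assoc, ap_diag_succ, this, ap_tri_succ _ (_ + 1), ap_isZero_of_ne, add_zero]
      rw [ne_eq, tsub_eq_zero_iff_le, not_le]
      grind) i
  simp only [holds_imp, holds_eq, holds_lt, Formula.quantifierFree_eq,
    Formula.quantifierFree_lt, ev_app_one, ev_app_two, ev_succ, ap_add] at this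
  exact this hs (P.lt_add_one_iff'.2 hi)

theorem ap_diag_tri (s : P.Num) : P.ap .diag ![P.ap .tri ![s + 1]] = s := by
  obtain ⟨s, rfl⟩ := P.exists_ev s
  simpa only [holds_eq, ev_app_one, ev_succ] using P.induction_nil
    (fun s => .eq (.app .diag ![.app .tri ![s.succ]]) s)
    (fun P => by
      have := P.ap_tri_succ 0
      rw [zero_add, zero_add, ap_tri_zero] at this
      simp [this]) (fun P s ih => by
      simp only [holds_eq, ev_app_one, ev_succ] at ih ⊢
      rw [ap_tri_succ _ (_ + 1), add_comm, ← add_assoc, ap_diag_succ,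
        P.ap_diag_tri_add ih le_rfl, ap_tri_succ _ (_ + 1), add_comm (P.ev s + 1), ← add_assoc]
      simp) s

theorem ap_diag_pair (x y : P.Num) : P.ap .diag ![P.ap .pair ![x, y]] = x + y := by
  rw [ap_pair, P.ap_diag_tri_add (P.ap_diag_tri _) le_self_add]

@[simp] theorem ap_fst_pair (x y : P.Num) : P.ap .fst ![P.ap .pair ![x, y]] = x := by
  simp only [FTerm.fst, ap_comp_two, ap_proj, ap_comp_one, Matrix.cons_val_zero, ap_diag_pair,
    ap_succ, ap_sub]
  rw [ap_pair, add_sub_left']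

@[simp] theorem ap_snd_pair (x y : P.Num) : P.ap .snd ![P.ap .pair ![x, y]] = y := by
  simp only [FTerm.snd, ap_comp_two, ap_diag_pair, ap_fst_pair, ap_sub]
  rw [add_sub_left']

theorem ap_mod_zero (d : P.Num) : P.ap .mod ![0, d] = 0 := by
  rw [FTerm.mod, ap_prec_zero]; simp

theorem ap_mod_lt (x : P.Num) {d : P.Num} (hd : 0 < d) : P.ap .mod ![x, d] < d := by
  obtain ⟨x, rfl⟩ := P.exists_ev x
  obtain ⟨d, rfl⟩ := P.exists_ev d
  have := P.induction_nil (fun x => .imp (.lt .zero d) (.lt (.app .mod ![x, d]) d))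
    (fun P => by simp [ap_mod_zero]) (fun P x _ => by
      simp only [holds_imp, holds_lt, Formula.quantifierFree_lt, ev_app_two, ev_succ, ev_zero]
      intro hd
      rw [FTerm.mod, ap_prec_succ, ← FTerm.mod]
      simp only [ap_comp_two, ap_comp_one, ap_proj, ap_succ, ap_mul, ap_sub]
      simp only [Matrix.cons_val]
      by_cases h : P.ev d - (P.ap .mod ![P.ev x, P.ev d] + 1) = 0
      · simp [h, ap_isZero_of_ne, hd]
      · rw [P.ap_isZero_of_ne h, ap_isZero_zero, mul_one]
        rwa [tsub_eq_zero_iff_le, not_le] at h) x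
  simp only [holds_imp, holds_lt, Formula.quantifierFree_lt, ev_app_two, ev_zero] at this
  exact this hd

theorem ap_pow_zero (x : P.Num) : P.ap .pow ![x, 0] = 1 := by
  rw [FTerm.pow, ap_comp_two, ap_proj, ap_proj]
  simp [ap_prec_zero]

theorem ap_pow_succ (x y : P.Num) : P.ap .pow ![x, y + 1] = P.ap .pow ![x, y] * x := by
  simp only [FTerm.pow, ap_comp_two, ap_proj]
  simp [ap_prec_succ]

theorem ap_pow_pos {x : P.Num} (hx : 0 < x) (y : P.Num) : 0 < P.ap .pow ![x, y] := by
  obtain ⟨x, rfl⟩ := P.exists_ev x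
  obtain ⟨y, rfl⟩ := P.exists_ev y
  have := P.induction_nil (fun y => .imp (.lt .zero x) (.lt .zero (.app .pow ![x, y])))
    (fun P => by simp [ap_pow_zero]) (fun P x ih => by
      simp only [holds_imp, holds_lt, Formula.quantifierFree_lt, ev_app_two, ev_succ,
        ev_zero] at ih ⊢
      intro hx
      rw [ap_pow_succ]
      exact P.mul_pos' (ih hx) hx) y
  simp only [holds_imp, holds_lt, Formula.quantifierFree_lt, ev_app_two, ev_zero] at this
  exact this hx

theorem ap_digit_lt {k : P.Num} (hk : 0 < k) (s x : P.Num) : P.ap .digit ![k, s, x] < k := by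
  simp only [FTerm.digit, ap_comp_two, ap_proj]
  exact P.ap_mod_lt _ hk

/-! ### Bounded search -/

variable {n : ℕ} (h : FTerm (n + 1))

theorem ap_search_zero (xs : Fin n → P.Num) :
    P.ap (.search h) (Matrix.vecCons 0 xs) = 0 := by
  rw [FTerm.search, ap_prec_zero]; simp

theorem ap_search_succ (m : P.Num) (xs : Fin n → P.Num) :
    P.ap (.search h) (Matrix.vecCons (m + 1) xs) =
      P.ap .cond ![P.ap (.search h) (Matrix.vecCons m xs), P.ap (.search h) (Matrix.vecCons m xs),
        P.ap .cond ![P.ap h (Matrix.vecCons m xs), 0, m + 1]] := by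
  conv_lhs => rw [FTerm.search, ap_prec_succ, ← FTerm.search]
  simp only [ap_comp_three, ap_comp_one, ap_comp_zero, ap_zero, ap_proj, ap_succ]
  simp only [Matrix.cons_val_zero, Matrix.cons_val_one]
  have : ∀ r, P.ap (.comp h (Fin.cons (.proj 0) fun i => .proj i.succ.succ))
      (Matrix.vecCons m (Matrix.vecCons r xs)) = P.ap h (Matrix.vecCons m xs) := by
    intro r
    rw [ap_comp]
    congr 1
    funext i
    refine Fin.cases ?_ (fun i => ?_) i <;> simp
  rw [this]

/-- One step of the search: already successful and frozen, successful just now at `m`, or still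
unsuccessful. -/
theorem ap_search_cases (m : P.Num) (xs : Fin n → P.Num) :
    (P.ap (.search h) (Matrix.vecCons m xs) ≠ 0 ∧
      P.ap (.search h) (Matrix.vecCons (m + 1) xs) = P.ap (.search h) (Matrix.vecCons m xs)) ∨
    (P.ap (.search h) (Matrix.vecCons m xs) = 0 ∧ P.ap h (Matrix.vecCons m xs) = 0 ∧
      P.ap (.search h) (Matrix.vecCons (m + 1) xs) = m + 1) ∨
    (P.ap (.search h) (Matrix.vecCons m xs) = 0 ∧ P.ap h (Matrix.vecCons m xs) ≠ 0 ∧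
      P.ap (.search h) (Matrix.vecCons (m + 1) xs) = 0) := by
  rw [ap_search_succ]
  by_cases h₁ : P.ap (.search h) (Matrix.vecCons m xs) = 0
  · by_cases h₂ : P.ap h (Matrix.vecCons m xs) = 0
    · simp [h₁, h₂]
    · simp [h₁, h₂, ap_cond_of_ne]
  · simp [h₁, ap_cond_of_ne]

theorem search_spec (m : P.Num) (xs : Fin n → P.Num)
    (hm : P.ap (.search h) (Matrix.vecCons m xs) ≠ 0) :
    P.ap .pred ![P.ap (.search h) (Matrix.vecCons m xs)] < m ∧
      P.ap h (Matrix.vecCons (P.ap .pred ![P.ap (.search h) (Matrix.vecCons m xs)]) xs) = 0 := by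
  obtain ⟨m, rfl⟩ := P.exists_ev m
  obtain ⟨ts, rfl⟩ := P.exists_ev_vec xs
  have := P.induction_nil (fun m => .imp
      (.neg (.eq (.app (.search h) (Matrix.vecCons m ts)) .zero))
      (.and (.lt (.app .pred ![.app (.search h) (Matrix.vecCons m ts)]) m)
        (.eq (.app h (Matrix.vecCons (.app .pred ![.app (.search h) (Matrix.vecCons m ts)]) ts))
          .zero)))
    (fun P => by simp [ev_app_vecCons, ap_search_zero]) (fun P m ih => by
      simp only [holds_imp, holds_and, holds_neg, holds_eq, holds_lt, Formula.quantifierFree_eq,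
        Formula.quantifierFree_neg, ev_vecEmpty, ev_app_vecCons, ev_succ, ev_zero] at ih ⊢
      intro hm
      rcases P.ap_search_cases h (P.ev m) fun i => P.ev (ts i) with h₁ | h₁ | h₁
      · rw [h₁.2]
        exact ⟨(ih h₁.1).1.trans (lt_add_one _), (ih h₁.1).2⟩
      · rw [h₁.2.2]
        rw [ap_pred_succ]
        exact ⟨lt_add_one _, h₁.2.1⟩
      · exact absurd h₁.2.2 hm) m
  simp only [holds_imp, holds_and, holds_neg, holds_eq, holds_lt, Formula.quantifierFree_eq,
    Formula.quantifierFree_neg, ev_vecEmpty, ev_app_vecCons, ev_zero] at this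
  exact this hm

theorem search_ne_zero {m x : P.Num} {xs : Fin n → P.Num} (hx : x < m)
    (hx' : P.ap h (Matrix.vecCons x xs) = 0) :
    P.ap (.search h) (Matrix.vecCons m xs) ≠ 0 := by
  obtain ⟨m, rfl⟩ := P.exists_ev m
  obtain ⟨x, rfl⟩ := P.exists_ev x
  obtain ⟨ts, rfl⟩ := P.exists_ev_vec xs
  have := P.induction_nil (fun m => .imp (.lt x m)
      (.imp (.eq (.app h (Matrix.vecCons x ts)) .zero)
        (.neg (.eq (.app (.search h) (Matrix.vecCons m ts)) .zero))))
    (fun P => by simp) (fun P m ih => by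
      simp only [holds_imp, holds_neg, holds_eq, holds_lt, Formula.quantifierFree_eq,
        Formula.quantifierFree_lt, ev_app_vecCons, ev_succ, ev_zero] at ih ⊢
      intro hx hx'
      rcases P.ap_search_cases h (P.ev m) fun i => P.ev (ts i) with h₁ | h₁ | h₁
      · rw [h₁.2]; exact h₁.1
      · rw [h₁.2.2]; exact P.add_one_ne_zero' _
      · rcases (P.lt_add_one_iff'.1 hx).lt_or_eq with hlt | heq
        · exact absurd h₁.1 (ih hlt hx')
        · rw [heq] at hx'; exact absurd hx' h₁.2.1) m
  simp only [holds_imp, holds_neg, holds_eq, holds_lt, Formula.quantifierFree_eq,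
    Formula.quantifierFree_lt, ev_app_vecCons, ev_zero] at this
  exact this hx hx'

/-- A search stops at its first success: when the value `m + 1` was set, the search below `m` had
failed, which by `search_ne_zero` excludes any earlier zero. -/
theorem search_least {m x : P.Num} {xs : Fin n → P.Num}
    (hx : x + 1 < P.ap (.search h) (Matrix.vecCons m xs)) :
    P.ap h (Matrix.vecCons x xs) ≠ 0 := by
  obtain ⟨m, rfl⟩ := P.exists_ev m
  obtain ⟨x, rfl⟩ := P.exists_ev x
  obtain ⟨ts, rfl⟩ := P.exists_ev_vec xs
  have := P.induction_nil (fun m => .imp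
      (.lt x.succ (.app (.search h) (Matrix.vecCons m ts)))
      (.neg (.eq (.app h (Matrix.vecCons x ts)) .zero)))
    (fun P => by simp [ev_app_vecCons, ap_search_zero]) (fun P m ih => by
      simp only [holds_imp, holds_neg, holds_eq, holds_lt, Formula.quantifierFree_eq,
        Formula.quantifierFree_lt, ev_app_vecCons, ev_succ, ev_zero] at ih ⊢
      intro hx hx'
      rcases P.ap_search_cases h (P.ev m) fun i => P.ev (ts i) with h₁ | h₁ | h₁
      · rw [h₁.2] at hx; exact ih hx hx'
      · rw [h₁.2.2] at hx
        exact P.search_ne_zero h (by simpa using hx) hx' h₁.1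
      · rw [h₁.2.2] at hx; simp at hx) m
  simp only [holds_imp, holds_neg, holds_eq, holds_lt, Formula.quantifierFree_eq,
    Formula.quantifierFree_lt, ev_app_vecCons, ev_succ, ev_zero] at this
  exact this hx

theorem search_mono {m m' : P.Num} {xs : Fin n → P.Num} (hm : m ≤ m')
    (hs : P.ap (.search h) (Matrix.vecCons m xs) ≠ 0) :
    P.ap (.search h) (Matrix.vecCons m' xs) ≠ 0 :=
  have := P.search_spec h m xs hs
  P.search_ne_zero h (this.1.trans_le hm) this.2

end PrimeTheory

end SecondOrder

/-! ### Choice, comprehension and LPO as rules on prime theories -/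

namespace SecondOrder

@[simp] theorem Term.var_subst (x : ℕ) (σ : ℕ → Term) (τ : ℕ → FTerm 1) :
    (Term.var x).subst σ τ = σ x := rfl

@[simp] theorem FTerm.var_subst (v : ℕ) (τ : ℕ → FTerm 1) : (FTerm.var v).subst τ = τ v := rfl

@[simp] theorem liftN_zero (σ : ℕ → Term) : liftN σ 0 = .var 0 := rfl
@[simp] theorem liftN_succ (σ : ℕ → Term) (x : ℕ) : liftN σ (x + 1) = (σ x).shiftN := rfl
@[simp] theorem liftF_zero (τ : ℕ → FTerm 1) : liftF τ 0 = .var 0 := rfl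
@[simp] theorem liftF_succ (τ : ℕ → FTerm 1) (x : ℕ) : liftF τ (x + 1) = (τ x).shiftF := rfl
@[simp] theorem instτ_one (F : FTerm 1) : instτ F 1 = .var 0 := rfl

@[simp] theorem Term.shiftN_var (x : ℕ) : (Term.var x).shiftN = .var (x + 1) := rfl
@[simp] theorem Term.shiftF_var (x : ℕ) : (Term.var x).shiftF = .var x := rfl

@[simp] theorem FTerm.shiftF_instτ {n : ℕ} (F : FTerm n) (G : FTerm 1) :
    F.shiftF.subst (instτ G) = F := by
  rw [FTerm.shiftF_subst]; exact FTerm.subst_var F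

@[simp] theorem Formula.lt_subst (s t : Term) (σ : ℕ → Term) (τ : ℕ → FTerm 1) :
    (Formula.lt s t).subst σ τ = .lt (s.subst σ τ) (t.subst σ τ) := by
  simp [Formula.lt, Formula.subst]

@[simp] theorem Formula.eq_subst (s t : Term) (σ : ℕ → Term) (τ : ℕ → FTerm 1) :
    (Formula.eq s t).subst σ τ = .eq (s.subst σ τ) (t.subst σ τ) := rfl

@[simp] theorem Term.pred_subst (t : Term) (σ : ℕ → Term) (τ : ℕ → FTerm 1) :
    t.pred.subst σ τ = (t.subst σ τ).pred := by simp [Term.pred]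

@[simp] theorem Term.entry_subst (v : ℕ) (s t : Term) (σ : ℕ → Term) (τ : ℕ → FTerm 1) :
    (Term.entry v s t).subst σ τ =
      .app (τ v) ![.app .pair ![s.subst σ τ, t.subst σ τ]] := by simp [Term.entry]

variable {T : Set Formula} {Γ : List Formula}

namespace PrimeTheory

variable (P : PrimeTheory T)

theorem holds_exN {φ : Formula} {t : Term} (h : P.Holds (φ.instN t)) : P.Holds (.exN φ) :=
  P.closed (Γ := [φ.instN t]) (by simpa) (.exNI t (.hyp (by simp)))

theorem holds_iff {φ ψ : Formula} (h : P.Holds (.iff φ ψ)) : P.Holds φ ↔ P.Holds ψ :=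
  ⟨P.mp (P.holds_and.1 h).1, P.mp (P.holds_and.1 h).2⟩

@[simp] theorem ev_pred (t : Term) : P.ev t.pred = P.ap .pred ![P.ev t] := P.ev_app_one _ _

end PrimeTheory

theorem PrimeTheory.Models.cons {P : PrimeTheory T} {φ : Formula} (h : P.Models Γ)
    (hφ : P.Holds φ) : P.Models (φ :: Γ) := by
  simpa [PrimeTheory.Models] using ⟨hφ, h⟩

theorem PrimeTheory.Models.of_le {P Q : PrimeTheory T} (h : P.Models Γ)
    (hQ : ∀ χ, P.Holds χ → Q.Holds χ) : Q.Models Γ := fun φ hφ => hQ φ (h φ hφ)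

variable [IsTheory T]

/-! ### Choice and comprehension -/

/-- The substitution of `s` and `t` for the variables `0` and `1`. -/
def instσ₂ (s t : Term) : ℕ → Term := fun x => Nat.casesOn x s (instσ t)

@[simp] theorem instσ₂_zero (s t : Term) : instσ₂ s t 0 = s := rfl
@[simp] theorem instσ₂_one (s t : Term) : instσ₂ s t 1 = t := rfl
@[simp] theorem instσ₂_succ (s t : Term) (x : ℕ) : instσ₂ s t (x + 1) = instσ t x := rfl

omit [IsTheory T] in
theorem PrimeTheory.holds_exN_instN (P : PrimeTheory T) {φ : Formula} {s t : Term}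
    (h : P.Holds (φ.subst (instσ₂ s t) .var)) : P.Holds ((Formula.exN φ).instN t) := by
  refine P.holds_exN (t := s) ?_
  rw [Formula.subst_liftN_instN]
  exact h

/-- The choice axiom as an elimination rule. The premise is checked in all prime theories over `Γ`,
and the choice function enters as an arbitrary functional `G`. -/
theorem Deriv.choice {φ χ : Formula} (hφ : φ.QuantifierFree)
    (h : ∀ P : PrimeTheory T, P.Models Γ → ∀ t, P.Holds ((Formula.exN φ).instN t))
    (h' : ∀ G Δ, Γ ⊆ Δ → (∀ P : PrimeTheory T, P.Models Δ → ∀ t,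
      P.Holds (φ.subst (instσ₂ (.app G ![t]) t) .var)) → Deriv T Δ χ) : Deriv T Γ χ := by
  have h₁ : Deriv T Γ (.allN (.exN φ)) := by
    exact Deriv.allN_intro fun t => Deriv.complete fun P hP => h P hP t
  have h₂ : Deriv T Γ (choiceAxiom φ) := .ax (IsTheory.rca (.choice φ hφ))
  refine (h₂.impE h₁).exF_elim fun G Δ hΔ hG => h' G Δ hΔ fun P hP t => ?_
  have := (hG.holds hP)
  have := P.holds_allN this t
  convert this using 1
  simp only [Formula.instN_def, Formula.shiftF, Formula.subst_subst]
  refine φ.subst_congr (fun x => ?_) (fun v => ?_)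
  · rcases x with _ | x
    · simp
    · simp [Term.subst]
  · simp

/-- `G` is the characteristic function of `φ`. -/
def IsCharFun (T : Set Formula) (Γ : List Formula) (G : FTerm 1) (φ : Formula) : Prop :=
  ∀ P : PrimeTheory T, P.Models Γ → ∀ t, (P.ap G ![P.ev t] = 0 ∨ P.ap G ![P.ev t] = 1) ∧
    (P.ap G ![P.ev t] = 1 ↔ P.Holds (φ.instN t))

/-- The matrix of `comprehensionAxiom φ`. -/
def comprehensionMatrix (φ : Formula) : Formula :=
  Formula.and
    (.or (.eq (.fn 0 (.var 0)) .zero) (.eq (.fn 0 (.var 0)) (.succ .zero)))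
    (.iff (.eq (.fn 0 (.var 0)) (.succ .zero)) φ.shiftF)

theorem comprehensionMatrix_subst (φ : Formula) (G : FTerm 1) (t : Term) :
    ((comprehensionMatrix φ).subst (liftN .var) (instτ G)).subst (instσ t) .var =
    .and (.or (.eq (.app G ![t]) .zero) (.eq (.app G ![t]) (.succ .zero)))
      (.iff (.eq (.app G ![t]) (.succ .zero)) (φ.instN t)) := by
  have : (φ.shiftF.subst .var (instτ G)).subst (instσ t) .var = φ.instN t := by
    rw [Formula.instN_def, Formula.shiftF, Formula.subst_subst, Formula.subst_subst]
    exact φ.subst_congr (fun x => by simp) (fun v => by simp)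
  simp [comprehensionMatrix, Formula.subst, Formula.iff, this]

theorem IsCharFun.deriv {G : FTerm 1} {φ : Formula} (h : IsCharFun T Γ G φ) :
    Deriv T Γ (comprehensionAxiom φ) := by
  refine .exFI G (Deriv.allN_intro fun t => ?_)
  change Deriv T Γ (((comprehensionMatrix φ).subst (liftN .var) (instτ G)).subst (instσ t) .var)
  rw [comprehensionMatrix_subst]
  refine Deriv.complete fun P hP => ?_
  simp only [PrimeTheory.holds_and, PrimeTheory.holds_or, PrimeTheory.holds_eq,
    PrimeTheory.ev_app_one, PrimeTheory.ev_succ, PrimeTheory.ev_zero, zero_add, Formula.iff]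
  -- As `φ` may contain quantifiers, the implication from `φ` has to be checked in all larger prime
  -- theories; the other one has an equation as antecedent.
  refine ⟨(h P hP t).1, ?_, P.holds_imp_of fun Q hQ hφ => ?_⟩
  · simpa using (h P hP t).2.1
  · simpa using (h Q (hP.of_le hQ) t).2.2 hφ

theorem Deriv.comprehension_elim {φ χ : Formula} (h : Deriv T Γ (comprehensionAxiom φ))
    (h' : ∀ G Δ, Γ ⊆ Δ → IsCharFun T Δ G φ → Deriv T Δ χ) : Deriv T Γ χ := by
  refine h.exF_elim fun G Δ hΔ hG => h' G Δ hΔ fun P hP t => ?_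
  have := P.holds_allN (hG.holds hP) t
  change P.Holds (((comprehensionMatrix φ).subst (liftN .var) (instτ G)).subst (instσ t) .var)
    at this
  rw [comprehensionMatrix_subst, PrimeTheory.holds_and] at this
  have h₂ := P.holds_iff this.2
  simpa using And.intro this.1 h₂

/-- Comprehension for quantifier-free formulas. -/
theorem Deriv.comprehension_quantifierFree {φ : Formula} (hφ : φ.QuantifierFree) :
    Deriv T Γ (comprehensionAxiom φ) := by
  have key : ∀ s t : Term, ((Formula.or (.and (.eq (.var 0) (.succ .zero)) φ.shiftN)
      (.and (.eq (.var 0) .zero) φ.shiftN.neg)).subst (instσ₂ s t) .var) =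
      .or (.and (.eq s (.succ .zero)) (φ.instN t)) (.and (.eq s .zero) (φ.instN t).neg) := by
    intro s t
    have : φ.shiftN.subst (instσ₂ s t) .var = φ.instN t := by
      rw [Formula.shiftN, Formula.subst_subst]; rfl
    simp [Formula.subst, this, Formula.neg]
  have hqf : ∀ t, (φ.instN t).QuantifierFree := fun t => hφ.subst _ _
  -- Choice is applied to "`y = 1` and `φ(x)`, or `y = 0` and not `φ(x)`"; a suitable `y` exists
  -- since `φ` is decidable.
  refine Deriv.choice (φ := .or (.and (.eq (.var 0) (.succ .zero)) φ.shiftN)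
    (.and (.eq (.var 0) .zero) φ.shiftN.neg)) (by simp [Formula.shiftN, hφ.subst])
    (fun P _ t => ?_) (fun G Δ _ hG => (IsCharFun.deriv (G := G) fun P hP t => ?_))
  · rcases P.holds_or_neg (hqf t) with h | h
    · refine P.holds_exN_instN (s := .succ .zero) ?_
      rw [key]
      simp [h]
    · refine P.holds_exN_instN (s := .zero) ?_
      rw [key]
      simp [h]
  · have := hG P hP t
    simp only [key, PrimeTheory.holds_or, PrimeTheory.holds_and, PrimeTheory.holds_eq,
      PrimeTheory.holds_neg _ (hqf t), PrimeTheory.ev_app_one, PrimeTheory.ev_succ,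
      PrimeTheory.ev_zero, zero_add] at this
    rcases this with ⟨h₁, h₂⟩ | ⟨h₁, h₂⟩ <;> simp [h₁, h₂]

/-- Lets comprehension for a complex formula follow from a quantifier-free one that mentions
functions already obtained. -/
theorem Deriv.comprehension_congr {φ ψ : Formula} (h : Deriv T Γ (comprehensionAxiom ψ))
    (h' : ∀ P : PrimeTheory T, P.Models Γ → ∀ t, P.Holds (ψ.instN t) ↔ P.Holds (φ.instN t)) :
    Deriv T Γ (comprehensionAxiom φ) :=
  h.comprehension_elim fun _ _ hΔ hG => IsCharFun.deriv fun P hP t =>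
    ⟨(hG P hP t).1, (hG P hP t).2.trans (h' P (hP.mono hΔ) t)⟩

/-! ### The limited principle of omniscience -/

/-- `G` solves the instance `F` of the parallelization of `LPO`. -/
def IsLPO (T : Set Formula) [IsTheory T] (Γ : List Formula) (F G : FTerm 1) : Prop :=
  ∀ P : PrimeTheory T, P.Models Γ → ∀ i : P.Num,
    (P.ap G ![i] = 0 → ∀ t, P.ap F ![P.ap .pair ![i, t]] ≠ 0) ∧
    (P.ap G ![i] ≠ 0 → P.ap F ![P.ap .pair ![i, P.ap .pred ![P.ap G ![i]]]] = 0 ∧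
      ∀ t < P.ap .pred ![P.ap G ![i]], P.ap F ![P.ap .pair ![i, t]] ≠ 0)

/-- The matrix of `LPOhat`. -/
def LPOhatMatrix : Formula :=
  Formula.and
    (.imp (.eq (.fn 0 (.var 0)) .zero)
      (.allN (.lt .zero (.entry 1 (.var 1) (.var 0)))))
    (.imp (.lt .zero (.fn 0 (.var 0)))
      (.and
        (.eq (.entry 1 (.var 0) (.pred (.fn 0 (.var 0)))) .zero)
        (.allN (.imp (.lt (.var 0) (.pred (.fn 0 (.var 1))))
          (.lt .zero (.entry 1 (.var 1) (.var 0)))))))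

theorem LPOhatMatrix_subst (F G : FTerm 1) (i : Term) :
    (((LPOhatMatrix.subst (liftN fun x => (Term.var x).shiftF) (liftF (instτ F))).subst
      (liftN .var) (instτ G)).subst (instσ i) .var) =
    .and (.imp (.eq (.app G ![i]) .zero)
      (.allN (.lt .zero (.app F ![.app .pair ![i.shiftN, .var 0]]))))
    (.imp (.lt .zero (.app G ![i]))
      (.and (.eq (.app F ![.app .pair ![i, .pred (.app G ![i])]]) .zero)
        (.allN (.imp (.lt (.var 0) (.pred (.app G ![i.shiftN])))
          (.lt .zero (.app F ![.app .pair ![i.shiftN, .var 0]])))))) := by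
  simp [LPOhatMatrix, Formula.subst]

theorem IsLPO.deriv {F G : FTerm 1} (h : IsLPO T Γ F G) :
    Deriv T Γ ((Formula.exF (.allN LPOhatMatrix)).instF F) := by
  refine .exFI G (Deriv.allN_intro fun i => ?_)
  change Deriv T Γ (((LPOhatMatrix.subst (liftN fun x => (Term.var x).shiftF)
    (liftF (instτ F))).subst (liftN .var) (instτ G)).subst (instσ i) .var)
  rw [LPOhatMatrix_subst]
  refine .andI (.impI (.allN_intro fun t => Deriv.complete fun P hP => ?_))
    (.impI (.andI (Deriv.complete fun P hP => ?_)
      (.allN_intro fun t => Deriv.complete fun P hP => ?_)))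
  · have h₁ : P.Holds (.eq (.app G ![i]) .zero) := hP _ (by simp)
    have h₂ := (h P (hP.mono (by simp)) (P.ev i)).1
    simp only [PrimeTheory.holds_eq, PrimeTheory.ev_app_one, PrimeTheory.ev_zero] at h₁
    simpa [Formula.instN_def, pos_iff_ne_zero] using h₂ h₁ (P.ev t)
  · have h₁ : P.Holds (.lt .zero (.app G ![i])) := hP _ (by simp)
    have h₂ := (h P (hP.mono (by simp)) (P.ev i)).2
    simp only [PrimeTheory.holds_lt, PrimeTheory.ev_app_one, PrimeTheory.ev_zero] at h₁
    simpa [pos_iff_ne_zero] using (h₂ h₁.ne').1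
  · have h₁ : P.Holds (.lt .zero (.app G ![i])) := hP _ (by simp)
    have h₂ := (h P (hP.mono (by simp)) (P.ev i)).2
    simp only [PrimeTheory.holds_lt, PrimeTheory.ev_app_one, PrimeTheory.ev_zero] at h₁
    simpa [Formula.instN_def, Formula.subst, pos_iff_ne_zero] using (h₂ h₁.ne').2 (P.ev t)

theorem Deriv.lpo_elim {χ : Formula} (h : Deriv T Γ LPOhat) (F : FTerm 1)
    (h' : ∀ G Δ, Γ ⊆ Δ → IsLPO T Δ F G → Deriv T Δ χ) : Deriv T Γ χ := by
  refine (h.allFE F).exF_elim fun G Δ hΔ hG => h' G Δ hΔ fun P hP i => ?_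
  obtain ⟨i, rfl⟩ := P.exists_ev i
  have := P.holds_allN (hG.holds hP) i
  change P.Holds (((LPOhatMatrix.subst (liftN fun x => (Term.var x).shiftF)
    (liftF (instτ F))).subst (liftN .var) (instτ G)).subst (instσ i) .var) at this
  rw [LPOhatMatrix_subst, PrimeTheory.holds_and, PrimeTheory.holds_imp _ (by simp),
    PrimeTheory.holds_imp _ (by simp), PrimeTheory.holds_and] at this
  simp only [PrimeTheory.holds_eq, PrimeTheory.holds_lt, PrimeTheory.ev_app_one,
    PrimeTheory.ev_app_two, PrimeTheory.ev_pred, PrimeTheory.ev_zero, pos_iff_ne_zero] at this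
  refine ⟨fun h₀ t => ?_, fun h₀ => ⟨(this.2 h₀).1, fun t ht => ?_⟩⟩
  · obtain ⟨t, rfl⟩ := P.exists_ev t
    have := P.holds_allN (this.1 h₀) t
    simpa [Formula.instN_def, pos_iff_ne_zero] using this
  · obtain ⟨t, rfl⟩ := P.exists_ev t
    have := P.holds_allN (this.2 h₀).2 t
    simp [Formula.instN_def, Formula.subst, pos_iff_ne_zero] at this
    exact this ht

end SecondOrder

/-! ### Arithmetical comprehension and LPO -/

namespace SecondOrder

variable {T : Set Formula} [IsTheory T] {Γ : List Formula}

namespace PrimeTheory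

variable (P : PrimeTheory T)

/-! ### Quantifiers in prime theories -/

/-- All instances lying in `P` would not suffice: the generalization needs a derivation, hence all
prime theories over some finite part `Γ` of `P`. -/
theorem holds_allN_of (hP : P.Models Γ) {φ : Formula}
    (h : ∀ Q : PrimeTheory T, Q.Models Γ → ∀ t, Q.Holds (φ.instN t)) : P.Holds (.allN φ) :=
  (Deriv.allN_intro fun t => Deriv.complete fun Q hQ => h Q hQ t).holds hP

/-- `P` may contain an existential formula without any instance, so the witness is introduced in
other prime theories over `Γ`, and only the conclusion is brought back to `P`. -/
theorem holds_of_exN (hP : P.Models Γ) {φ χ : Formula} (hφ : P.Holds (.exN φ))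
    (h : ∀ Q : PrimeTheory T, Q.Models Γ → ∀ t, Q.Holds (φ.instN t) → Q.Holds χ) :
    P.Holds χ := by
  refine P.mp (φ := .exN φ) (Deriv.holds (Γ := Γ) (.impI ?_) hP) hφ
  refine (Deriv.hyp (φ := .exN φ) (by simp)).exN_elim fun t Δ hΔ ht => Deriv.complete fun Q hQ => ?_
  exact h Q (hQ.mono fun χ hχ => hΔ (by simp [hχ])) t (ht.holds hQ)

omit [IsTheory T] in
-- Two uses of the equality rule, one for each variable.
theorem holds_instσ₂_congr {φ : Formula} {s t s' t' : Term} (hs : P.ev s = P.ev s')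
    (ht : P.ev t = P.ev t') (h : P.Holds (φ.subst (instσ₂ s t) .var)) :
    P.Holds (φ.subst (instσ₂ s' t') .var) := by
  have h₁ : ∀ r, (φ.subst (instσ s.shiftN) .var).instN r = φ.subst (instσ₂ s r) .var := by
    intro r
    rw [Formula.instN_def, Formula.subst_subst]
    refine φ.subst_congr (fun x => ?_) (fun v => by simp)
    rcases x with _ | x <;> simp
  have h₂ : ∀ r, (φ.subst (fun x => Nat.casesOn x (.var 0)
      fun y => Nat.casesOn y t'.shiftN fun z => .var (z + 1)) .var).instN r =
      φ.subst (instσ₂ r t') .var := by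
    intro r
    rw [Formula.instN_def, Formula.subst_subst]
    refine φ.subst_congr (fun x => ?_) (fun v => by simp)
    rcases x with _ | _ | x <;> simp
  rw [← h₁] at h
  have h := P.holds_subst _ (P.holds_eq.2 ht) h
  rw [h₁, ← h₂] at h
  have h := P.holds_subst _ (P.holds_eq.2 hs) h
  rwa [h₂] at h

end PrimeTheory

/-- The equation `G(t) = 1` is decidable, and its negation persists to larger prime theories, where
it refutes `φ(t)`. -/
theorem IsCharFun.holds_or_neg {G : FTerm 1} {φ : Formula} (h : IsCharFun T Γ G φ)
    {P : PrimeTheory T} (hP : P.Models Γ) (t : Term) :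
    P.Holds (φ.instN t) ∨ P.Holds (φ.instN t).neg := by
  by_cases h₁ : P.ap G ![P.ev t] = 1
  · exact Or.inl ((h P hP t).2.1 h₁)
  · refine Or.inr (P.holds_imp_of fun Q hQ hφ => ?_)
    have h₂ : P.Holds (.neg (.eq (.app G ![t]) (.succ .zero))) := by simpa using h₁
    have h₃ := hQ _ h₂
    simp only [PrimeTheory.holds_neg, Formula.quantifierFree_eq, PrimeTheory.holds_eq,
      PrimeTheory.ev_app_one, PrimeTheory.ev_succ, PrimeTheory.ev_zero, zero_add] at h₃
    exact absurd ((h Q (hP.of_le hQ) t).2.2 hφ) h₃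

omit [IsTheory T] in
theorem IsCharFun.mono {Δ : List Formula} {G : FTerm 1} {φ : Formula} (h : IsCharFun T Γ G φ)
    (hΔ : Γ ⊆ Δ) : IsCharFun T Δ G φ := fun P hP => h P (hP.mono hΔ)

/-! ### Arithmetical comprehension from the limited principle of omniscience -/

/-- The atomic formula `G(x) = 1`. -/
def memFormula (G : FTerm 1) : Formula := .eq (.app G ![.var 0]) (.succ .zero)

theorem IsCharFun.holds_memFormula {G : FTerm 1} {φ : Formula} (h : IsCharFun T Γ G φ)
    {P : PrimeTheory T} (hP : P.Models Γ) (t : Term) :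
    P.Holds ((memFormula G).instN t) ↔ P.Holds (φ.instN t) := by
  rw [← (h P hP t).2]
  simp [memFormula, Formula.instN_def]

/-- The substitution of `t` and `s` for `1` and `0`, when variable `0` codes the pair of `t` and
`s`. -/
def unpairσ : ℕ → Term := fun x => Nat.casesOn x (.app .snd ![.var 0])
  fun y => Nat.casesOn y (.app .fst ![.var 0]) fun z => .var (z + 1)

theorem unpairσ_instN (ψ : Formula) (p : Term) : (ψ.subst unpairσ .var).instN p =
    ψ.subst (instσ₂ (.app .snd ![p]) (.app .fst ![p])) .var := by
  rw [Formula.instN_def, Formula.subst_subst]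
  refine ψ.subst_congr (fun x => ?_) (fun v => by simp)
  rcases x with _ | _ | x <;> simp [unpairσ]

/-- The projections of the code of a pair equal its components provably but not syntactically, hence
the appeal to `holds_instσ₂_congr`. -/
theorem IsCharFun.pair {G : FTerm 1} {ψ : Formula} (h : IsCharFun T Γ G (ψ.subst unpairσ .var))
    {P : PrimeTheory T} (hP : P.Models Γ) (t s : Term) :
    (P.ap G ![P.ap .pair ![P.ev t, P.ev s]] = 0 ∨ P.ap G ![P.ap .pair ![P.ev t, P.ev s]] = 1) ∧
    (P.ap G ![P.ap .pair ![P.ev t, P.ev s]] = 1 ↔ P.Holds (ψ.subst (instσ₂ s t) .var)) := by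
  have := h P hP (.app .pair ![t, s])
  rw [unpairσ_instN, PrimeTheory.ev_app_two] at this
  refine ⟨this.1, this.2.trans ⟨fun h => ?_, fun h => ?_⟩⟩
  · exact P.holds_instσ₂_congr (by simp) (by simp) h
  · exact P.holds_instσ₂_congr (by simp) (by simp) h

/-- Induction on `φ`; the substitution is general so that, at a quantifier, the induction hypothesis
is available for the matrix with both variables read off from a single code. -/
theorem Deriv.comprehension_of_lpo (h : Deriv T Γ LPOhat) {φ : Formula} (hφ : φ.Arithmetical)
    (σ : ℕ → Term) (τ : ℕ → FTerm 1) : Deriv T Γ (comprehensionAxiom (φ.subst σ τ)) := by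
  induction φ generalizing σ Γ with
  | bot => exact .comprehension_quantifierFree trivial
  | eq s t => exact .comprehension_quantifierFree trivial
  | and φ ψ ih₁ ih₂ =>
    refine (ih₁ h hφ.1 σ).comprehension_elim fun G Δ hΔ hG => ?_
    refine (ih₂ (h.mono hΔ) hφ.2 σ).comprehension_elim fun G' Δ' hΔ' hG' => ?_
    refine (Deriv.comprehension_quantifierFree (φ := .and (memFormula G) (memFormula G'))
      ⟨trivial, trivial⟩).comprehension_congr fun P hP t => ?_
    simpa [Formula.instN_def, Formula.subst] using and_congr
      ((hG.mono hΔ').holds_memFormula hP t) (hG'.holds_memFormula hP t)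
  | or φ ψ ih₁ ih₂ =>
    refine (ih₁ h hφ.1 σ).comprehension_elim fun G Δ hΔ hG => ?_
    refine (ih₂ (h.mono hΔ) hφ.2 σ).comprehension_elim fun G' Δ' hΔ' hG' => ?_
    refine (Deriv.comprehension_quantifierFree (φ := .or (memFormula G) (memFormula G'))
      ⟨trivial, trivial⟩).comprehension_congr fun P hP t => ?_
    simpa [Formula.instN_def, Formula.subst] using or_congr
      ((hG.mono hΔ').holds_memFormula hP t) (hG'.holds_memFormula hP t)
  | imp φ ψ ih₁ ih₂ =>
    refine (ih₁ h hφ.1 σ).comprehension_elim fun G Δ hΔ hG => ?_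
    refine (ih₂ (h.mono hΔ) hφ.2 σ).comprehension_elim fun G' Δ' hΔ' hG' => ?_
    refine (Deriv.comprehension_quantifierFree (φ := .imp (memFormula G) (memFormula G'))
      ⟨trivial, trivial⟩).comprehension_congr fun P hP t => ?_
    -- The characteristic function decides the antecedent, so the implication is truth-functional
    -- even if it contains quantifiers.
    have h₁ := P.holds_imp_iff (ψ := (ψ.subst σ τ).instN t) ((hG.mono hΔ').holds_or_neg hP t)
    have h₂ := P.holds_imp (φ := (memFormula G).instN t) (ψ := (memFormula G').instN t) trivial
    have h₃ := imp_congr ((hG.mono hΔ').holds_memFormula hP t) (hG'.holds_memFormula hP t)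
    exact h₂.trans (h₃.trans h₁.symm)
  | allN φ ih =>
    have hih : Deriv T Γ (comprehensionAxiom ((φ.subst (liftN σ) τ).subst unpairσ .var)) := by
      have := ih h hφ (fun x => (liftN σ x).subst unpairσ .var)
      rw [Formula.subst_subst]
      simpa using this
    generalize hψ : φ.subst (liftN σ) τ = ψ at hih
    refine hih.comprehension_elim fun G Δ hΔ hG => ?_
    -- The zeros of `G` are the counterexamples to the matrix, so the universal formula holds iff
    -- LPO answers `0`.
    refine (h.mono hΔ).lpo_elim G fun g Δ' hΔ' hg => ?_
    refine (Deriv.comprehension_quantifierFree (φ := .eq (.app g ![.var 0]) .zero)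
      trivial).comprehension_congr fun P hP t => ?_
    have hG := hG.mono hΔ'
    rw [show ((Formula.allN φ).subst σ τ).instN t = .allN (ψ.subst (liftN (instσ t)) .var) by
      rw [← hψ]; rfl]
    simp only [Formula.instN_def, Formula.eq_subst, Term.subst_app_one, Term.var_subst,
      instσ_zero, FTerm.subst_var, Term.subst_zero, PrimeTheory.holds_eq, PrimeTheory.ev_app_one,
      PrimeTheory.ev_zero]
    constructor
    · intro h₀
      -- The answer `g(t) = 0` is put into the context, since it has to be available in every prime
      -- theory considered.
      refine P.holds_allN_of (hP.cons (φ := .eq (.app g ![t]) .zero) (by simpa using h₀))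
        fun Q hQ x => ?_
      have h₁ : Q.Holds (.eq (.app g ![t]) .zero) := hQ _ (by simp)
      simp only [PrimeTheory.holds_eq, PrimeTheory.ev_app_one, PrimeTheory.ev_zero] at h₁
      have hQ := hQ.mono (Γ := Δ') (by simp)
      rw [Formula.subst_liftN_instN]
      exact (hG.pair hQ t x).2.1 ((hG.pair hQ t x).1.resolve_left ((hg Q hQ _).1 h₁ _))
    · intro hall
      by_contra h₀
      have h₁ := ((hg P hP _).2 h₀).1
      have h₂ := P.holds_allN hall (.pred (.app g ![t]))
      rw [Formula.subst_liftN_instN] at h₂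
      have h₃ := (hG.pair hP t (.pred (.app g ![t]))).2.2 h₂
      rw [PrimeTheory.ev_pred, PrimeTheory.ev_app_one, h₁] at h₃
      exact zero_ne_one h₃
  | exN φ ih =>
    have hih : Deriv T Γ (comprehensionAxiom ((φ.subst (liftN σ) τ).subst unpairσ .var)) := by
      have := ih h hφ (fun x => (liftN σ x).subst unpairσ .var)
      rw [Formula.subst_subst]
      simpa using this
    generalize hψ : φ.subst (liftN σ) τ = ψ at hih
    refine hih.comprehension_elim fun G Δ hΔ hG => ?_
    -- Composing with `isZero` turns the witnesses, where `G` is `1`, into zeros.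
    refine (h.mono hΔ).lpo_elim (.comp .isZero ![G]) fun g Δ' hΔ' hg => ?_
    refine (Deriv.comprehension_quantifierFree (φ := .neg (.eq (.app g ![.var 0]) .zero))
      (by simp)).comprehension_congr fun P hP t => ?_
    have hG := hG.mono hΔ'
    have hiff : ∀ (Q : PrimeTheory T) (hQ : Q.Models Δ') (x : Term),
        Q.ap (.comp .isZero ![G]) ![Q.ap .pair ![Q.ev t, Q.ev x]] = 0 ↔
          Q.Holds (ψ.subst (instσ₂ x t) .var) := by
      intro Q hQ x
      rw [← (hG.pair hQ t x).2, PrimeTheory.ap_comp_one]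
      rcases (hG.pair hQ t x).1 with h₁ | h₁ <;> simp [h₁, Q.ap_isZero_of_ne]
    rw [show ((Formula.exN φ).subst σ τ).instN t = .exN (ψ.subst (liftN (instσ t)) .var) by
      rw [← hψ]; rfl]
    simp only [Formula.instN_def, Formula.neg_subst, Formula.eq_subst, Term.subst_app_one,
      Term.var_subst, instσ_zero, FTerm.subst_var, Term.subst_zero, PrimeTheory.holds_neg,
      Formula.quantifierFree_eq, PrimeTheory.holds_eq, PrimeTheory.ev_app_one,
      PrimeTheory.ev_zero]
    constructor
    · intro h₀
      have h₁ := ((hg P hP _).2 h₀).1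
      refine P.holds_exN (t := .pred (.app g ![t])) ?_
      rw [Formula.subst_liftN_instN]
      exact (hiff P hP _).1 (by simpa using h₁)
    · intro hex h₀
      refine P.not_bot (P.holds_of_exN (hP.cons (φ := .eq (.app g ![t]) .zero) (by simpa using h₀))
        hex fun Q hQ x hx => ?_)
      have h₁ : Q.Holds (.eq (.app g ![t]) .zero) := hQ _ (by simp)
      simp only [PrimeTheory.holds_eq, PrimeTheory.ev_app_one, PrimeTheory.ev_zero] at h₁
      have hQ := hQ.mono (Γ := Δ') (by simp)
      rw [Formula.subst_liftN_instN] at hx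
      exact absurd ((hiff Q hQ x).2 hx) ((hg Q hQ _).1 h₁ _)
  | _ => exact hφ.elim

/-! ### The limited principle of omniscience from bounds for the search -/

/-- `(x, i) ↦ F(⟨i, x⟩)`. -/
def FTerm.swapEntry (F : FTerm 1) : FTerm 2 := .comp F ![.comp .pair ![.proj 1, .proj 0]]

@[simp] theorem PrimeTheory.ap_swapEntry (P : PrimeTheory T) (F : FTerm 1) (x i : P.Num) :
    P.ap F.swapEntry ![x, i] = P.ap F ![P.ap .pair ![i, x]] := by
  simp [FTerm.swapEntry]

/-- A bound `b(i)` for some zero of `f_i`, if there is one, gives the least zeros. -/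
theorem isLPO_of_bound {F b : FTerm 1} (h : ∀ P : PrimeTheory T, P.Models Γ → ∀ i n : P.Num,
    P.ap F ![P.ap .pair ![i, n]] = 0 → P.ap (.search F.swapEntry) ![P.ap b ![i] + 1, i] ≠ 0) :
    IsLPO T Γ F (.comp (.search F.swapEntry) ![.comp .succ ![b], .proj 0]) := by
  intro P hP i
  have hval : P.ap (.comp (.search F.swapEntry) ![.comp .succ ![b], .proj 0]) ![i] =
      P.ap (.search F.swapEntry) ![P.ap b ![i] + 1, i] := by simp
  rw [hval]
  -- The search and LPO share one convention: position plus one, and `0` for failure.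
  refine ⟨fun h₀ t ht => h P hP i t ht h₀, fun h₀ => ⟨?_, fun t ht => ?_⟩⟩
  · simpa using (P.search_spec F.swapEntry _ ![i] h₀).2
  · have := P.search_least F.swapEntry (m := P.ap b ![i] + 1) (x := t) (xs := ![i]) (by
      obtain ⟨y, hy⟩ := (P.eq_zero_or_exists_add_one _).resolve_left h₀
      rw [hy, PrimeTheory.ap_pred_succ] at ht
      rw [hy]
      simpa using ht)
    simpa using this

/-- Comprehension decides which `f_i` have a zero; choice then yields some zero for each of those
`i`, and `isLPO_of_bound` passes to the least one. -/
theorem Deriv.lpo_of_comprehension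
    (h : ∀ φ : Formula, φ.Arithmetical → Deriv T Γ (comprehensionAxiom φ)) : Deriv T Γ LPOhat := by
  refine Deriv.allF_intro fun F => ?_
  change Deriv T Γ ((Formula.exF (.allN LPOhatMatrix)).instF F)
  refine (h (.exN (.eq (.app F ![.app .pair ![.var 1, .var 0]]) .zero))
    trivial).comprehension_elim fun H Δ hΔ hH => ?_
  have hinst : ∀ t, (Formula.exN (.eq (.app F ![.app .pair ![.var 1, .var 0]]) .zero)).instN t =
      .exN (.eq (.app F ![.app .pair ![t.shiftN, .var 0]]) .zero) := by
    intro t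
    simp [Formula.instN_def, Formula.subst]
  have hθ : ∀ s t, (Formula.imp (.eq (.app H ![.var 1]) (.succ .zero))
      (.eq (.app F ![.app .pair ![.var 1, .var 0]]) .zero)).subst (instσ₂ s t) .var =
      .imp (.eq (.app H ![t]) (.succ .zero)) (.eq (.app F ![.app .pair ![t, s]]) .zero) := by
    intro s t
    simp [Formula.subst]
  refine Deriv.choice (φ := .imp (.eq (.app H ![.var 1]) (.succ .zero))
    (.eq (.app F ![.app .pair ![.var 1, .var 0]]) .zero)) ⟨trivial, trivial⟩
    (fun P hP t => ?_) fun b Δ' hΔ' hb => (isLPO_of_bound (b := b) fun P hP i n hn => ?_).deriv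
  · by_cases h₁ : P.ap H ![P.ev t] = 1
    · have h₂ := (hH P hP t).2.1 h₁
      rw [hinst] at h₂
      refine P.holds_of_exN hP h₂ fun Q hQ s hs => Q.holds_exN_instN (s := s) ?_
      rw [hθ, PrimeTheory.holds_imp _ (Formula.quantifierFree_eq _ _)]
      intro _
      simpa [Formula.instN_def] using hs
    -- If `f_i` has no zero the matrix is vacuous and any value serves.
    · refine P.holds_exN_instN (s := .zero) ?_
      rw [hθ, PrimeTheory.holds_imp _ (Formula.quantifierFree_eq _ _)]
      intro h₂
      exact absurd (by simpa using h₂) h₁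
  · obtain ⟨i, rfl⟩ := P.exists_ev i
    obtain ⟨n, rfl⟩ := P.exists_ev n
    have h₁ := (hH P (hP.mono hΔ') i).2.2 (by
      rw [hinst]
      refine P.holds_exN (t := n) ?_
      simpa [Formula.instN_def] using hn)
    have h₂ := hb P hP i
    rw [hθ, PrimeTheory.holds_imp _ (Formula.quantifierFree_eq _ _)] at h₂
    simp only [PrimeTheory.holds_eq, PrimeTheory.ev_app_one, PrimeTheory.ev_app_two,
      PrimeTheory.ev_succ, PrimeTheory.ev_zero, zero_add] at h₂
    exact P.search_ne_zero F.swapEntry (lt_add_one _) (by simpa using h₂ h₁)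

end SecondOrder

/-! ### Local colorings and the final equivalences -/

namespace SecondOrder

variable {T : Set Formula} [IsTheory T] {Γ : List Formula}

/-! ### The pigeonhole principle -/

namespace FTerm

/-- `(x, w, n, k, s) ↦ |digit(k, s, n + x) - w|`. -/
def digitDist : FTerm 5 :=
  .comp .add ![
    .comp .sub ![.comp .digit ![.proj 3, .proj 4, .comp .add ![.proj 2, .proj 0]], .proj 1],
    .comp .sub ![.proj 1, .comp .digit ![.proj 3, .proj 4, .comp .add ![.proj 2, .proj 0]]]]

/-- `(m, w, n, k, s) ↦ #{x < m | digit(k, s, n + x) < w}`. -/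
def count : FTerm 5 :=
  .prec (.comp .zero ![]) (.comp .add ![.proj 1, .comp .isZero ![.comp .sub
    ![.comp .succ ![.comp .digit ![.proj 4, .proj 5, .comp .add ![.proj 3, .proj 0]]], .proj 2]]])

end FTerm

namespace PrimeTheory

variable (P : PrimeTheory T)

theorem ap_isZero_one : P.ap .isZero ![1] = 0 := P.ap_isZero_of_ne one_ne_zero

theorem ap_digitDist_eq_zero (x w n k s : P.Num) :
    P.ap .digitDist ![x, w, n, k, s] = 0 ↔ P.ap .digit ![k, s, n + x] = w := by
  simp only [FTerm.digitDist, ap_comp_two, ap_comp_three, ap_proj]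
  simp only [Matrix.cons_val, ap_add, ap_sub, add_eq_zero, tsub_eq_zero_iff_le]
  exact le_antisymm_iff.symm

theorem ap_count_zero (w n k s : P.Num) : P.ap .count ![0, w, n, k, s] = 0 := by
  rw [FTerm.count, ap_prec_zero]; simp

theorem ap_count_succ (m w n k s : P.Num) : P.ap .count ![m + 1, w, n, k, s] =
    P.ap .count ![m, w, n, k, s] + if P.ap .digit ![k, s, n + m] < w then 1 else 0 := by
  conv_lhs => rw [FTerm.count, ap_prec_succ, ← FTerm.count]
  simp only [ap_comp_one, ap_comp_two, ap_comp_three, ap_proj]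
  simp only [Matrix.cons_val, ap_add, ap_sub, ap_succ]
  split_ifs with h
  · rw [tsub_eq_zero_iff_le.2 (P.lt_iff_add_one_le.1 h), ap_isZero_zero]
  · rw [ap_isZero_of_ne]
    rwa [ne_eq, tsub_eq_zero_iff_le, ← P.lt_iff_add_one_le]

theorem count_le (m n k s : P.Num) (hk : 0 < k) : P.ap .count ![m, k, n, k, s] = m := by
  obtain ⟨m, rfl⟩ := P.exists_ev m
  obtain ⟨n, rfl⟩ := P.exists_ev n
  obtain ⟨k, rfl⟩ := P.exists_ev k
  obtain ⟨s, rfl⟩ := P.exists_ev s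
  have := P.induction_nil (fun m => .imp (.lt .zero k) (.eq (.app .count ![m, k, n, k, s]) m))
    (fun P => by simp [ap_count_zero]) (fun P m ih => by
      simp only [holds_imp, holds_eq, holds_lt, Formula.quantifierFree_lt, ev_app_five, ev_succ,
        ev_zero] at ih ⊢
      intro hk
      rw [ap_count_succ, if_pos (P.ap_digit_lt hk _ _), ih hk]) m
  simp only [holds_imp, holds_eq, holds_lt, Formula.quantifierFree_lt, ev_app_five, ev_zero] at this
  exact this hk

theorem count_zero (m n k s : P.Num) : P.ap .count ![m, 0, n, k, s] = 0 := by
  obtain ⟨m, rfl⟩ := P.exists_ev m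
  obtain ⟨n, rfl⟩ := P.exists_ev n
  obtain ⟨k, rfl⟩ := P.exists_ev k
  obtain ⟨s, rfl⟩ := P.exists_ev s
  simpa using P.induction_nil (fun m => .eq (.app .count ![m, .zero, n, k, s]) .zero)
    (fun P => by simp [ap_count_zero]) (fun P m ih => by
      simp only [holds_eq, ev_app_five, ev_succ, ev_zero] at ih ⊢
      rw [ap_count_succ, ih]
      simp) m

end PrimeTheory

variable {k s n : Term}

/-- An injective coloring uses each color at most once. -/
theorem PrimeTheory.count_succ_of_injective
    (hinj : ∀ P : PrimeTheory T, P.Models Γ → ∀ x y : P.Num, x < y → y ≤ P.ev k →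
      P.ap .digit ![P.ev k, P.ev s, P.ev n + x] ≠ P.ap .digit ![P.ev k, P.ev s, P.ev n + y])
    (P : PrimeTheory T) (hP : P.Models Γ) {m : P.Num} (w : P.Num) (hm : m ≤ P.ev k + 1) :
    P.ap .count ![m, w + 1, P.ev n, P.ev k, P.ev s] = P.ap .count ![m, w, P.ev n, P.ev k, P.ev s] +
      P.ap .isZero ![P.ap .isZero
        ![P.ap (.search .digitDist) ![m, w, P.ev n, P.ev k, P.ev s]]] := by
  obtain ⟨m, rfl⟩ := P.exists_ev m
  obtain ⟨w, rfl⟩ := P.exists_ev w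
  have := P.induction (Γ := Γ) (fun m => .imp (.lt m k.succ.succ)
    (.eq (.app .count ![m, w.succ, n, k, s]) (.app .add ![.app .count ![m, w, n, k, s],
      .app .isZero ![.app .isZero ![.app (.search .digitDist) ![m, w, n, k, s]]]])))
    (fun P hP => by simp [ap_count_zero, ap_search_zero, ap_isZero_one]) (fun P hP m ih => by
      simp only [holds_imp, holds_eq, holds_lt, Formula.quantifierFree_lt, ev_app_one, ev_app_two,
        ev_app_five, ev_succ, ap_add] at ih ⊢
      intro hm
      have hm' : P.ev m ≤ P.ev k := by
        rw [← P.lt_add_one_iff']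
        exact lt_of_add_lt_add_right hm
      rw [ap_count_succ, ap_count_succ, ih ((lt_add_one _).trans hm)]
      -- Color `w` occurs before vertex `n + m`, or first there, or not yet. The doubled `isZero` is
      -- the indicator of its occurrence; in the first case injectivity keeps `w` away from the new
      -- vertex.
      rcases P.ap_search_cases .digitDist (P.ev m) ![P.ev w, P.ev n, P.ev k, P.ev s] with h | h | h
      · have hne : P.ap .digit ![P.ev k, P.ev s, P.ev n + P.ev m] ≠ P.ev w := by
          intro heq
          have h₁ := P.search_spec .digitDist _ _ h.1
          rw [ap_digitDist_eq_zero] at h₁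
          exact hinj P hP _ _ h₁.1 hm' (h₁.2.trans heq.symm)
        have hiff : P.ap .digit ![P.ev k, P.ev s, P.ev n + P.ev m] < P.ev w + 1 ↔
            P.ap .digit ![P.ev k, P.ev s, P.ev n + P.ev m] < P.ev w := by
          rw [P.lt_add_one_iff']
          exact ⟨fun h => h.lt_of_ne hne, le_of_lt⟩
        rw [h.2]
        simp only [hiff]
        ring
      · rw [ap_digitDist_eq_zero] at h
        rw [h.1, h.2.2, h.2.1, if_pos (lt_add_one _), if_neg (lt_irrefl _)]
        simp [ap_isZero_one]
      · have hne := h.2.1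
        rw [ne_eq, ap_digitDist_eq_zero] at hne
        have hiff : P.ap .digit ![P.ev k, P.ev s, P.ev n + P.ev m] < P.ev w + 1 ↔
            P.ap .digit ![P.ev k, P.ev s, P.ev n + P.ev m] < P.ev w := by
          rw [P.lt_add_one_iff']
          exact ⟨fun h => h.lt_of_ne hne, le_of_lt⟩
        rw [h.2.2, h.1]
        simp only [hiff]
        ring) hP m
  simp only [holds_imp, holds_eq, holds_lt, Formula.quantifierFree_lt, ev_app_one, ev_app_two,
    ev_app_five, ev_succ, ap_add] at this
  exact this (P.lt_add_one_iff'.2 hm)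

theorem PrimeTheory.ap_isZero_le_one (P : PrimeTheory T) (x : P.Num) :
    P.ap .isZero ![x] ≤ 1 := by
  by_cases h : x = 0
  · simp [h]
  · simp [P.ap_isZero_of_ne h]

/-- There is no injective coloring of `k + 1` vertices with `k` colors. -/
theorem PrimeTheory.pigeonhole
    (hinj : ∀ P : PrimeTheory T, P.Models Γ → ∀ x y : P.Num, x < y → y ≤ P.ev k →
      P.ap .digit ![P.ev k, P.ev s, P.ev n + x] ≠ P.ap .digit ![P.ev k, P.ev s, P.ev n + y])
    (P : PrimeTheory T) (hP : P.Models Γ) (hk : 0 < P.ev k) : False := by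
  -- Each further color adds at most one vertex, so at most `w` of the `k + 1` vertices have a color
  -- below `w`. For `w = k` this contradicts `count_le`, by which all `k + 1` are counted.
  have := P.induction (Γ := Γ) (fun w => .lt (.app .count ![k.succ, w, n, k, s]) w.succ)
    (fun P hP => by simp [count_zero]) (fun P hP w ih => by
      simp only [holds_lt, ev_app_five, ev_succ, P.lt_add_one_iff'] at ih ⊢
      rw [PrimeTheory.count_succ_of_injective hinj P hP _ le_rfl]
      exact add_le_add ih (P.ap_isZero_le_one _)) hP k
  simp only [holds_lt, ev_app_five, ev_succ, P.lt_add_one_iff', P.count_le _ _ _ _ hk] at this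
  exact absurd (lt_add_one (P.ev k)) this.not_gt

/-! ### Colorability -/

theorem Term.shiftN_subst_liftN (t : Term) (σ : ℕ → Term) (τ : ℕ → FTerm 1) :
    t.shiftN.subst (liftN σ) τ = (t.subst σ τ).shiftN := by
  rw [Term.shiftN_subst]
  simp [Term.shiftN, Term.subst_subst]

/-- The matrix of the formula `colorFormula`. -/
def colorMatrix (E : FTerm 1) (k i m : Term) : Formula :=
  .and
    (.lt (.var 0) (.app .pow ![k.shiftN, .succ m.shiftN]))
    (.allN (.imp (.lt (.var 0) (.succ m.shiftN.shiftN))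
      (.allN (.imp (.lt (.var 0) (.var 1))
        (.imp
          (.neg (.eq (.app E ![.app .pair ![i.shiftN.shiftN.shiftN,
            .app .edgeCode ![.var 0, .var 1]]]) .zero))
          (.neg (.eq (.app .digit ![k.shiftN.shiftN.shiftN, .var 2, .var 0])
            (.app .digit ![k.shiftN.shiftN.shiftN, .var 2, .var 1]))))))))

/-- `colorable`, for the sequence of graphs coded by a functional `E`. -/
def colorFormula (E : FTerm 1) (k i m : Term) : Formula := .exN (colorMatrix E k i m)

theorem colorable_subst (k i m : Term) (v : ℕ) (σ : ℕ → Term) (τ : ℕ → FTerm 1) :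
    (colorable k v i m).subst σ τ =
      colorFormula (τ v) (k.subst σ τ) (i.subst σ τ) (m.subst σ τ) := by
  simp [colorable, colorFormula, colorMatrix, Formula.subst, Term.shiftN_subst_liftN,
    Formula.neg_subst]

theorem colorFormula_subst (E : FTerm 1) (k i m : Term) (σ : ℕ → Term) (τ : ℕ → FTerm 1) :
    (colorFormula E k i m).subst σ τ =
      colorFormula (E.subst τ) (k.subst σ τ) (i.subst σ τ) (m.subst σ τ) := by
  simp [colorFormula, colorMatrix, Formula.subst, Term.shiftN_subst_liftN, Formula.neg_subst]

omit [IsTheory T] in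
-- Needed to exchange `i` and `m` for the projections of their code.
theorem PrimeTheory.holds_colorFormula_congr (P : PrimeTheory T) {E : FTerm 1} {k i i' m m' : Term}
    (hi : P.ev i = P.ev i') (hm : P.ev m = P.ev m') (h : P.Holds (colorFormula E k i m)) :
    P.Holds (colorFormula E k i' m') := by
  have key : ∀ i m, (colorFormula E k.shiftN.shiftN (.var 1) (.var 0)).subst (instσ₂ m i) .var =
      colorFormula E k i m := by
    intro i m
    have : k.shiftN.shiftN.subst (instσ₂ m i) .var = k := by
      rw [Term.shiftN_subst, Term.shiftN_subst]
      exact Term.subst_var k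
    simp [colorFormula_subst, this]
  rw [← key] at h ⊢
  exact P.holds_instσ₂_congr hm hi h

/-- The statement that the colors of the vertices below `b` that are adjacent to `b` are different
from the color of `b`. -/
def colorStep (E : FTerm 1) (k i s b : Term) : Formula :=
  .imp (.lt (.var 0) b.shiftN)
    (.imp
      (.neg (.eq (.app E ![.app .pair ![i.shiftN, .app .edgeCode ![.var 0, b.shiftN]]]) .zero))
      (.neg (.eq (.app .digit ![k.shiftN, s.shiftN, .var 0])
        (.app .digit ![k.shiftN, s.shiftN, b.shiftN]))))

theorem colorMatrix_instN (E : FTerm 1) (k i m s : Term) :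
    (colorMatrix E k i m).instN s = .and (.lt s (.app .pow ![k, .succ m]))
      (.allN (.imp (.lt (.var 0) (.succ m.shiftN))
        (.allN (colorStep E k.shiftN i.shiftN s.shiftN (.var 0))))) := by
  simp [colorMatrix, colorStep, Formula.instN_def, Formula.subst, Term.shiftN_subst_liftN,
    Formula.neg_subst]

theorem colorStep_subst (E : FTerm 1) (k i m s b : Term) :
    (Formula.imp (.lt (.var 0) (.succ m.shiftN))
        (.allN (colorStep E k.shiftN i.shiftN s.shiftN (.var 0)))).instN b =
      .imp (.lt b (.succ m)) (.allN (colorStep E k i s b)) := by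
  simp [colorStep, Formula.instN_def, Formula.subst, Term.shiftN_subst_liftN,
    Formula.neg_subst]

theorem PrimeTheory.holds_colorStep (P : PrimeTheory T) (E : FTerm 1) (k i s b a : Term) :
    P.Holds ((colorStep E k i s b).instN a) ↔ (P.ev a < P.ev b →
      P.ap E ![P.ap .pair ![P.ev i, P.ap .edgeCode ![P.ev a, P.ev b]]] ≠ 0 →
      P.ap .digit ![P.ev k, P.ev s, P.ev a] ≠ P.ap .digit ![P.ev k, P.ev s, P.ev b]) := by
  simp [colorStep, Formula.instN_def, Formula.subst, Formula.neg_subst]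

/-- The colors of adjacent vertices are different. -/
theorem PrimeTheory.holds_colorMatrix (P : PrimeTheory T) {E : FTerm 1} {k i m s : Term}
    (h : P.Holds ((colorMatrix E k i m).instN s)) {a b : P.Num} (hb : b ≤ P.ev m) (hab : a < b)
    (hE : P.ap E ![P.ap .pair ![P.ev i, P.ap .edgeCode ![a, b]]] ≠ 0) :
    P.ap .digit ![P.ev k, P.ev s, a] ≠ P.ap .digit ![P.ev k, P.ev s, b] := by
  obtain ⟨a, rfl⟩ := P.exists_ev a
  obtain ⟨b, rfl⟩ := P.exists_ev b
  rw [colorMatrix_instN, PrimeTheory.holds_and] at h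
  have h₁ := P.holds_allN h.2 b
  rw [colorStep_subst, PrimeTheory.holds_imp _ (Formula.quantifierFree_lt _ _)] at h₁
  exact (P.holds_colorStep _ _ _ _ _ _).1
    (P.holds_allN (h₁ (by simpa [P.lt_add_one_iff'] using hb)) a) hab hE

/-- Every graph without edges on `{0, …, m}` has a constant coloring. -/
theorem PrimeTheory.holds_colorFormula_of_no_edge {E : FTerm 1} {k i m : Term}
    (hE : ∀ P : PrimeTheory T, P.Models Γ → ∀ a b : P.Num, b ≤ P.ev m → a < b →
      P.ap E ![P.ap .pair ![P.ev i, P.ap .edgeCode ![a, b]]] = 0)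
    (P : PrimeTheory T) (hP : P.Models Γ) (hk : 0 < P.ev k) : P.Holds (colorFormula E k i m) := by
  -- Without edges every code is a coloring; positivity of `k` serves only to have `0 < k ^ (m +
  -- 1)`.
  refine P.holds_exN (t := .zero) ?_
  rw [colorMatrix_instN, PrimeTheory.holds_and]
  refine ⟨by simpa using P.ap_pow_pos hk _, P.holds_allN_of hP fun Q hQ b => ?_⟩
  rw [colorStep_subst, PrimeTheory.holds_imp _ (Formula.quantifierFree_lt _ _)]
  intro hb
  refine Q.holds_allN_of (hQ.cons hb) fun R hR a => (R.holds_colorStep _ _ _ _ _ _).2 ?_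
  have hb : R.Holds _ := hR _ List.mem_cons_self
  rw [PrimeTheory.holds_lt, PrimeTheory.ev_succ, R.lt_add_one_iff'] at hb
  intro hab h
  exact absurd (hE R (hR.mono (by simp)) _ _ hb hab) h

/-! ### The parallelized coloring problem -/

/-- `G` solves the instance `E` of the parallelized local `k`-coloring problem. -/
def IsLG (T : Set Formula) [IsTheory T] (Γ : List Formula) (k : Term) (E G : FTerm 1) : Prop :=
  ∀ P : PrimeTheory T, P.Models Γ → ∀ i : Term,
    (P.ap G ![P.ev i] = 0 → ∀ m, P.Holds (colorFormula E k i m)) ∧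
    (P.ap G ![P.ev i] ≠ 0 → ¬ P.Holds (colorFormula E k i (.app G ![i])) ∧
      ∀ m, P.ev m < P.ap G ![P.ev i] → P.Holds (colorFormula E k i m))

/-- The matrix of `LGhatAt`. -/
def LGhatMatrix : Formula :=
  .and
    (.imp (.eq (.fn 0 (.var 0)) .zero)
      (.allN (colorable (.var 2) 1 (.var 1) (.var 0))))
    (.imp (.lt .zero (.fn 0 (.var 0)))
      (.and
        (.neg (colorable (.var 1) 1 (.var 0) (.fn 0 (.var 0))))
        (.allN (.imp (.lt (.var 0) (.fn 0 (.var 1)))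
          (colorable (.var 2) 1 (.var 1) (.var 0))))))

/-- The instance of `LGhatAt` for `k` colors and the sequence of graphs `E`. -/
def LGhatInstance (k : Term) (E : FTerm 1) : Formula :=
  (Formula.exF (.allN (LGhatMatrix.subst (liftN fun x => (instσ k x).shiftF.shiftF)
    (liftF (liftF .var))))).instF E

theorem Term.shiftN_subst_var (t : Term) (τ : ℕ → FTerm 1) :
    t.shiftN.subst .var τ = (t.subst .var τ).shiftN := by
  rw [← Term.shiftN_subst_liftN, liftN_var]

theorem Term.shiftF_subst_var_liftF (t : Term) (τ : ℕ → FTerm 1) :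
    t.shiftF.subst .var (liftF τ) = (t.subst .var τ).shiftF :=
  Term.shiftF_subst_liftF t .var τ

theorem LGhatMatrix_subst (k i : Term) (E G : FTerm 1) :
    ((((LGhatMatrix.subst (liftN fun x => (instσ k x).shiftF.shiftF)
      (liftF (liftF .var))).subst (liftN fun x => (Term.var x).shiftF) (liftF (instτ E))).subst
      (liftN .var) (instτ G)).subst (instσ i) .var) =
    .and (.imp (.eq (.app G ![i]) .zero)
      (.allN (colorFormula E k.shiftN i.shiftN (.var 0))))
    (.imp (.lt .zero (.app G ![i]))
      (.and
        (.neg (colorFormula E k i (.app G ![i])))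
        (.allN (.imp (.lt (.var 0) (.app G ![i.shiftN]))
          (colorFormula E k.shiftN i.shiftN (.var 0)))))) := by
  simp [LGhatMatrix, Formula.subst, colorable_subst, colorFormula_subst, Formula.neg_subst,
    Term.shiftN_subst_var, Term.shiftF_subst_var_liftF, Term.shiftN_subst_liftN]

theorem IsLG.deriv {k : Term} {E G : FTerm 1} (h : IsLG T Γ k E G) :
    Deriv T Γ (LGhatInstance k E) := by
  refine .exFI G (Deriv.allN_intro fun i => ?_)
  change Deriv T Γ (((LGhatMatrix.subst (liftN fun x => (instσ k x).shiftF.shiftF)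
    (liftF (liftF .var))).subst (liftN fun x => (Term.var x).shiftF) (liftF (instτ E))).subst
    (liftN .var) (instτ G) |>.subst (instσ i) .var)
  rw [LGhatMatrix_subst]
  refine .andI (.impI (.allN_intro fun t => Deriv.complete fun P hP => ?_))
    (.impI (.andI (.impI (Deriv.complete fun P hP => ?_))
      (.allN_intro fun t => ?_)))
  · have h₁ : P.Holds (.eq (.app G ![i]) .zero) := hP _ (by simp)
    have h₂ := (h P (hP.mono (by simp)) i).1
    simp only [PrimeTheory.holds_eq, PrimeTheory.ev_app_one, PrimeTheory.ev_zero] at h₁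
    simpa [Formula.instN_def, colorFormula_subst] using h₂ h₁ t
  · have h₁ : P.Holds (.lt .zero (.app G ![i])) := hP _ (by simp)
    have h₂ := (h P (hP.mono fun _ hφ => by simp [hφ]) i).2
    simp only [PrimeTheory.holds_lt, PrimeTheory.ev_app_one, PrimeTheory.ev_zero] at h₁
    exact absurd (hP _ (by simp)) (h₂ h₁.ne').1
  · rw [Formula.instN_def, Formula.subst]
    refine .impI (Deriv.complete fun P hP => ?_)
    have h₁ : P.Holds (.lt .zero (.app G ![i])) := hP _ (by simp)
    have h₂ := (h P (hP.mono fun _ hφ => by simp [hφ]) i).2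
    simp only [PrimeTheory.holds_lt, PrimeTheory.ev_app_one, PrimeTheory.ev_zero] at h₁
    have h₃ := (h₂ h₁.ne').2 t
    have h₄ := hP _ List.mem_cons_self
    simp only [Formula.lt_subst, Term.subst_app_one, Term.shiftN_instσ, Term.subst_var,
      Term.var_subst, instσ_zero, FTerm.subst_var, PrimeTheory.holds_lt,
      PrimeTheory.ev_app_one] at h₄
    simpa [colorFormula_subst] using h₃ h₄

theorem Deriv.lg_elim {k : Term} {χ : Formula} (h : Deriv T Γ (LGhatAt.instN k)) (E : FTerm 1)
    (h' : ∀ G Δ, Γ ⊆ Δ → IsLG T Δ k E G → Deriv T Δ χ) : Deriv T Γ χ := by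
  refine (h.allFE E).exF_elim fun G Δ hΔ hG => h' G Δ hΔ fun P hP i => ?_
  have := P.holds_allN (hG.holds hP) i
  change P.Holds (((LGhatMatrix.subst (liftN fun x => (instσ k x).shiftF.shiftF)
    (liftF (liftF .var))).subst (liftN fun x => (Term.var x).shiftF) (liftF (instτ E))).subst
    (liftN .var) (instτ G) |>.subst (instσ i) .var) at this
  rw [LGhatMatrix_subst, PrimeTheory.holds_and, PrimeTheory.holds_imp _ (by simp),
    PrimeTheory.holds_imp _ (by simp), PrimeTheory.holds_and] at this
  simp only [PrimeTheory.holds_eq, PrimeTheory.holds_lt, PrimeTheory.ev_app_one,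
    PrimeTheory.ev_zero, pos_iff_ne_zero] at this
  refine ⟨fun h₀ m => ?_, fun h₀ => ⟨fun hc => P.not_bot (P.mp (this.2 h₀).1 hc), fun m hm => ?_⟩⟩
  · simpa [Formula.instN_def, colorFormula_subst] using P.holds_allN (this.1 h₀) m
  · have h₁ := P.holds_allN (this.2 h₀).2 m
    rw [Formula.instN_def, Formula.subst] at h₁
    have h₁ := P.mp h₁ (by simpa using hm)
    simpa [colorFormula_subst] using h₁

theorem colorFormula_arithmetical (E : FTerm 1) (k i m : Term) :
    (colorFormula E k i m).Arithmetical := by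
  simp [colorFormula, colorMatrix, Formula.Arithmetical, Formula.lt, Formula.neg]

/-- LPO already yields arithmetical comprehension, hence a characteristic function `c` of
colorability; its first zero is the first `m` for which `G_m` is not colorable. -/
theorem Deriv.lg_of_lpo (h : Deriv T Γ LPOhat) {k : Term} (hk : Deriv T Γ (.lt .zero k)) :
    Deriv T Γ (LGhatAt.instN k) := by
  refine Deriv.allF_intro fun E => ?_
  change Deriv T Γ (LGhatInstance k E)
  have hca := h.comprehension_of_lpo (colorFormula_arithmetical E k.shiftN (.app .fst ![.var 0])
    (.app .snd ![.var 0])) .var .var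
  rw [Formula.subst_var] at hca
  refine hca.comprehension_elim fun c Δ hΔ hc => ?_
  refine (h.mono hΔ).lpo_elim c fun g Δ' hΔ' hg => ?_
  -- LPO reports the first bad `m` as `m + 1`, local coloring as `m` itself. The values `0` and `1`
  -- of `g` are thus merged, harmlessly, as `G_0` is colorable.
  refine (IsLG.deriv (G := .comp .pred ![g]) fun P hP i => ?_)
  have hc : ∀ m, (P.ap c ![P.ap .pair ![P.ev i, P.ev m]] = 0 ∨
      P.ap c ![P.ap .pair ![P.ev i, P.ev m]] = 1) ∧
      (P.ap c ![P.ap .pair ![P.ev i, P.ev m]] = 1 ↔ P.Holds (colorFormula E k i m)) := by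
    intro m
    have h₁ := hc P (hP.mono hΔ') (.app .pair ![i, m])
    simp only [PrimeTheory.ev_app_two, Formula.instN_def, colorFormula_subst, FTerm.subst_var,
      Term.shiftN_instσ, Term.subst_var, Term.subst_app_one, FTerm.fst_subst, FTerm.snd_subst,
      Term.var_subst, instσ_zero] at h₁
    refine ⟨h₁.1, h₁.2.trans ⟨fun h => ?_, fun h => ?_⟩⟩
    · exact P.holds_colorFormula_congr (by simp) (by simp) h
    · exact P.holds_colorFormula_congr (by simp) (by simp) h
  have hc' : ∀ m, P.ap c ![P.ap .pair ![P.ev i, P.ev m]] ≠ 0 → P.Holds (colorFormula E k i m) :=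
    fun m hm => (hc m).2.1 ((hc m).1.resolve_left hm)
  have hkP := hk.holds (hP.mono fun _ hφ => hΔ' (hΔ hφ))
  rw [PrimeTheory.holds_lt] at hkP
  have hzero : ∀ m, P.ev m = 0 → P.Holds (colorFormula E k i m) := by
    intro m hm
    refine P.holds_colorFormula_congr (i := i) (m := .zero) rfl (by simp [hm]) ?_
    refine PrimeTheory.holds_colorFormula_of_no_edge (Γ := []) (fun Q _ a b hb hab => ?_)
      P P.models_nil hkP
    rw [PrimeTheory.ev_zero, nonpos_iff_eq_zero] at hb
    rw [hb] at hab
    exact absurd hab not_lt_zero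
  have hG : P.ap (.comp .pred ![g]) ![P.ev i] = P.ap .pred ![P.ap g ![P.ev i]] := by simp
  rw [hG]
  constructor
  · intro h₀ m
    by_cases hgi : P.ap g ![P.ev i] = 0
    · exact hc' m ((hg P hP _).1 hgi _)
    -- Here LPO would report the first zero of `c` at `m = 0`, against the colorability of `G_0`.
    · have h₁ := ((hg P hP _).2 hgi).1
      rw [h₀, ← PrimeTheory.ev_zero] at h₁
      have h₂ := (hc .zero).2.2 (hzero _ rfl)
      rw [h₁] at h₂
      exact absurd h₂ zero_ne_one
  · intro h₀
    have hgi : P.ap g ![P.ev i] ≠ 0 := by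
      intro hgi
      rw [hgi] at h₀
      exact h₀ P.ap_pred_zero
    refine ⟨fun hcol => ?_, fun m hm => hc' m (((hg P hP _).2 hgi).2 _ hm)⟩
    have h₁ := (hc _).2.2 hcol
    rw [PrimeTheory.ev_app_one, hG, ((hg P hP _).2 hgi).1] at h₁
    exact zero_ne_one h₁

/-! ### The limited principle of omniscience from colorings -/

/-- The sequence of graphs in which `a < b` are adjacent in the `i`-th graph iff `f_i(t) = 0` for
some `t ≤ a`. -/
def FTerm.zeroGraph (F : FTerm 1) : FTerm 1 :=
  .comp (.search F.swapEntry) ![.comp .succ ![.comp .fst ![.snd]], .fst]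

/-- The code of the edge `a < b` is also the Cantor code of `(a, b - a - 1)`, so `fst` recovers the
smaller endpoint. -/
theorem PrimeTheory.ap_zeroGraph (P : PrimeTheory T) (F : FTerm 1) {i a b : P.Num} (h : a < b) :
    P.ap F.zeroGraph ![P.ap .pair ![i, P.ap .edgeCode ![a, b]]] =
      P.ap (.search F.swapEntry) ![a + 1, i] := by
  obtain ⟨c, rfl⟩ := P.le_iff'.1 (P.lt_iff_add_one_le.1 h)
  rw [show a + 1 + c = a + c + 1 by ring, ap_edgeCode_add]
  simp [FTerm.zeroGraph]

/-- If `f_i(n) = 0`, any two vertices from `n` to `n + k` are adjacent, so a coloring would be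
injective on `k + 1` vertices. -/
theorem Deriv.not_colorable {F : FTerm 1} {k i n : Term} :
    Deriv T [colorFormula F.zeroGraph k i (.app .add ![n, k]), .lt .zero k,
      .eq (.app F ![.app .pair ![i, n]]) .zero] .bot := by
  refine (Deriv.hyp (φ := colorFormula F.zeroGraph k i (.app .add ![n, k]))
    (by simp)).exN_elim fun s Δ hΔ hs => Deriv.complete fun P hP => ?_
  refine (PrimeTheory.pigeonhole (k := k) (s := s) (n := n)
    (fun Q hQ x y hxy hy => ?_) P hP ?_).elim
  · have h₀ : Q.Holds (.eq (.app F ![.app .pair ![i, n]]) .zero) := hQ _ (hΔ (by simp))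
    have hlt := add_lt_add_right hxy (Q.ev n)
    refine Q.holds_colorMatrix (hs.holds hQ) ?_ hlt ?_
    · simpa using hy
    · rw [Q.ap_zeroGraph F hlt]
      refine PrimeTheory.search_ne_zero Q F.swapEntry (x := Q.ev n) ?_ ?_
      · rw [Q.lt_add_one_iff']; exact le_self_add
      · simpa using h₀
  · simpa using hP _ (hΔ (List.mem_cons_of_mem _ List.mem_cons_self))

/-- The solution `g` for the graphs `F.zeroGraph` is itself the bound asked for by `isLPO_of_bound`.
-/
theorem Deriv.lpo_of_lg {k : Term} (h : Deriv T Γ (LGhatAt.instN k))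
    (hk : Deriv T Γ (.lt .zero k)) : Deriv T Γ LPOhat := by
  refine Deriv.allF_intro fun F => ?_
  change Deriv T Γ ((Formula.exF (.allN LPOhatMatrix)).instF F)
  refine h.lg_elim F.zeroGraph fun g Δ hΔ hg =>
    (isLPO_of_bound (b := g) fun P hP i n hn hsearch => ?_).deriv
  obtain ⟨i, rfl⟩ := P.exists_ev i
  obtain ⟨n, rfl⟩ := P.exists_ev n
  have hkP := hk.holds (hP.mono hΔ)
  by_cases hgi : P.ap g ![P.ev i] = 0
  -- The answer `0` makes all `G_m` colorable, in particular `G_(n+k)`, which contains the clique.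
  · refine P.not_bot ((Deriv.not_colorable (F := F) (k := k) (i := i) (n := n)).holds ?_)
    simp only [PrimeTheory.Models, List.forall_mem_cons]
    exact ⟨(hg P hP i).1 hgi _, hkP, by simpa using hn, by simp⟩
  -- A failed search for zeros up to `g(i)` leaves `G_(g(i))` without edges, hence colorable. The
  -- failure enters as context because edges must be absent in all prime theories over it.
  · refine ((hg P hP i).2 hgi).1 (PrimeTheory.holds_colorFormula_of_no_edge
      (Γ := [.eq (.app (.search F.swapEntry) ![.succ (.app g ![i]), i]) .zero])
      (fun Q hQ a b hb hab => ?_) P ?_ (by simpa using hkP))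
    · have h₀ := hQ _ List.mem_cons_self
      simp only [PrimeTheory.holds_eq, PrimeTheory.ev_app_two, PrimeTheory.ev_app_one,
        PrimeTheory.ev_succ, PrimeTheory.ev_zero] at h₀ hb
      rw [Q.ap_zeroGraph F hab]
      by_contra hne
      exact Q.search_mono F.swapEntry (by simpa using hab.le.trans hb) hne h₀
    · simpa [PrimeTheory.Models] using hsearch

/-! ### The equivalences -/

@[simp] theorem FTerm.shiftF_var (v : ℕ) : (FTerm.var v).shiftF = .var (v + 1) := rfl

theorem LPOhat_subst (σ : ℕ → Term) (τ : ℕ → FTerm 1) : LPOhat.subst σ τ = LPOhat := by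
  simp [LPOhat, Formula.subst, Term.fn, Term.entry]

theorem Term.numeral_subst (k : ℕ) (σ : ℕ → Term) (τ : ℕ → FTerm 1) :
    (Term.numeral k).subst σ τ = .numeral k := by
  induction k with
  | zero => exact Term.subst_zero _ _
  | succ k ih => rw [Term.numeral, Term.subst_succ, ih]

theorem LGhatAt_subst (σ : ℕ → Term) (τ : ℕ → FTerm 1) :
    LGhatAt.subst (liftN σ) τ = LGhatAt := by
  have : ∀ k v i m, colorable k v i m = colorFormula (.var v) k i m := fun _ _ _ _ => rfl
  simp [LGhatAt, Formula.subst, Term.fn, this, colorFormula_subst, Formula.neg_subst]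

theorem LGhat_subst (k : ℕ) (σ : ℕ → Term) (τ : ℕ → FTerm 1) : (LGhat k).subst σ τ = LGhat k := by
  rw [LGhat, Formula.instN_subst, Term.numeral_subst, LGhatAt_subst]

theorem Deriv.zero_lt_numeral {k : ℕ} (hk : 1 ≤ k) : Deriv T Γ (.lt .zero (.numeral k)) := by
  obtain ⟨k, rfl⟩ := Nat.exists_eq_succ_of_ne_zero (Nat.one_le_iff_ne_zero.1 hk)
  exact Deriv.complete fun P _ => by simp [Term.numeral, pos_iff_ne_zero, P.add_one_ne_zero']

theorem equivOver_ACA_LPOhat : EquivOver iRCA₀ ACA {LPOhat} := by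
  have := isTheory_union_singleton LPOhat_subst
  constructor
  · rintro _ rfl
    exact Deriv.lpo_of_comprehension fun φ hφ => .ax (Or.inr ⟨φ, hφ, rfl⟩)
  · rintro _ ⟨φ, hφ, rfl⟩
    have := (Deriv.ax (T := iRCA₀ ∪ {LPOhat}) (Γ := []) (Or.inr rfl)).comprehension_of_lpo hφ
      .var .var
    rwa [Formula.subst_var] at this

theorem equivOver_LPOhat_LGhat {k : ℕ} (hk : 1 ≤ k) : EquivOver iRCA₀ {LPOhat} {LGhat k} := by
  have := isTheory_union_singleton LPOhat_subst
  have := isTheory_union_singleton (LGhat_subst k)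
  constructor
  · rintro _ rfl
    exact (Deriv.ax (Or.inr rfl)).lg_of_lpo (.zero_lt_numeral hk)
  · rintro _ rfl
    exact Deriv.lpo_of_lg (k := .numeral k) (.ax (Or.inr rfl)) (.zero_lt_numeral hk)

theorem equivOver_ACA_LGhat {k : ℕ} (hk : 1 ≤ k) : EquivOver iRCA₀ ACA {LGhat k} := by
  have := isTheory_union_singleton (LGhat_subst k)
  constructor
  · rintro _ rfl
    exact (Deriv.lpo_of_comprehension fun φ hφ => .ax (Or.inr ⟨φ, hφ, rfl⟩)).lg_of_lpo
      (.zero_lt_numeral hk)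
  · rintro _ ⟨φ, hφ, rfl⟩
    have h : Deriv (iRCA₀ ∪ {LGhat k}) [] LPOhat :=
      Deriv.lpo_of_lg (k := .numeral k) (.ax (Or.inr rfl)) (.zero_lt_numeral hk)
    have := h.comprehension_of_lpo hφ .var .var
    rwa [Formula.subst_var] at this

/-- Both directions were proved for an arbitrary term `k` with `0 < k` derivable, so `k` may be a
variable. -/
theorem provable_forall_LPOhat_iff_LGhatAt :
    Provable iRCA₀ (.allN (.imp (.lt .zero (.var 0)) (.iff LPOhat LGhatAt))) := by
  refine Deriv.allN_intro fun k => ?_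
  have hinst : (Formula.imp (.lt .zero (.var 0)) (.iff LPOhat LGhatAt)).instN k =
      .imp (.lt .zero k) (.iff LPOhat (LGhatAt.instN k)) := by
    simp [Formula.instN_def, Formula.subst, Formula.iff, LPOhat_subst]
  rw [hinst]
  refine .impI (.andI (.impI ?_) (.impI ?_))
  · exact (Deriv.hyp (φ := LPOhat) (by simp)).lg_of_lpo (.hyp (by simp))
  · exact (Deriv.hyp (φ := LGhatAt.instN k) (by simp)).lpo_of_lg (.hyp (by simp))

end SecondOrder

theorem mainTheorem3 :
    SecondOrder.EquivOver SecondOrder.iRCA₀ SecondOrder.ACA {SecondOrder.LPOhat} ∧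
    (∀ k : ℕ, 1 ≤ k →
      SecondOrder.EquivOver SecondOrder.iRCA₀ {SecondOrder.LPOhat} {SecondOrder.LGhat k} ∧
      SecondOrder.EquivOver SecondOrder.iRCA₀ SecondOrder.ACA {SecondOrder.LGhat k}) ∧
    SecondOrder.Provable SecondOrder.iRCA₀
      (.allN (.imp (.lt .zero (.var 0)) (.iff SecondOrder.LPOhat SecondOrder.LGhatAt))) :=
  ⟨SecondOrder.equivOver_ACA_LPOhat, fun _ hk => ⟨SecondOrder.equivOver_LPOhat_LGhat hk,
    SecondOrder.equivOver_ACA_LGhat hk⟩, SecondOrder.provable_forall_LPOhat_iff_LGhatAt⟩
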